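/- Let $k$ be a field that is complete with respect to a non-trivial non-Archimedean absolute value $|\cdot|$, let $X$ be an integral projective $k$-scheme, $Y\subseteq X$ a non-empty reduced closed subscheme, and $L$ an ample invertible $\mathcal O_X$-module. Write $X^{\mathrm{an}}$ for the Berkovich analytification of $X$ and $\widehat\kappa(x)$ for the completed residue field of $x\in X^{\mathrm{an}}$. Put $V_n(L)=H^0(X,L^{\otimes n})$, $V_\bullet(L)=\bigoplus_{n\ge 0}V_n(L)$, and let $V_\bullet(L_{X|Y})$ be the image of the restriction homomorphism $V_\bullet(L)\to V_\bullet(L|_Y)$. A metric $\phi$ on $L$ is a family of norms $|\cdot|_\phi(x)$ on the one-dimensional $\widehat\kappa(x)$-vector spaces $L(x)$, $x\in X^{\mathrm{an}}$; it induces metrics $n\phi$ on $L^{\otimes n}$ and, by restriction, $\phi|_Y$ on $L|_Y$. For a norm $\|\cdot\|_n$ on $V_n(L)$ with $L^{\otimes n}$ globally generated, the Fubini–Study metric $\mathrm{FS}(\|\cdot\|_n)$ on $L^{\otimes n}$ is given at $x$ by the quotient norm, under the evaluation map $V_n(L)\otimes_k\widehat\kappa(x)\to L^{\otimes n}(x)$,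 of the scalar extension $\|w\|_{n,\widehat\kappa(x)}=\sup_{0\ne\ell\in V_n(L)^\vee}|(\ell\otimes 1)(w)|/\|\ell\|_n^\vee$, where $\|\ell\|_n^\vee=\sup_{v\ne0}|\ell(v)|/\|v\|_n$. Let $\frac1n\mathrm{FS}(\|\cdot\|_n)$ be the metric on $L$ whose $n$-th tensor power is $\mathrm{FS}(\|\cdot\|_n)$. The metric $\phi$ is called asymptotic Fubini–Study if there are norms $\|\cdot\|_n$ on $V_n(L)$, $n\in\mathbb N$, such that $\frac1n\mathrm{FS}(\|\cdot\|_n)$ (which is defined for all large $n$) converges to $\phi$ uniformly on $X^{\mathrm{an}}$, i.e. $\sup_{x\in X^{\mathrm{an}}}\bigl|\log\bigl(|\cdot|_{\frac1n\mathrm{FS}(\|\cdot\|_n)}(x)/|\cdot|_{\phi}(x)\bigr)\bigr|\to 0$. Let $\phi$ be an asymptotic Fubini–Study metric on $L$. For $\underline s=(s_n)_n\in V_\bullet(L)$ put $|||\underline s|||_\phi=\sup_n\sup_{x\in X^{\mathrm{an}}}|s_n|_{n\phi}(x)$, and define on $V_\bullet(L_{X|Y})$ $$|||\underline t|||_{\phi,X|Y}=\inf\{|||\underline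 s|||_\phi:\ \underline s\in V_\bullet(L),\ \underline s|_Y=\underline t\},\qquad |||\underline t|||_{\phi|_Y}=\sup_n\sup_{y\in Y^{\mathrm{an}}}|t_n|_{n\phi|_Y}(y).$$ Then both are (finite) $k$-algebra norms on $V_\bullet(L_{X|Y})$ taking the value $1$ at the unit, and the spectral seminorm of the first is the second: $$\lim_{n\to\infty}|||\underline t^{\,n}|||_{\phi,X|Y}^{1/n}=|||\underline t|||_{\phi|_Y}\qquad\text{for all }\underline t\in V_\bullet(L_{X|Y}).$$ Moreover, if $\widehat V_\bullet(L_{X|Y},\phi_{X|Y})$ and $\widehat V_\bullet(L_{X|Y},\phi|_Y)$ denote the Banach $k$-algebras obtained by completing $V_\bullet(L_{X|Y})$ for these two norms, there is a canonical homeomorphism of Berkovich spectra $$\mathfrak M(\widehat V_\bullet(L_{X|Y},\phi_{X|Y}))\simeq\mathfrak M(\widehat V_\bullet(L_{X|Y},\phi|_Y)),$$ namely one under which corresponding multiplicative seminorms have the same restriction to $V_\bullet(L_{X|Y})$. -/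

import Mathlib

open CategoryTheory AlgebraicGeometry Opposite TopologicalSpace
open scoped DirectSum TensorProduct ENNReal Topology

universe u

noncomputable section

namespace NormedSections

/-! ### Schemes over a field -/

section Structure

variable (k : Type u) [CommRing k] {X : Scheme.{u}} [X.Over (Spec (CommRingCat.of k))]

/-- The ring homomorphism `k → Γ(X, U)` of a scheme over `Spec k`. -/
def structureHom (U : X.Opens) : k →+* Γ(X, U) :=
  ((X ↘ Spec (CommRingCat.of k)).appLE ⊤ U le_top).hom.comp
    (Scheme.ΓSpecIso (CommRingCat.of k)).inv.hom

instance algebraSections (U : X.Opens) : Algebra k Γ(X, U) :=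
  (structureHom k U).toAlgebra

/-- The ring homomorphism from `k` to the residue field of a point of a `k`-scheme. -/
def residueHom (x : X) : k →+* X.residueField x :=
  (X.evaluation ⊤ x trivial).hom.comp (structureHom k ⊤)

theorem map_structureHom {U V : X.Opens} (h : V ≤ U) (a : k) :
    X.presheaf.map (homOfLE h).op (structureHom k U a) = structureHom k V a := by
  have := (X ↘ Spec (CommRingCat.of k)).appLE_map (U := ⊤) (V := U) le_top (homOfLE h).op
  simp only [structureHom, RingHom.comp_apply]
  rw [← this]
  rfl

theorem evaluation_structureHom (U : X.Opens) (x : X) (hx : x ∈ U) (a : k) :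
    X.evaluation U x hx (structureHom k U a) = residueHom k x a := by
  rw [residueHom, RingHom.comp_apply, ← map_structureHom k (le_top : U ≤ ⊤)]
  have := X.presheaf.germ_res_apply (homOfLE (le_top : U ≤ ⊤)) x hx (structureHom k ⊤ a)
  exact congrArg (X.residue x) this

theorem app_structureHom {Y : Scheme.{u}} [Y.Over (Spec (CommRingCat.of k))] (f : Y ⟶ X)
    [f.IsOver (Spec (CommRingCat.of k))] (U : X.Opens) (a : k) :
    f.app U (structureHom k U a) = structureHom k (f ⁻¹ᵁ U) a := by
  have h : f ≫ (X ↘ Spec (CommRingCat.of k)) = Y ↘ Spec (CommRingCat.of k) :=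
    comp_over f (Spec (CommRingCat.of k))
  simp only [structureHom, RingHom.comp_apply, ← h]
  rw [← Scheme.Hom.appLE_comp_appLE f (X ↘ Spec (CommRingCat.of k)) ⊤ U (f ⁻¹ᵁ U) le_top le_rfl,
    Scheme.Hom.app_eq_appLE]
  rfl

end Structure

section Projective

attribute [local instance] MvPolynomial.gradedAlgebra

/-- `X` is projective over `k`: it is isomorphic, over `k`, to a closed subscheme of some
projective space `Proj k[T₀, …, T_N]`. -/
def IsProjectiveOver (k : Type u) [CommRing k] (X : Scheme.{u})
    [X.Over (Spec (CommRingCat.of k))] : Prop :=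
  ∃ (N : ℕ) (j : X ⟶ Proj (MvPolynomial.homogeneousSubmodule (Fin (N + 1)) k)),
    IsClosedImmersion j ∧
      j ≫ Proj.toSpecZero (MvPolynomial.homogeneousSubmodule (Fin (N + 1)) k) ≫
        Spec.map (CommRingCat.ofHom (algebraMap k
          (MvPolynomial.homogeneousSubmodule (Fin (N + 1)) k 0))) =
      X ↘ Spec (CommRingCat.of k)

end Projective

/-! ### Invertible modules -/

/-- A line bundle on `X` given by an open cover `U i` with frames `e i` on `U i` and
transition functions `g i j` on `U i ∩ U j`, the convention being `e j = g i j • e i`. -/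
structure LineBundle (X : Scheme.{u}) where
  ι : Type u
  U : ι → X.Opens
  covers : ∀ x : X, ∃ i, x ∈ U i
  g : ∀ i j, Γ(X, U i ⊓ U j)
  g_self : ∀ i, g i i = 1
  g_trans : ∀ i j l,
    X.presheaf.map (homOfLE (inf_le_left : U i ⊓ U j ⊓ U l ≤ U i ⊓ U j)).op (g i j) *
      X.presheaf.map (homOfLE (le_inf (inf_le_left.trans inf_le_right) inf_le_right :
        U i ⊓ U j ⊓ U l ≤ U j ⊓ U l)).op (g j l) =
      X.presheaf.map (homOfLE (le_inf (inf_le_left.trans inf_le_left) inf_le_right :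
        U i ⊓ U j ⊓ U l ≤ U i ⊓ U l)).op (g i l)

section Modules

variable {X : Scheme.{u}} (M : X.Modules)

/-- The restriction of a section of an `𝒪_X`-module to a smaller open subset. -/
def restr {U V : X.Opens} (h : V ≤ U) (e : Γ(M, U)) : Γ(M, V) :=
  M.presheaf.map (homOfLE h).op e

/-- `e` is a frame of `M` on `U`: multiplication by `e` is an isomorphism `𝒪_U → M|_U`. -/
def IsFrame (U : X.Opens) (e : Γ(M, U)) : Prop :=
  ∀ (V : X.Opens) (h : V ≤ U),
    Function.Bijective (fun f : Γ(X, V) => f • restr M h e)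

/-- `M` is an invertible `𝒪_X`-module: it is locally isomorphic to `𝒪_X`. -/
def IsInvertible : Prop :=
  ∀ x : X, ∃ (U : X.Opens) (e : Γ(M, U)), x ∈ U ∧ IsFrame M U e

/-- The type of all local frames of `M`. -/
structure Frame where
  U : X.Opens
  e : Γ(M, U)
  isFrame : IsFrame M U e

variable {M}

theorem restr_restr {U V W : X.Opens} (h : V ≤ U) (h' : W ≤ V) (e : Γ(M, U)) :
    restr M h' (restr M h e) = restr M (h'.trans h) e := by
  have h := M.presheaf.map_comp (homOfLE h).op (homOfLE h').op
  exact (congrArg (fun φ => φ e) h).symm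

theorem restr_smul {U V : X.Opens} (h : V ≤ U) (f : Γ(X, U)) (e : Γ(M, U)) :
    restr M h (f • e) = X.presheaf.map (homOfLE h).op f • restr M h e :=
  M.map_smul _ _ _

/-- The function `g` with `b.e = g • a.e` on the intersection of the domains of `a` and `b`. -/
def Frame.transition (a b : Frame M) : Γ(X, a.U ⊓ b.U) :=
  ((a.isFrame (a.U ⊓ b.U) inf_le_left).2 (restr M inf_le_right b.e)).choose

theorem Frame.transition_smul (a b : Frame M) :
    a.transition b • restr M inf_le_left a.e =
      restr M (inf_le_right : a.U ⊓ b.U ≤ b.U) b.e :=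
  ((a.isFrame (a.U ⊓ b.U) inf_le_left).2 (restr M inf_le_right b.e)).choose_spec

variable (M)

/-- The line bundle of an invertible module, described by all of its local frames. -/
def lineBundle (hM : IsInvertible M) : LineBundle X where
  ι := Frame M
  U := Frame.U
  covers x := by
    obtain ⟨U, e, hx, he⟩ := hM x
    exact ⟨⟨U, e, he⟩, hx⟩
  g a b := a.transition b
  g_self a := by
    apply (a.isFrame _ inf_le_left).1
    simp only [one_smul]
    exact a.transition_smul a
  g_trans a b c := by
    apply (a.isFrame (a.U ⊓ b.U ⊓ c.U) (inf_le_left.trans inf_le_left)).1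
    have hab := congrArg (restr M (inf_le_left : a.U ⊓ b.U ⊓ c.U ≤ a.U ⊓ b.U))
      (a.transition_smul b)
    have hbc := congrArg (restr M (le_inf (inf_le_left.trans inf_le_right) inf_le_right :
        a.U ⊓ b.U ⊓ c.U ≤ b.U ⊓ c.U)) (b.transition_smul c)
    have hac := congrArg (restr M (le_inf (inf_le_left.trans inf_le_left) inf_le_right :
        a.U ⊓ b.U ⊓ c.U ≤ a.U ⊓ c.U)) (a.transition_smul c)
    simp only [restr_smul, restr_restr] at hab hbc hac
    simp only
    rw [hac, mul_comm, mul_smul, hab, hbc]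

end Modules

namespace LineBundle

variable {X Y : Scheme.{u}}

theorem app_map (f : Y ⟶ X) {U V : X.Opens} (h : V ≤ U) (a : Γ(X, U)) :
    f.app V (X.presheaf.map (homOfLE h).op a) =
      Y.presheaf.map (homOfLE (f.preimage_mono h)).op (f.app U a) :=
  congrArg (fun φ => φ a) (f.naturality (homOfLE h).op)

/-- The pull-back of a line bundle along a morphism of schemes. -/
def pullback (L : LineBundle X) (f : Y ⟶ X) : LineBundle Y where
  ι := L.ι
  U i := f ⁻¹ᵁ L.U i
  covers y := L.covers (f y)
  g i j := f.app (L.U i ⊓ L.U j) (L.g i j)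
  g_self i := by rw [L.g_self]; exact map_one _
  g_trans i j l := by
    have h := congrArg (f.app (L.U i ⊓ L.U j ⊓ L.U l)) (L.g_trans i j l)
    rw [map_mul, app_map, app_map, app_map] at h
    exact h

section Sections

variable (k : Type u) [CommRing k] [X.Over (Spec (CommRingCat.of k))] (L : LineBundle X)

/-- The space `V_n(L) = H⁰(X, L^{⊗ n})`. A section `s` is given by its coordinates `s i` on
`U i` with respect to the frames `e i ^ n`; they satisfy `s i = (g i j) ^ n * s j`. -/
def sections (n : ℕ) : Submodule k (∀ i, Γ(X, L.U i)) where
  carrier := {s | ∀ i j,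
    X.presheaf.map (homOfLE (inf_le_left : L.U i ⊓ L.U j ≤ L.U i)).op (s i) =
      L.g i j ^ n * X.presheaf.map (homOfLE (inf_le_right : L.U i ⊓ L.U j ≤ L.U j)).op (s j)}
  add_mem' {s t} hs ht i j := by
    simp only [Pi.add_apply, map_add, hs i j, ht i j, mul_add]
  zero_mem' i j := by simp
  smul_mem' a s hs i j := by
    simp only [Pi.smul_apply, Algebra.smul_def, map_mul, hs i j]
    have h (U V : X.Opens) (h : V ≤ U) :
      X.presheaf.map (homOfLE h).op (algebraMap k Γ(X, U) a) = algebraMap k Γ(X, V) a :=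
      map_structureHom k h a
    rw [h, h]
    ring

instance gradedMonoid : SetLike.GradedMonoid (L.sections k) where
  one_mem i j := by simp
  mul_mem m n s t hs ht i j := by
    simp only [Pi.mul_apply, map_mul, hs i j, ht i j]
    ring

/-- The graded `k`-algebra `V_•(L) = ⨁ₙ V_n(L)`. -/
def SectionAlgebra : Type u := ⨁ n, L.sections k n

instance : CommRing (L.SectionAlgebra k) :=
  inferInstanceAs (CommRing (⨁ n, L.sections k n))

instance : Algebra k (L.SectionAlgebra k) :=
  inferInstanceAs (Algebra k (⨁ n, L.sections k n))

variable {k L}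

/-- The homogeneous component of degree `n`. -/
def SectionAlgebra.component (s : L.SectionAlgebra k) (n : ℕ) : L.sections k n :=
  DirectSum.component k ℕ (fun n => L.sections k n) n s

/-- The open set `X_s` where a section `s` of `L^{⊗ n}` does not vanish. -/
def nonvanishing {n : ℕ} (s : L.sections k n) : X.Opens :=
  ⨆ i, X.basicOpen (s.1 i)

variable (k L)

/-- `L` is ample: the non-vanishing loci `X_s` that are affine, with `s` a global section of some
`L^{⊗ n}`, `n ≥ 1`, cover `X` (for `X` quasi-compact). -/
def IsAmple : Prop :=
  CompactSpace X ∧ ∀ x : X, ∃ n : ℕ, 0 < n ∧ ∃ s : L.sections k n,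
    x ∈ nonvanishing s ∧ IsAffineOpen (nonvanishing s)

variable [Y.Over (Spec (CommRingCat.of k))] (f : Y ⟶ X) [f.IsOver (Spec (CommRingCat.of k))]

/-- The pull-back `V_n(L) → V_n(f^* L)` of sections. -/
def sectionsPullback (n : ℕ) : L.sections k n →ₗ[k] (L.pullback f).sections k n where
  toFun s := ⟨fun i => f.app (L.U i) (s.1 i), fun i j => by
    have h := congrArg (f.app (L.U i ⊓ L.U j)) (s.2 i j)
    rw [map_mul, map_pow, app_map, app_map] at h
    exact h⟩
  map_add' s t := by
    ext i
    exact map_add (f.app (L.U i)).hom (s.1 i) (t.1 i)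
  map_smul' a s := by
    ext i
    refine (map_mul (f.app (L.U i)).hom (structureHom k (L.U i) a) (s.1 i)).trans ?_
    exact congrArg (· * _) (app_structureHom k f (L.U i) a)

/-- The homomorphism of graded `k`-algebras `V_•(L) → V_•(f^* L)`. -/
def algebraPullback : L.SectionAlgebra k →ₐ[k] (L.pullback f).SectionAlgebra k :=
  DirectSum.toAlgebra k (fun n => L.sections k n)
    (B := ⨁ n, (L.pullback f).sections k n)
    (fun n => DirectSum.lof k ℕ (fun n => (L.pullback f).sections k n) n ∘ₗ
      L.sectionsPullback k f n)
    (by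
      refine congrArg (DirectSum.lof k ℕ (fun n => (L.pullback f).sections k n) 0) ?_
      ext i
      exact map_one (f.app (L.U i)).hom)
    (fun {m n} s t => by
      simp only [LinearMap.comp_apply, DirectSum.lof_eq_of, DirectSum.of_mul_of]
      congr 1
      ext i
      exact map_mul (f.app (L.U i)).hom (s.1 i) (t.1 i))

/-- The restricted section algebra `V_•(L_{X|Y})`, the image of `V_•(L) → V_•(L|_Y)`. -/
abbrev RestrictedAlgebra : Subalgebra k ((L.pullback f).SectionAlgebra k) :=
  (L.algebraPullback k f).range

end Sections

end LineBundle

/-! ### Berkovich analytification -/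

section Analytification

variable (k : Type u) [NormedField k] (X : Scheme.{u}) [X.Over (Spec (CommRingCat.of k))]

/-- A point of the Berkovich analytification of `X`: a point of `X` together with an absolute
value on its residue field that extends the absolute value of `k`. -/
structure Analytification where
  pt : X
  abs : AbsoluteValue (X.residueField pt) ℝ
  abs_residueHom : ∀ a : k, abs (residueHom k pt a) = ‖a‖

namespace Analytification

variable {k X}

/-- The value `|f|(x)` of a regular function at a point of the analytification. -/
def absEval (x : Analytification k X) {U : X.Opens} (hx : x.pt ∈ U) (f : Γ(X, U)) : ℝ :=
  x.abs (X.evaluation U x.pt hx f)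

theorem absEval_mul (x : Analytification k X) {U : X.Opens} (hx : x.pt ∈ U) (f g : Γ(X, U)) :
    x.absEval hx (f * g) = x.absEval hx f * x.absEval hx g := by
  simp [absEval]

theorem absEval_pow (x : Analytification k X) {U : X.Opens} (hx : x.pt ∈ U) (f : Γ(X, U))
    (n : ℕ) : x.absEval hx (f ^ n) = x.absEval hx f ^ n := by
  simp [absEval]

theorem absEval_restrict (x : Analytification k X) {U V : X.Opens} (h : V ≤ U) (hx : x.pt ∈ V)
    (f : Γ(X, U)) :
    x.absEval hx (X.presheaf.map (homOfLE h).op f) = x.absEval (h hx) f :=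
  congrArg (fun a => x.abs (X.residue x.pt a))
    (X.presheaf.germ_res_apply (homOfLE h) x.pt hx f)

/-- The Berkovich topology: the coarsest one for which, for each Zariski open subset `U` and each
regular function `f` on `U`, the set `U^an` is open and `|f|` is continuous on it. -/
instance : TopologicalSpace (Analytification k X) :=
  TopologicalSpace.generateFrom
    {S | ∃ (U : X.Opens) (f : Γ(X, U)) (p q : ℝ),
      S = {x | ∃ hx : x.pt ∈ U, p < x.absEval hx f ∧ x.absEval hx f < q}}

/-- The completed residue field of a point of the analytification. -/
abbrev CompletedResidueField (x : Analytification k X) : Type u := x.abs.Completion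

/-- The homomorphism from the residue field to its completion. -/
def toCompleted (x : Analytification k X) :
    X.residueField x.pt →+* x.CompletedResidueField :=
  (UniformSpace.Completion.coeRingHom (α := WithAbs x.abs)).comp
    (WithAbs.equiv x.abs).symm.toRingHom

instance (x : Analytification k X) : Algebra k x.CompletedResidueField :=
  (x.toCompleted.comp (residueHom k x.pt)).toAlgebra

/-- The map of analytifications induced by a morphism of `k`-schemes. -/
def map {Y : Scheme.{u}} [Y.Over (Spec (CommRingCat.of k))] (f : Y ⟶ X)
    [f.IsOver (Spec (CommRingCat.of k))] (y : Analytification k Y) : Analytification k X where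
  pt := f y.pt
  abs := y.abs.comp (f := (f.residueFieldMap y.pt).hom) (RingHom.injective _)
  abs_residueHom a := by
    have hy : f y.pt ∈ (⊤ : X.Opens) := trivial
    have h := y.abs_residueHom a
    rw [← evaluation_structureHom k (f ⁻¹ᵁ ⊤) y.pt hy, ← app_structureHom k f ⊤ a] at h
    exact (congrArg y.abs (Scheme.evaluation_naturality_apply f y.pt hy _)).trans h

theorem absEval_map {Y : Scheme.{u}} [Y.Over (Spec (CommRingCat.of k))] (f : Y ⟶ X)
    [f.IsOver (Spec (CommRingCat.of k))] (y : Analytification k Y) {U : X.Opens}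
    (hy : f y.pt ∈ U) (a : Γ(X, U)) :
    (y.map f).absEval hy a = y.absEval (U := f ⁻¹ᵁ U) hy (f.app U a) :=
  congrArg y.abs (Scheme.evaluation_naturality_apply f y.pt hy a)

end Analytification

end Analytification

/-! ### Metrics on line bundles -/

namespace LineBundle

variable {k : Type u} [NormedField k] {X : Scheme.{u}} [X.Over (Spec (CommRingCat.of k))]

/-- A metric on `L`: a norm on each line `L(x)`, for `x` in the analytification of `X`. The norm
on the one-dimensional space `L(x)` over the completed residue field is recorded by its values
`|e i|(x) > 0` on the frames, which are subject to `|e j|(x) = |g i j|(x) * |e i|(x)`. -/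
structure Metric (k : Type u) [NormedField k] {X : Scheme.{u}}
    [X.Over (Spec (CommRingCat.of k))] (L : LineBundle X) where
  frameNorm : ∀ (i : L.ι) (x : Analytification k X), x.pt ∈ L.U i → ℝ
  frameNorm_pos : ∀ i x hx, 0 < frameNorm i x hx
  frameNorm_change : ∀ i j x (hi : x.pt ∈ L.U i) (hj : x.pt ∈ L.U j),
    frameNorm j x hj = x.absEval (U := L.U i ⊓ L.U j) ⟨hi, hj⟩ (L.g i j) * frameNorm i x hi

namespace Metric

variable {L : LineBundle X} (φ : Metric k L)

/-- The function `|s|_{nφ}` on the analytification of `X`, for `s` in `V_n(L)`: if `s = f • e ^ n`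
near `x`, with `e` a frame, then `|s|_{nφ}(x) = |f|(x) * |e|_φ(x) ^ n`. -/
def abs {n : ℕ} (s : L.sections k n) (x : Analytification k X) : ℝ :=
  x.absEval (L.covers x.pt).choose_spec (s.1 (L.covers x.pt).choose) *
    φ.frameNorm (L.covers x.pt).choose x (L.covers x.pt).choose_spec ^ n

theorem abs_eq {n : ℕ} (s : L.sections k n) (x : Analytification k X) (i : L.ι)
    (hi : x.pt ∈ L.U i) :
    φ.abs s x = x.absEval hi (s.1 i) * φ.frameNorm i x hi ^ n := by
  have key (j : L.ι) (hj : x.pt ∈ L.U j) :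
      x.absEval hj (s.1 j) * φ.frameNorm j x hj ^ n =
        x.absEval hi (s.1 i) * φ.frameNorm i x hi ^ n := by
    have hx : x.pt ∈ L.U i ⊓ L.U j := ⟨hi, hj⟩
    have h := congrArg (x.absEval hx) (s.2 i j)
    replace h := (x.absEval_restrict inf_le_left hx (s.1 i)).symm.trans h
    rw [x.absEval_mul, x.absEval_pow] at h
    replace h := h.trans (congrArg (_ * ·) (x.absEval_restrict inf_le_right hx (s.1 j)))
    rw [h, φ.frameNorm_change i j x hi hj, mul_pow]
    ring
  exact key _ _

/-- The supremum norm `‖s‖_{nφ}` of `s` in `V_n(L)`. -/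
def supNorm {n : ℕ} (s : L.sections k n) : ℝ≥0∞ :=
  ⨆ x : Analytification k X, ENNReal.ofReal (φ.abs s x)

/-- The supremum algebra norm `|||s|||_φ = supₙ ‖sₙ‖_{nφ}` on `V_•(L)`. -/
def algNorm (s : L.SectionAlgebra k) : ℝ≥0∞ :=
  ⨆ n, φ.supNorm (s.component n)

variable {Y : Scheme.{u}} [Y.Over (Spec (CommRingCat.of k))] (f : Y ⟶ X)
  [f.IsOver (Spec (CommRingCat.of k))]

/-- The pull-back of a metric; for a closed immersion it is the restriction `φ|_Y`. -/
def pullback : Metric k (L.pullback f) where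
  frameNorm i y hy := φ.frameNorm i (y.map f) hy
  frameNorm_pos i y hy := φ.frameNorm_pos i (y.map f) hy
  frameNorm_change i j y hi hj := by
    refine (φ.frameNorm_change i j (y.map f) hi hj).trans ?_
    exact congrArg (· * _) (y.absEval_map f (U := L.U i ⊓ L.U j) ⟨hi, hj⟩ (L.g i j))

/-- The quotient algebra norm `|||·|||_{φ, X|Y}` of `|||·|||_φ` on `V_•(L_{X|Y})`. -/
def quotientAlgNorm (t : L.RestrictedAlgebra k f) : ℝ≥0∞ :=
  ⨅ (s : L.SectionAlgebra k) (_ : L.algebraPullback k f s = t), φ.algNorm s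

end Metric

end LineBundle

/-! ### Fubini–Study metrics -/

section ScalarExtension

variable {k : Type*} [NormedField k] {V : Type*} [AddCommGroup V] [Module k V]

/-- The dual norm on `V^∨` of a norm on a (finite-dimensional) space `V`. -/
def dualNorm (p : Seminorm k V) (l : Module.Dual k V) : ℝ :=
  ⨆ v : V, ‖l v‖ / p v

/-- The scalar extension to `K ⊗ V` of a norm on a (finite-dimensional) space `V`. -/
def scalarExtension (p : Seminorm k V) (K : Type*) [NormedField K] [Algebra k K]
    (w : K ⊗[k] V) : ℝ :=
  ⨆ l : Module.Dual k V,
    ‖((Algebra.linearMap k K).comp l).liftBaseChange K w‖ / dualNorm p l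

end ScalarExtension

namespace LineBundle

variable {k : Type u} [NormedField k] {X : Scheme.{u}} [X.Over (Spec (CommRingCat.of k))]
  (L : LineBundle X)

/-- The coordinate, with respect to the frame `e i ^ n`, of the value at `x` of a section of
`L^{⊗ n}`. -/
def evalAt (n : ℕ) (i : L.ι) (x : Analytification k X) (hx : x.pt ∈ L.U i) :
    L.sections k n →ₗ[k] x.CompletedResidueField where
  toFun s := x.toCompleted (X.evaluation (L.U i) x.pt hx (s.1 i))
  map_add' s t := by simp
  map_smul' a s := by
    have h : X.evaluation (L.U i) x.pt hx ((a • s).1 i) =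
        residueHom k x.pt a * X.evaluation (L.U i) x.pt hx (s.1 i) := by
      rw [← evaluation_structureHom k (L.U i) x.pt hx a]
      exact map_mul (X.evaluation (L.U i) x.pt hx).hom (structureHom k (L.U i) a) (s.1 i)
    rw [h, map_mul]
    rfl

variable {L}

/-- The Fubini–Study metric `FS(‖·‖ₙ)` on `L^{⊗ n}` of a norm on `V_n(L)`, evaluated at the
frame `e i ^ n`: at `x` it is the quotient norm of the scalar extension of `‖·‖ₙ` under the
evaluation map `κ̂(x) ⊗ V_n(L) → L^{⊗ n}(x)`. -/
def fubiniStudy {n : ℕ} (p : Seminorm k (L.sections k n)) (i : L.ι) (x : Analytification k X)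
    (hx : x.pt ∈ L.U i) : ℝ :=
  sInf {r | ∃ w : x.CompletedResidueField ⊗[k] L.sections k n,
    (L.evalAt n i x hx).liftBaseChange x.CompletedResidueField w = 1 ∧
      r = scalarExtension p x.CompletedResidueField w}

/-- `φ` is an asymptotic Fubini–Study metric: there are norms `‖·‖ₙ` on the spaces `V_n(L)` such
that the metrics `(1/n) FS(‖·‖ₙ)` on `L` converge to `φ` uniformly. They are metrics for all
large `n`, when `L^{⊗ n}` is globally generated; this is the condition `0 < FS(‖·‖ₙ)`, because
the infimum over the empty set is `0`. -/
def Metric.IsAsymptoticFubiniStudy (φ : Metric k L) : Prop :=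
  ∃ p : ∀ n, Seminorm k (L.sections k n), (∀ n s, p n s = 0 → s = 0) ∧
    ∀ ε : ℝ, 0 < ε → ∀ᶠ n : ℕ in Filter.atTop, ∀ i x (hx : x.pt ∈ L.U i),
      0 < fubiniStudy (p n) i x hx ∧
      |Real.log (fubiniStudy (p n) i x hx ^ (1 / (n : ℝ)) / φ.frameNorm i x hx)| ≤ ε

end LineBundle

/-! ### Banach algebras -/

section Banach

variable {k : Type*} [NormedField k] {A : Type*} [CommRing A] [Algebra k A]

/-- The algebra `A` equipped with the norm `P`. -/
def WithAlgebraNorm (_ : AlgebraNorm k A) : Type _ := A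

variable (P : AlgebraNorm k A)

instance : NormedCommRing (WithAlgebraNorm P) :=
  { P.toRingNorm.toNormedRing, (inferInstance : CommRing A) with }

instance : NormedAlgebra k (WithAlgebraNorm P) :=
  { (inferInstance : Algebra k A) with
    norm_smul_le := fun a x => (map_smul_eq_mul P a x).le }

/-- The Banach algebra obtained by completing `A` with respect to the algebra norm `P`. -/
abbrev AlgebraCompletion : Type _ := UniformSpace.Completion (WithAlgebraNorm P)

/-- The canonical map of `A` into its completion. -/
def toCompletion (a : A) : AlgebraCompletion P :=
  UniformSpace.Completion.coe' (α := WithAlgebraNorm P) a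

end Banach

/-- The Berkovich spectrum of a Banach `k`-algebra: the bounded multiplicative `k`-algebra
seminorms on it. -/
structure BerkovichSpectrum (k : Type*) [NormedField k] (B : Type*) [NormedCommRing B]
    [NormedAlgebra k B] extends MulRingSeminorm B where
  smul' : ∀ (a : k) (b : B), toFun (a • b) = ‖a‖ * toFun b
  bounded' : ∃ C : ℝ, 0 < C ∧ ∀ b : B, toFun b ≤ C * ‖b‖

namespace BerkovichSpectrum

variable {k : Type*} [NormedField k] {B : Type*} [NormedCommRing B] [NormedAlgebra k B]

/-- The value `|b|_z`. -/
def eval (z : BerkovichSpectrum k B) (b : B) : ℝ := z.toMulRingSeminorm b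

/-- The weakest topology for which all functions `z ↦ |b|_z` are continuous. -/
instance : TopologicalSpace (BerkovichSpectrum k B) :=
  TopologicalSpace.induced eval inferInstance

end BerkovichSpectrum

end NormedSections

end
/-!
The supremum norm over `Y^an` is power-multiplicative and dominated by the quotient norm `P`, so
it is dominated by the spectral seminorm of `P`. For the converse, the maximum principle for
bounded multiplicative seminorms represents the spectral seminorm at a homogeneous element `s` as
`z s`, for some multiplicative seminorm `z ≤ P`. Pulled back to `V_•(L)`, such a `z` is, in
positive degrees, a point of the cone over `X^an`: ampleness provides an affine non-vanishing locus
`X_t` with `z t ≠ 0`, the quotients `z a / z (t ^ m)` form a valuation of the ring of functions of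
`X_t`, and so there are a point `y` and a constant `c > 0` such that `z σ = |σ / e ^ m| (y) * c ^ m`
for `σ` in `V_m(L)`, with `e` a frame at `y`; as `z` kills the kernel of the restriction, `y` lies
on `Y`. Thus `c` is the value at `e` of a norm on the fibre `L(y)` that is dominated by the
supremum norms of `φ`. Since `φ` is a limit of Fubini–Study metrics, which are quotient norms, and
since every map from `V_m(L)` to the completed residue field has image in a subspace of countable
type, over which linear functionals are almost norming, `c` is at most `|e|_φ(y)`. Hence `z s` is
at most `|s|(y)`.

Two algebra norms `Q ≤ P` such that `Q` is the spectral seminorm of `P` bound the same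
multiplicative seminorms, and these are the points of the Berkovich spectra.
-/

noncomputable section

namespace NormedSections

/-! ### The maximum modulus principle -/

section MaximumPrinciple

open Filter

variable {R : Type*} [CommRing R]

/-- The pointwise order on ring seminorms, to which Zorn's lemma is applied. -/
local instance ringSeminormPartialOrder : PartialOrder (RingSeminorm R) :=
  PartialOrder.lift (fun g => ⇑g) DFunLike.coe_injective

theorem exists_tendsto_atBot_of_monotone {ι : Type*} [Preorder ι] [IsCodirectedOrder ι]
    [Nonempty ι] {G : ι → RingSeminorm R} (hG : Monotone G) :
    ∃ N : RingSeminorm R, ∀ x, Tendsto (fun i => G i x) atBot (𝓝 (N x)) := by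
  have lim (x : R) : Tendsto (fun i => G i x) atBot (𝓝 (⨅ i, G i x)) :=
    tendsto_atBot_ciInf (fun _ _ hij => hG hij x)
      ⟨0, Set.forall_mem_range.2 fun i => apply_nonneg (G i) x⟩
  exact ⟨{
    toFun x := ⨅ i, G i x
    map_zero' := by simp only [map_zero, ciInf_const]
    add_le' x y := le_of_tendsto_of_tendsto' (lim _) ((lim x).add (lim y))
      fun i => map_add_le_add (G i) x y
    neg' x := iInf_congr fun i => map_neg_eq_map (G i) x
    mul_le' x y := le_of_tendsto_of_tendsto' (lim _) ((lim x).mul (lim y))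
      fun i => map_mul_le_mul (G i) x y }, lim⟩

/-- `g` is a non-Archimedean power-multiplicative seminorm below `μ` that takes the value `r` at
`t` and for which `t` is a multiplicative element. A minimal such `g` is multiplicative. -/
structure IsPowMulMinorant (μ : R → ℝ) (t : R) (r : ℝ) (g : RingSeminorm R) : Prop where
  isNonarchimedean : IsNonarchimedean g
  map_one : g 1 = 1
  isPowMul : IsPowMul g
  le : ∀ x, g x ≤ μ x
  apply_const : g t = r
  map_const_mul : ∀ x, g (t * x) = g t * g x

namespace IsPowMulMinorant

variable {μ : R → ℝ} {t : R} {r : ℝ} {g : RingSeminorm R}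

theorem of_tendsto {ι : Type*} {l : Filter ι} [l.NeBot] {G : ι → RingSeminorm R}
    (hG : ∀ i, IsPowMulMinorant μ t r (G i)) (lim : ∀ x, Tendsto (fun i => G i x) l (𝓝 (g x))) :
    IsPowMulMinorant μ t r g where
  isNonarchimedean x y := le_of_tendsto_of_tendsto' (lim _) ((lim x).max (lim y))
    fun i => (hG i).isNonarchimedean x y
  map_one := tendsto_nhds_unique (lim 1)
    (tendsto_const_nhds.congr fun i => (hG i).map_one.symm)
  isPowMul x n hn := tendsto_nhds_unique (lim _)
    (((lim x).pow n).congr fun i => ((hG i).isPowMul x hn).symm)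
  le x := le_of_tendsto' (lim x) fun i => (hG i).le x
  apply_const := tendsto_nhds_unique (lim t)
    (tendsto_const_nhds.congr fun i => (hG i).apply_const.symm)
  map_const_mul x := tendsto_nhds_unique (lim _)
    (((lim t).mul (lim x)).congr fun i => ((hG i).map_const_mul x).symm)

theorem exists_isLowerBound_of_isChain {c : Set (RingSeminorm R)} (hc : IsChain (· ≤ ·) c)
    (hne : c.Nonempty) (h : ∀ g ∈ c, IsPowMulMinorant μ t r g) :
    ∃ N, IsPowMulMinorant μ t r N ∧ ∀ g ∈ c, N ≤ g := by
  have : Nonempty c := hne.to_subtype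
  have : IsCodirectedOrder c := ⟨fun a b => (hc.total a.2 b.2).elim
    (fun hab => ⟨a, le_rfl, hab⟩) fun hba => ⟨b, hba, le_rfl⟩⟩
  have hmono : Monotone ((↑) : c → RingSeminorm R) := fun _ _ hab => hab
  obtain ⟨N, hN⟩ := exists_tendsto_atBot_of_monotone hmono
  exact ⟨N, of_tendsto (fun g : c => h g g.2) hN,
    fun g hg x => Monotone.le_of_tendsto (fun _ _ hab => hmono hab x) (hN x) ⟨g, hg⟩⟩

theorem seminormFromConst (h : IsPowMulMinorant μ t r g) {c : R} (hc : g c ≠ 0) :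
    IsPowMulMinorant μ t r (_root_.seminormFromConst h.map_one.le hc h.isPowMul) where
  isNonarchimedean :=
    seminormFromConst_isNonarchimedean h.map_one.le hc h.isPowMul h.isNonarchimedean
  map_one := seminormFromConst_one h.map_one.le hc h.isPowMul
  isPowMul := seminormFromConst_isPowMul h.map_one.le hc h.isPowMul
  le x := (seminormFromConst_le_seminorm h.map_one.le hc h.isPowMul x).trans (h.le x)
  apply_const :=
    (seminormFromConst_apply_of_isMul h.map_one.le hc h.isPowMul h.map_const_mul).trans
      h.apply_const
  map_const_mul := seminormFromConst_isMul_of_isMul h.map_one.le hc h.isPowMul h.map_const_mul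

theorem map_mul_of_minimal (h : Minimal (IsPowMulMinorant μ t r) g) (x y : R) :
    g (x * y) = g x * g y := by
  by_cases hx : g x = 0
  · refine le_antisymm (map_mul_le_mul g x y) ?_
    rw [hx, zero_mul]
    exact apply_nonneg g _
  · have hle w := seminormFromConst_le_seminorm h.prop.map_one.le hx h.prop.isPowMul w
    have heq w : seminormFromConst' x g w = g w :=
      (hle w).antisymm (h.le_of_le (h.prop.seminormFromConst hx) hle w)
    have hmul := seminormFromConst_const_mul h.prop.map_one.le hx h.prop.isPowMul y
    rwa [heq, heq, heq] at hmul

theorem exists_mulRingSeminorm (h : IsPowMulMinorant μ t r g) :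
    ∃ z : MulRingSeminorm R, IsNonarchimedean z ∧ (∀ x, z x ≤ μ x) ∧ z t = r := by
  obtain ⟨m, -, hm⟩ := zorn_le_nonempty₀ (α := (RingSeminorm R)ᵒᵈ)
    {g | IsPowMulMinorant μ t r (OrderDual.ofDual g)}
    (fun c hc hchain g hg => exists_isLowerBound_of_isChain hchain.symm ⟨g, hg⟩ hc) _ h
  have hmin : Minimal (IsPowMulMinorant μ t r) (OrderDual.ofDual m) := hm
  exact ⟨{ OrderDual.ofDual m with
    map_one' := hmin.prop.map_one
    map_mul' := map_mul_of_minimal hmin },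
    hmin.prop.isNonarchimedean, hmin.prop.le, hmin.prop.apply_const⟩

end IsPowMulMinorant

theorem exists_mulRingSeminorm_eq_smoothingFun (μ : RingSeminorm R) (hμ1 : μ 1 ≤ 1)
    (hna : IsNonarchimedean μ) (t : R) (ht : smoothingFun μ t ≠ 0) :
    ∃ z : MulRingSeminorm R, IsNonarchimedean z ∧ (∀ x, z x ≤ μ x) ∧ z t = smoothingFun μ t := by
  let ρ := smoothingSeminorm μ hμ1 hna
  have hρ1 : ρ 1 ≤ 1 := smoothingFun_one_le μ hμ1
  have hρt : ρ t ≠ 0 := ht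
  have hρpm : IsPowMul ρ := isPowMul_smoothingFun μ hμ1
  have hρna : IsNonarchimedean ρ := isNonarchimedean_smoothingFun μ hμ1 hna
  have start : IsPowMulMinorant μ t (ρ t) (seminormFromConst hρ1 hρt hρpm) :=
    { isNonarchimedean := seminormFromConst_isNonarchimedean hρ1 hρt hρpm hρna
      map_one := seminormFromConst_one hρ1 hρt hρpm
      isPowMul := seminormFromConst_isPowMul hρ1 hρt hρpm
      le := fun x =>
        (seminormFromConst_le_seminorm hρ1 hρt hρpm x).trans (smoothingFun_le_self μ x)
      apply_const := seminormFromConst_apply_c hρ1 hρt hρpm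
      map_const_mul := seminormFromConst_const_mul hρ1 hρt hρpm }
  exact start.exists_mulRingSeminorm

end MaximumPrinciple

/-! ### Spectra of completions -/

section MulRingSeminorm

/-- The multiplicative seminorm on `R` induced along a homomorphism `f : R → S`. -/
def comapSeminorm {R S : Type*} [Ring R] [Ring S] (z : MulRingSeminorm S) (f : R →+* S) :
    MulRingSeminorm R where
  toFun a := z (f a)
  map_zero' := by rw [map_zero, map_zero]
  add_le' a b := by
    rw [map_add]
    exact map_add_le_add z _ _
  neg' a := by rw [map_neg, map_neg_eq_map]
  map_one' := by rw [map_one, map_one]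
  map_mul' a b := by rw [map_mul, map_mul]

theorem mulRingSeminorm_le_of_tendsto {R : Type*} [Ring R] (z : MulRingSeminorm R) {P : R → ℝ}
    (hz : ∀ a, z a ≤ P a) {a : R} {r : ℝ}
    (h : Filter.Tendsto (fun n : ℕ => P (a ^ n) ^ (1 / (n : ℝ))) Filter.atTop (𝓝 r)) :
    z a ≤ r := by
  refine ge_of_tendsto h ((Filter.eventually_ne_atTop 0).mono fun n hn => ?_)
  calc z a = z (a ^ n) ^ (1 / (n : ℝ)) := by
        rw [map_pow, one_div, Real.pow_rpow_inv_natCast (apply_nonneg z a) hn]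
    _ ≤ P (a ^ n) ^ (1 / (n : ℝ)) :=
        Real.rpow_le_rpow (apply_nonneg z _) (hz _) (by positivity)

end MulRingSeminorm

namespace BerkovichSpectrum

section Eval

variable {k : Type*} [NormedField k] {B : Type*} [NormedCommRing B] [NormedAlgebra k B]

theorem ext_eval {z w : BerkovichSpectrum k B} (h : ∀ b, z.eval b = w.eval b) : z = w := by
  obtain ⟨z, _, _⟩ := z
  obtain ⟨w, _, _⟩ := w
  obtain rfl : z = w := DFunLike.ext _ _ h
  rfl

theorem eval_le_norm (z : BerkovichSpectrum k B) (b : B) : z.eval b ≤ ‖b‖ :=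
  contraction_of_isPowMul_of_boundedWrt (SeminormedRing.toRingSeminorm B)
    (nβ := z.toMulRingSeminorm) (f := RingHom.id B) (fun a n _ => map_pow z.toMulRingSeminorm a n)
    z.bounded' b

theorem abs_eval_sub_le (z : BerkovichSpectrum k B) (a b : B) :
    |z.eval a - z.eval b| ≤ ‖a - b‖ :=
  (abs_sub_map_le_sub z.toMulRingSeminorm a b).trans (z.eval_le_norm _)

theorem continuous_eval (z : BerkovichSpectrum k B) : Continuous z.eval :=
  (LipschitzWith.of_dist_le_mul (K := 1) fun a b => by
    rw [NNReal.coe_one, one_mul, dist_eq_norm a b]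
    exact z.abs_eval_sub_le a b).continuous

theorem continuous_eval_apply (b : B) : Continuous fun z : BerkovichSpectrum k B => z.eval b :=
  (continuous_apply b).comp continuous_induced_dom

end Eval

end BerkovichSpectrum

section Completion

variable {k : Type*} [NormedField k] {A : Type*} [CommRing A] [Algebra k A]
  (P Q : AlgebraNorm k A)

/-- The canonical map of `A` into its completion, as a homomorphism of algebras. -/
def completionHom : A →ₐ[k] AlgebraCompletion P :=
  { UniformSpace.Completion.coeRingHom (α := WithAlgebraNorm P) with commutes' := fun _ => rfl }

theorem completionHom_apply (a : A) : completionHom P a = toCompletion P a := rfl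

theorem norm_toCompletion (a : A) : ‖toCompletion P a‖ = P a :=
  UniformSpace.Completion.norm_coe (E := WithAlgebraNorm P) a

theorem denseRange_toCompletion : DenseRange (toCompletion P) :=
  UniformSpace.Completion.denseRange_coe (α := WithAlgebraNorm P)

variable {P Q}

theorem exists_continuous_extension {g : MulRingSeminorm A} (hg : ∀ a, g a ≤ P a) :
    ∃ G : AlgebraCompletion P → ℝ, Continuous G ∧ ∀ a, G (toCompletion P a) = g a := by
  have huc : UniformContinuous fun a : WithAlgebraNorm P => g a := by
    refine Metric.uniformContinuous_iff.2 fun ε hε => ⟨ε, hε, fun {a b} hab => ?_⟩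
    rw [dist_eq_norm (E := WithAlgebraNorm P)] at hab
    exact ((abs_sub_map_le_sub g a b).trans (hg (a - b))).trans_lt hab
  exact ⟨UniformSpace.Completion.extension fun a : WithAlgebraNorm P => g a,
    UniformSpace.Completion.continuous_extension,
    fun a => UniformSpace.Completion.extension_coe (α := WithAlgebraNorm P) huc a⟩

namespace BerkovichSpectrum

theorem exists_eval_toCompletion_eq (g : MulRingSeminorm A) (hg : ∀ a, g a ≤ P a)
    (hsmul : ∀ (c : k) a, g (c • a) = ‖c‖ * g a) :
    ∃ z : BerkovichSpectrum k (AlgebraCompletion P), ∀ a, z.eval (toCompletion P a) = g a := by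
  obtain ⟨G, hcont, hG⟩ := exists_continuous_extension hg
  have hdense := denseRange_toCompletion P
  simp only [← completionHom_apply] at hG
  exact ⟨{
    toFun := G
    map_zero' := by rw [← map_zero (completionHom P), hG, map_zero]
    map_one' := by rw [← map_one (completionHom P), hG, map_one]
    add_le' := hdense.induction_on₂ (isClosed_le (by fun_prop) (by fun_prop)) fun a b => by
      simp only [← completionHom_apply, ← map_add, hG]
      exact map_add_le_add g a b
    neg' := fun b => hdense.induction_on b (isClosed_eq (by fun_prop) hcont) fun a => by
      simp only [← completionHom_apply, ← map_neg, hG]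
      exact map_neg_eq_map g a
    map_mul' := hdense.induction_on₂ (isClosed_eq (by fun_prop) (by fun_prop)) fun a b => by
      simp only [← completionHom_apply, ← map_mul, hG]
    smul' := fun c b => hdense.induction_on b
      (isClosed_eq (hcont.comp (continuous_const_smul c)) (by fun_prop)) fun a => by
        simp only [← completionHom_apply, ← map_smul, hG, hsmul]
    bounded' := ⟨1, one_pos, fun b => hdense.induction_on b
      (isClosed_le hcont (by fun_prop)) fun a => by
        rw [norm_toCompletion, one_mul, ← completionHom_apply, hG]
        exact hg a⟩ }, hG⟩

/-- The restriction to `A` of a point of the spectrum of a completion of `A`. -/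
def restrict (z : BerkovichSpectrum k (AlgebraCompletion P)) : MulRingSeminorm A :=
  comapSeminorm z.toMulRingSeminorm (completionHom P : A →+* AlgebraCompletion P)

theorem restrict_smul (z : BerkovichSpectrum k (AlgebraCompletion P)) (c : k) (a : A) :
    z.restrict (c • a) = ‖c‖ * z.restrict a :=
  (congrArg z.eval (map_smul (completionHom P) c a)).trans (z.smul' c _)

theorem restrict_le (z : BerkovichSpectrum k (AlgebraCompletion P)) (a : A) :
    z.restrict a ≤ P a :=
  (z.eval_le_norm _).trans_eq (norm_toCompletion P a)

theorem eq_of_restrict_eq {z w : BerkovichSpectrum k (AlgebraCompletion P)}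
    (h : ∀ a, z.restrict a = w.restrict a) : z = w :=
  ext_eval <| congrFun <|
    (denseRange_toCompletion P).equalizer z.continuous_eval w.continuous_eval (funext h)

theorem continuous_of_continuous_restrict {Z : Type*} [TopologicalSpace Z]
    (F : Z → BerkovichSpectrum k (AlgebraCompletion P))
    (h : ∀ a, Continuous fun z => (F z).restrict a) : Continuous F := by
  refine continuous_induced_rng.2 (continuous_pi fun b => ?_)
  refine continuous_of_uniform_approx_of_continuous fun u hu => ?_
  obtain ⟨ε, hε, hu⟩ := Metric.mem_uniformity_dist.1 hu
  obtain ⟨a, ha⟩ := (denseRange_toCompletion P).exists_dist_lt b hε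
  refine ⟨_, h a, fun z => hu ?_⟩
  rw [dist_eq_norm] at ha
  exact ((F z).abs_eval_sub_le b (toCompletion P a)).trans_lt ha

/-- A point of either spectrum is determined by its restriction to `A`, and the same seminorms
on `A` are bounded by `P` as by its spectral seminorm `Q`. -/
theorem exists_homeomorph (hQP : ∀ a, Q a ≤ P a)
    (hlim : ∀ a, Filter.Tendsto (fun n : ℕ => P (a ^ n) ^ (1 / (n : ℝ))) Filter.atTop
      (𝓝 (Q a))) :
    ∃ h : BerkovichSpectrum k (AlgebraCompletion P) ≃ₜ BerkovichSpectrum k (AlgebraCompletion Q),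
      ∀ z a, (h z).eval (toCompletion Q a) = z.eval (toCompletion P a) := by
  choose F hF using fun z : BerkovichSpectrum k (AlgebraCompletion P) =>
    exists_eval_toCompletion_eq z.restrict
      (fun a => mulRingSeminorm_le_of_tendsto z.restrict z.restrict_le (hlim a)) z.restrict_smul
  choose G hG using fun z : BerkovichSpectrum k (AlgebraCompletion Q) =>
    exists_eval_toCompletion_eq z.restrict (fun a => (z.restrict_le a).trans (hQP a))
      z.restrict_smul
  refine ⟨⟨⟨F, G, fun z => eq_of_restrict_eq fun a => (hG _ a).trans (hF z a),
    fun z => eq_of_restrict_eq fun a => (hF _ a).trans (hG z a)⟩,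
    continuous_of_continuous_restrict F fun a => ?_,
    continuous_of_continuous_restrict G fun a => ?_⟩, hF⟩
  · exact (continuous_eval_apply (toCompletion P a)).congr fun z => (hF z a).symm
  · exact (continuous_eval_apply (toCompletion Q a)).congr fun z => (hG z a).symm

end BerkovichSpectrum

end Completion

/-! ### Almost orthogonal bases -/

section Orthogonal

section Sequence

variable {k W : Type*} [NormedField k] [NormedAddCommGroup W] [NormedSpace k W]

theorem norm_smul_le_mul_norm_add {F : Submodule k W} {v : W} {η : ℝ} (hη : 0 ≤ η)
    (h : ∀ w ∈ F, ‖v‖ ≤ η * ‖v + w‖) (c : k) {w : W} (hw : w ∈ F) :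
    ‖c • v‖ ≤ η * ‖c • v + w‖ := by
  rcases eq_or_ne c 0 with rfl | hc
  · rw [zero_smul, norm_zero]
    positivity
  calc ‖c • v‖ = ‖c‖ * ‖v‖ := norm_smul c v
    _ ≤ ‖c‖ * (η * ‖v + c⁻¹ • w‖) := by
        gcongr
        exact h _ (F.smul_mem _ hw)
    _ = η * ‖c • v + w‖ := by
        rw [mul_left_comm, ← norm_smul, smul_add, smul_inv_smul₀ hc]

theorem exists_basis_norm_repr_mul_le_of_span {ι : Type*} {f : ι → W}
    (hspan : Submodule.span k (Set.range f) = ⊤) {D : ℝ}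
    (h : ∀ (a : ι →₀ k) j, ‖a j‖ * ‖f j‖ ≤ D * ‖Finsupp.linearCombination k f a‖) :
    ∃ (J : Set ι) (b : Module.Basis J k W), ∀ x j, ‖b.repr x j‖ * ‖b j‖ ≤ D * ‖x‖ := by
  let J : Set ι := {j | f j ≠ 0}
  have bound (a : J →₀ k) (j : J) :
      ‖a j‖ * ‖f j‖ ≤ D * ‖Finsupp.linearCombination k (fun j : J => f j) a‖ := by
    have hj := h (a.mapDomain Subtype.val) j
    rwa [Finsupp.mapDomain_apply Subtype.val_injective, Finsupp.linearCombination_mapDomain] at hj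
  have hli : LinearIndependent k fun j : J => f j := by
    refine linearIndependent_iff.2 fun a ha => Finsupp.ext fun j => ?_
    have hj := bound a j
    rw [ha, norm_zero, mul_zero] at hj
    by_contra hne
    exact hj.not_gt (mul_pos (norm_pos_iff.2 hne) (norm_pos_iff.2 j.2))
  have hsp : ⊤ ≤ Submodule.span k (Set.range fun j : J => f j) := by
    rw [← hspan, ← Submodule.span_sdiff_singleton_zero, Submodule.span_le]
    rintro _ ⟨⟨j, rfl⟩, hj⟩
    exact Submodule.subset_span ⟨⟨j, hj⟩, rfl⟩
  let b := Module.Basis.mk hli hsp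
  have hb (j : J) : b j = f j := Module.Basis.mk_apply hli hsp j
  refine ⟨J, b, fun x j => ?_⟩
  have hx : Finsupp.linearCombination k (fun j : J => f j) (b.repr x) = x := by
    simpa only [b, Module.Basis.coe_mk] using b.linearCombination_repr x
  simpa only [hb, hx] using bound (b.repr x) j

variable [IsUltrametricDist W] {f : ℕ → W} {u : ℕ → ℝ}

theorem norm_mul_le_norm_sum_of_almost_orthogonal (hu : Monotone u) (hu1 : ∀ n, 1 ≤ u n)
    (hf : ∀ n, ∀ w ∈ Submodule.span k (f '' Set.Iio n), ‖f n‖ ≤ u (n + 1) / u n * ‖f n + w‖)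
    (c : ℕ → k) {j n : ℕ} (hj : j < n) :
    ‖c j‖ * ‖f j‖ ≤ u n * ‖∑ i ∈ Finset.range n, c i • f i‖ := by
  induction n with
  | zero => exact absurd hj (Nat.not_lt_zero j)
  | succ n ih =>
    have hpos : 0 < u n := one_pos.trans_le (hu1 n)
    have hη : 1 ≤ u (n + 1) / u n := (one_le_div hpos).2 (hu n.le_succ)
    rw [Finset.sum_range_succ_comm]
    set w := ∑ i ∈ Finset.range n, c i • f i with hw
    have hwF : w ∈ Submodule.span k (f '' Set.Iio n) := Submodule.sum_mem _ fun i hi =>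
      Submodule.smul_mem _ _ (Submodule.subset_span ⟨i, Finset.mem_range.1 hi, rfl⟩)
    have last_le : ‖c n • f n‖ ≤ u (n + 1) / u n * ‖c n • f n + w‖ :=
      norm_smul_le_mul_norm_add (one_pos.le.trans hη) (hf n) (c n) hwF
    rcases Nat.lt_succ_iff_lt_or_eq.1 hj with hj | rfl
    · have init_le : ‖w‖ ≤ u (n + 1) / u n * ‖c n • f n + w‖ := by
        have hmax : ‖w‖ ≤ max ‖c n • f n + w‖ ‖c n • f n‖ := by
          simpa using IsUltrametricDist.norm_add_le_max (c n • f n + w) (-(c n • f n))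
        exact hmax.trans (max_le (le_mul_of_one_le_left (norm_nonneg _) hη) last_le)
      calc ‖c j‖ * ‖f j‖ ≤ u n * ‖w‖ := ih hj
        _ ≤ u n * (u (n + 1) / u n * ‖c n • f n + w‖) := by gcongr
        _ = u (n + 1) * ‖c n • f n + w‖ := by rw [← mul_assoc, mul_div_cancel₀ _ hpos.ne']
    · rw [← norm_smul]
      refine last_le.trans (mul_le_mul_of_nonneg_right ?_ (norm_nonneg _))
      exact div_le_self (one_pos.le.trans (hu1 _)) (hu1 _)

theorem norm_mul_le_norm_linearCombination_of_almost_orthogonal (hu : Monotone u)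
    (hu1 : ∀ n, 1 ≤ u n)
    (hf : ∀ n, ∀ w ∈ Submodule.span k (f '' Set.Iio n), ‖f n‖ ≤ u (n + 1) / u n * ‖f n + w‖)
    {D : ℝ} (hD : ∀ n, u n ≤ D) (a : ℕ →₀ k) (j : ℕ) :
    ‖a j‖ * ‖f j‖ ≤ D * ‖Finsupp.linearCombination k f a‖ := by
  obtain ⟨n, hn⟩ := a.support.exists_nat_subset_range
  have hsum : Finsupp.linearCombination k f a = ∑ i ∈ Finset.range (max n (j + 1)), a i • f i := by
    rw [Finsupp.linearCombination_apply]
    exact Finsupp.sum_of_support_subset _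
      (hn.trans (Finset.range_subset_range.2 (le_max_left _ _))) _ fun _ _ => zero_smul k _
  rw [hsum]
  exact (norm_mul_le_norm_sum_of_almost_orthogonal hu hu1 hf a (le_max_right n (j + 1))).trans
    (mul_le_mul_of_nonneg_right (hD _) (norm_nonneg _))

end Sequence

variable {k W : Type*} [NontriviallyNormedField k] [CompleteSpace k]
  [NormedAddCommGroup W] [NormedSpace k W]

theorem exists_sub_mem_forall_norm_le (F : Submodule k W) [FiniteDimensional k F] (v : W) {η : ℝ}
    (hη : 1 < η) : ∃ g, v - g ∈ F ∧ ∀ w ∈ F, ‖g‖ ≤ η * ‖g + w‖ := by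
  by_cases hv : v ∈ F
  · exact ⟨0, by rwa [sub_zero], fun w _ => by rw [norm_zero]; positivity⟩
  have hcl : IsClosed (F : Set W) := F.closed_of_finiteDimensional
  have hne : (F : Set W).Nonempty := ⟨0, F.zero_mem⟩
  have hd : 0 < Metric.infDist v F := (hcl.notMem_iff_infDist_pos hne).1 hv
  obtain ⟨y, hy, hvy⟩ := (Metric.infDist_lt_iff hne).1
    (lt_mul_of_one_lt_left hd hη : Metric.infDist v F < η * Metric.infDist v F)
  refine ⟨v - y, by rwa [sub_sub_cancel], fun w hw => ?_⟩
  rw [← dist_eq_norm]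
  refine hvy.le.trans (mul_le_mul_of_nonneg_left ?_ (by positivity))
  have := Metric.infDist_le_dist_of_mem (x := v) (F.sub_mem hy hw)
  rwa [dist_eq_norm, sub_sub_eq_add_sub, add_sub_right_comm] at this

theorem exists_almost_orthogonal_sequence (e : ℕ → W) {η : ℕ → ℝ} (hη : ∀ n, 1 < η n) :
    ∃ f : ℕ → W, Submodule.span k (Set.range e) ≤ Submodule.span k (Set.range f) ∧
      ∀ n, ∀ w ∈ Submodule.span k (f '' Set.Iio n), ‖f n‖ ≤ η n * ‖f n + w‖ := by
  let E (n : ℕ) : Submodule k W := Submodule.span k (e '' Set.Iio n)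
  have hfin (n : ℕ) : FiniteDimensional k (E n) :=
    FiniteDimensional.span_of_finite k ((Set.finite_Iio n).image e)
  have hE {m n : ℕ} (h : m ≤ n) : E m ≤ E n :=
    Submodule.span_mono (Set.image_mono (Set.Iio_subset_Iio h))
  choose f hsub hnorm using fun n => exists_sub_mem_forall_norm_le (E n) (e n) (hη n)
  have hfE (j : ℕ) : f j ∈ E (j + 1) := by
    have hej : e j ∈ E (j + 1) := Submodule.subset_span ⟨j, Nat.lt_succ_self j, rfl⟩
    simpa only [sub_sub_cancel] using (E (j + 1)).sub_mem hej (hE j.le_succ (hsub j))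
  refine ⟨f, Submodule.span_le.2 ?_, fun n w hw => hnorm n w (Submodule.span_le.2 ?_ hw)⟩
  · rintro _ ⟨n, rfl⟩
    induction n using Nat.strong_induction_on with
    | _ n ih =>
      have hfn : f n ∈ Submodule.span k (Set.range f) := Submodule.subset_span ⟨n, rfl⟩
      have hEn : E n ≤ Submodule.span k (Set.range f) := Submodule.span_le.2 <| by
        rintro _ ⟨m, hm, rfl⟩
        exact ih m hm
      exact (Submodule.sub_mem_iff_left _ hfn).1 (hEn (hsub n))
  · rintro _ ⟨j, hj, rfl⟩
    exact hE hj (hfE j)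

theorem exists_basis_norm_repr_mul_le [IsUltrametricDist W] {e : ℕ → W}
    (he : Submodule.span k (Set.range e) = ⊤) {D : ℝ} (hD : 1 < D) :
    ∃ (J : Set ℕ) (b : Module.Basis J k W), ∀ x j, ‖b.repr x j‖ * ‖b j‖ ≤ D * ‖x‖ := by
  -- The factors `u (n + 1) / u n` of the successive steps multiply up to less than `D`.
  obtain ⟨u, hu, hu1, -⟩ := exists_seq_strictMono_tendsto' hD
  obtain ⟨f, hspan, hf⟩ := exists_almost_orthogonal_sequence (k := k) e
    fun n => (one_lt_div (one_pos.trans (hu1 n).1)).2 (hu n.lt_succ_self)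
  exact exists_basis_norm_repr_mul_le_of_span (top_unique (he.ge.trans hspan))
    (norm_mul_le_norm_linearCombination_of_almost_orthogonal hu.monotone
      (fun n => (hu1 n).1.le) hf fun n => (hu1 n).2.le)

end Orthogonal

/-! ### Scalar extensions of norms -/

section ScalarExtension

variable {k : Type*} [NormedField k] {V : Type*} [AddCommGroup V] [Module k V]
  (p : Seminorm k V)

theorem dualNorm_nonneg (l : Module.Dual k V) : 0 ≤ dualNorm p l :=
  Real.iSup_nonneg fun v => div_nonneg (norm_nonneg _) (apply_nonneg p v)

theorem dualNorm_le {l : Module.Dual k V} {A : ℝ} (hA : 0 ≤ A) (h : ∀ v, ‖l v‖ ≤ A * p v) :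
    dualNorm p l ≤ A :=
  Real.iSup_le (fun v => div_le_of_le_mul₀ (apply_nonneg p v) hA (h v)) hA

variable {p}

theorem norm_le_dualNorm_mul (hp : ∀ v, p v = 0 → v = 0) {l : Module.Dual k V}
    (hl : BddAbove (Set.range fun v : V => ‖l v‖ / p v)) (v : V) :
    ‖l v‖ ≤ dualNorm p l * p v := by
  by_cases hv : p v = 0
  · rw [hp v hv, map_zero, map_zero, norm_zero, mul_zero]
  · exact (div_le_iff₀ ((apply_nonneg p v).lt_of_ne' hv)).1 (le_ciSup hl v)

/-- The dual norm of an unbounded functional is `0`, and so is the quotient on the left. -/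
theorem norm_div_dualNorm_le (hp : ∀ v, p v = 0 → v = 0) (l : Module.Dual k V) (v : V) :
    ‖l v‖ / dualNorm p l ≤ p v := by
  by_cases hl : BddAbove (Set.range fun v : V => ‖l v‖ / p v)
  · refine div_le_of_le_mul₀ (dualNorm_nonneg p l) (apply_nonneg p v) ?_
    rw [mul_comm]
    exact norm_le_dualNorm_mul hp hl v
  · rw [dualNorm, Real.iSup_of_not_bddAbove hl, div_zero]
    exact apply_nonneg p v

variable {K : Type*} [NormedField K] [NormedAlgebra k K]

theorem norm_liftBaseChange_dual_tmul_div_le (hp : ∀ v, p v = 0 → v = 0) (l : Module.Dual k V)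
    (a : K) (v : V) :
    ‖((Algebra.linearMap k K).comp l).liftBaseChange K (a ⊗ₜ[k] v)‖ / dualNorm p l ≤
      ‖a‖ * p v := by
  rw [LinearMap.liftBaseChange_tmul, LinearMap.comp_apply, Algebra.linearMap_apply, smul_eq_mul,
    norm_mul, norm_algebraMap', mul_div_assoc]
  exact mul_le_mul_of_nonneg_left (norm_div_dualNorm_le hp l v) (norm_nonneg a)

theorem bddAbove_scalarExtension (hp : ∀ v, p v = 0 → v = 0) (w : K ⊗[k] V) :
    BddAbove (Set.range fun l : Module.Dual k V =>
      ‖((Algebra.linearMap k K).comp l).liftBaseChange K w‖ / dualNorm p l) := by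
  induction w using TensorProduct.induction_on with
  | zero => exact ⟨0, by rintro _ ⟨l, rfl⟩; simp only [map_zero, norm_zero, zero_div, le_refl]⟩
  | tmul a v =>
    exact ⟨‖a‖ * p v, Set.forall_mem_range.2 fun l =>
      norm_liftBaseChange_dual_tmul_div_le hp l a v⟩
  | add x y hx hy =>
    obtain ⟨a, ha⟩ := hx
    obtain ⟨b, hb⟩ := hy
    refine ⟨a + b, Set.forall_mem_range.2 fun l => ?_⟩
    rw [map_add]
    refine (div_le_div_of_nonneg_right (norm_add_le _ _) (dualNorm_nonneg p l)).trans ?_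
    rw [add_div]
    exact add_le_add (ha ⟨l, rfl⟩) (hb ⟨l, rfl⟩)

theorem scalarExtension_nonneg (w : K ⊗[k] V) : 0 ≤ scalarExtension p K w :=
  Real.iSup_nonneg fun l => div_nonneg (norm_nonneg _) (dualNorm_nonneg p l)

theorem scalarExtension_tmul_le (hp : ∀ v, p v = 0 → v = 0) (a : K) (v : V) :
    scalarExtension p K (a ⊗ₜ[k] v) ≤ ‖a‖ * p v :=
  Real.iSup_le (fun l => norm_liftBaseChange_dual_tmul_div_le hp l a v)
    (mul_nonneg (norm_nonneg _) (apply_nonneg p v))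

theorem norm_liftBaseChange_dual_le (hp : ∀ v, p v = 0 → v = 0) {l : Module.Dual k V} {A : ℝ}
    (hA : 0 ≤ A) (h : ∀ v, ‖l v‖ ≤ A * p v) (w : K ⊗[k] V) :
    ‖((Algebra.linearMap k K).comp l).liftBaseChange K w‖ ≤ A * scalarExtension p K w := by
  have hl : BddAbove (Set.range fun v : V => ‖l v‖ / p v) :=
    ⟨A, Set.forall_mem_range.2 fun v => div_le_of_le_mul₀ (apply_nonneg p v) hA (h v)⟩
  rcases (dualNorm_nonneg p l).eq_or_lt with h0 | hpos
  · have hl0 : l = 0 := LinearMap.ext fun v => norm_le_zero_iff.1 <| by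
      simpa only [← h0, zero_mul] using norm_le_dualNorm_mul hp hl v
    have hzero : (0 : V →ₗ[k] K).liftBaseChange K = 0 := map_zero (LinearMap.liftBaseChangeEquiv K)
    rw [hl0, LinearMap.comp_zero, hzero, LinearMap.zero_apply, norm_zero]
    exact mul_nonneg hA (scalarExtension_nonneg w)
  · have hsup := le_ciSup (bddAbove_scalarExtension (K := K) hp w) l
    rw [div_le_iff₀ hpos, mul_comm] at hsup
    exact hsup.trans (mul_le_mul_of_nonneg_right (dualNorm_le p hA h) (scalarExtension_nonneg w))

end ScalarExtension

section BasisExpansion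

theorem basis_repr_baseChange {k K V W J : Type*} [CommRing k] [CommRing K] [Algebra k K]
    [AddCommGroup V] [Module k V] [AddCommGroup W] [Module k W] (b : Module.Basis J k W)
    (g : V →ₗ[k] W) (j : J) (w : K ⊗[k] V) :
    (Algebra.TensorProduct.basis K b).repr (g.baseChange K w) j =
      ((Algebra.linearMap k K).comp (b.coord j ∘ₗ g)).liftBaseChange K w := by
  induction w using TensorProduct.induction_on with
  | zero => simp only [map_zero, Finsupp.zero_apply]
  | tmul a v =>
    rw [LinearMap.baseChange_tmul, Algebra.TensorProduct.basis_repr_tmul, Finsupp.smul_apply,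
      LinearMap.liftBaseChange_tmul]
    rfl
  | add x y hx hy => simp only [map_add, Finsupp.add_apply, hx, hy]

theorem liftBaseChange_subtype_comp_eq_sum {k K V J : Type*} [CommRing k] [CommRing K]
    [Algebra k K] [AddCommGroup V] [Module k V] {W : Submodule k K} (b : Module.Basis J k W)
    (g : V →ₗ[k] W) (w : K ⊗[k] V) :
    ∃ S : Finset J, (W.subtype ∘ₗ g).liftBaseChange K w =
      ∑ j ∈ S, ((Algebra.linearMap k K).comp (b.coord j ∘ₗ g)).liftBaseChange K w * (b j : K) := by
  let B := Algebra.TensorProduct.basis K b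
  have comp_eq : (W.subtype ∘ₗ g).liftBaseChange K =
      W.subtype.liftBaseChange K ∘ₗ g.baseChange K := by
    ext v
    simp
  refine ⟨(B.repr (g.baseChange K w)).support, ?_⟩
  rw [comp_eq, LinearMap.comp_apply]
  conv_lhs => rw [← B.linearCombination_repr (g.baseChange K w), Finsupp.linearCombination_apply]
  rw [Finsupp.sum, map_sum]
  refine Finset.sum_congr rfl fun j _ => ?_
  rw [map_smul, basis_repr_baseChange, Algebra.TensorProduct.basis_apply,
    LinearMap.liftBaseChange_tmul, one_smul, smul_eq_mul, Submodule.subtype_apply]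

theorem norm_liftBaseChange_le_of_basis {k : Type*} [NormedField k]
    {V : Type*} [AddCommGroup V] [Module k V] {p : Seminorm k V} (hp : ∀ v, p v = 0 → v = 0)
    {K : Type*} [NormedField K] [NormedAlgebra k K] [IsUltrametricDist K] {W : Submodule k K}
    {J : Type*} (b : Module.Basis J k W) {C D : ℝ} (hC : 0 ≤ C) (hD : 0 ≤ D)
    (hb : ∀ x j, ‖b.repr x j‖ * ‖b j‖ ≤ D * ‖x‖) (g : V →ₗ[k] W) (hg : ∀ v, ‖g v‖ ≤ C * p v)
    (w : K ⊗[k] V) :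
    ‖(W.subtype ∘ₗ g).liftBaseChange K w‖ ≤ D * C * scalarExtension p K w := by
  obtain ⟨S, hS⟩ := liftBaseChange_subtype_comp_eq_sum b g w
  rw [hS]
  refine IsUltrametricDist.norm_sum_le_of_forall_le_of_nonneg
    (mul_nonneg (mul_nonneg hD hC) (scalarExtension_nonneg w)) fun j _ => ?_
  have hbj : 0 < ‖b j‖ := norm_pos_iff.2 (b.ne_zero j)
  have coord_le (v : V) : ‖(b.coord j ∘ₗ g) v‖ ≤ D * C / ‖b j‖ * p v := by
    rw [div_mul_eq_mul_div, le_div_iff₀ hbj, mul_assoc]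
    exact (hb (g v) j).trans (mul_le_mul_of_nonneg_left (hg v) hD)
  have hj := norm_liftBaseChange_dual_le (K := K) hp (by positivity) coord_le w
  rw [div_mul_eq_mul_div, le_div_iff₀ hbj] at hj
  rwa [norm_mul]

/-- A space of countable dimension need not have orthogonal bases, but it has bases that are
orthogonal up to any factor `D > 1`; the bound holds up to `D` for each of them. -/
theorem norm_liftBaseChange_le {k : Type*} [NontriviallyNormedField k] [CompleteSpace k]
    {V : Type*} [AddCommGroup V] [Module k V] {p : Seminorm k V} (hp : ∀ v, p v = 0 → v = 0)
    {K : Type*} [NormedField K] [NormedAlgebra k K] [IsUltrametricDist K] (ev : V →ₗ[k] K)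
    {e : ℕ → K} (he : ∀ v, ev v ∈ Submodule.span k (Set.range e)) {C : ℝ} (hC : 0 ≤ C)
    (h : ∀ v, ‖ev v‖ ≤ C * p v) (w : K ⊗[k] V) :
    ‖ev.liftBaseChange K w‖ ≤ C * scalarExtension p K w := by
  let W := Submodule.span k (Set.range e)
  let e' (n : ℕ) : W := ⟨e n, Submodule.subset_span ⟨n, rfl⟩⟩
  have he' : Submodule.span k (Set.range e') = ⊤ := by
    have hrange : Set.range e' = Subtype.val ⁻¹' Set.range e := by
      ext x
      simp only [e', Set.mem_range, Set.mem_preimage, Subtype.ext_iff]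
    rw [hrange]
    exact Submodule.span_span_coe_preimage
  have : IsUltrametricDist W := ⟨fun x y z => dist_triangle_max (x : K) y z⟩
  have bound (D : ℝ) (hD : 1 < D) :
      ‖ev.liftBaseChange K w‖ ≤ D * C * scalarExtension p K w := by
    obtain ⟨J, b, hb⟩ := exists_basis_norm_repr_mul_le he' hD
    exact norm_liftBaseChange_le_of_basis hp b hC (one_pos.trans hD).le hb
      (ev.codRestrict W he) h w
  have lim : Filter.Tendsto (fun D : ℝ => D * C * scalarExtension p K w) (𝓝[>] 1)
      (𝓝 (1 * C * scalarExtension p K w)) :=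
    (Continuous.tendsto (by fun_prop) 1).mono_left nhdsWithin_le_nhds
  rw [one_mul] at lim
  exact ge_of_tendsto lim (eventually_nhdsWithin_of_forall bound)

end BasisExpansion

/-! ### The seminorm of a point on the section algebra -/

namespace Analytification

variable {k : Type u} [NormedField k] {X : Scheme.{u}} [X.Over (Spec (CommRingCat.of k))]
  (x : Analytification k X)

theorem norm_toCompleted (a : X.residueField x.pt) : ‖x.toCompleted a‖ = x.abs a :=
  UniformSpace.Completion.norm_coe (E := WithAbs x.abs) (WithAbs.toAbs x.abs a)

theorem norm_algebraMap_completed (a : k) :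
    ‖algebraMap k x.CompletedResidueField a‖ = ‖a‖ :=
  (x.norm_toCompleted _).trans (x.abs_residueHom a)

/-- The completed residue field as a normed algebra. It is not a global instance. -/
@[reducible]
def normedAlgebraCompleted : NormedAlgebra k x.CompletedResidueField :=
  { (inferInstance : Algebra k x.CompletedResidueField) with
    norm_smul_le := fun a b => by
      rw [Algebra.smul_def, norm_mul, norm_algebraMap_completed] }

theorem isUltrametricDist_completed [IsUltrametricDist k] :
    IsUltrametricDist x.CompletedResidueField :=
  letI := x.normedAlgebraCompleted
  IsUltrametricDist.of_normedAlgebra k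

theorem isNonarchimedean_abs [IsUltrametricDist k] : IsNonarchimedean x.abs := fun a b => by
  have := x.isUltrametricDist_completed
  rw [← x.norm_toCompleted, ← x.norm_toCompleted, ← x.norm_toCompleted, map_add]
  exact IsUltrametricDist.norm_add_le_max _ _

end Analytification

namespace LineBundle

section Components

variable {k : Type u} [CommRing k] {X : Scheme.{u}} [X.Over (Spec (CommRingCat.of k))]
  {L : LineBundle X}

namespace SectionAlgebra

/-- The inclusion of `V_n(L)` into `V_•(L)`. -/
def of {n : ℕ} : L.sections k n →ₗ[k] L.SectionAlgebra k :=
  DirectSum.lof k ℕ (fun n => L.sections k n) n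

theorem component_of_self {n : ℕ} (s : L.sections k n) : (of s).component n = s :=
  DirectSum.component.lof_self k (M := fun n => L.sections k n) n s

theorem component_of_ne {m n : ℕ} (h : m ≠ n) (s : L.sections k m) :
    (of s).component n = 0 := by
  refine (DirectSum.component.of k (M := fun n => L.sections k n) n m s).trans ?_
  rw [dif_neg h]

theorem component_zero (n : ℕ) : (0 : L.SectionAlgebra k).component n = 0 :=
  map_zero (DirectSum.component k ℕ (fun n => L.sections k n) n)

theorem component_add (s t : L.SectionAlgebra k) (n : ℕ) :
    (s + t).component n = s.component n + t.component n :=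
  map_add (DirectSum.component k ℕ (fun n => L.sections k n) n) s t

theorem component_smul (a : k) (s : L.SectionAlgebra k) (n : ℕ) :
    (a • s).component n = a • s.component n :=
  map_smul (DirectSum.component k ℕ (fun n => L.sections k n) n) a s

theorem ext_component {s t : L.SectionAlgebra k} (h : ∀ n, s.component n = t.component n) :
    s = t :=
  DirectSum.ext_component k (M := fun n => L.sections k n) h

theorem induction_on {p : L.SectionAlgebra k → Prop} (s : L.SectionAlgebra k) (zero : p 0)
    (homogeneous : ∀ {n : ℕ} (s : L.sections k n), p (of s))
    (add : ∀ s t, p s → p t → p (s + t)) : p s :=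
  DirectSum.induction_on (β := fun n => L.sections k n) s zero (fun _ => homogeneous) add

theorem exists_eq_sum (s : L.SectionAlgebra k) :
    ∃ S : Finset ℕ, s = ∑ n ∈ S, of (s.component n) := by
  classical
  exact ⟨DFinsupp.support (β := fun n => L.sections k n) s,
    (DirectSum.sum_support_of (β := fun n => L.sections k n) s).symm⟩

end SectionAlgebra

/-- The product in `V_{m + n}(L)` of sections of degrees `m` and `n`. -/
def mulSection {m n : ℕ} (s : L.sections k m) (t : L.sections k n) : L.sections k (m + n) :=
  ⟨s.1 * t.1, (L.gradedMonoid k).mul_mem s.2 t.2⟩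

theorem pow_mem_sections {n : ℕ} (s : L.sections k n) (m : ℕ) :
    s.1 ^ m ∈ L.sections k (n * m) := by
  rw [mul_comm]
  exact SetLike.pow_mem_graded m s.2

/-- The `m`-th power in `V_{n * m}(L)` of a section of degree `n`. -/
def powSection {n : ℕ} (s : L.sections k n) (m : ℕ) : L.sections k (n * m) :=
  ⟨s.1 ^ m, pow_mem_sections s m⟩

/-- The unit of `V_•(L)` as a section of degree `0`. -/
def oneSection : L.sections k 0 := ⟨1, (L.gradedMonoid k).one_mem⟩

namespace SectionAlgebra

theorem of_mul {m n : ℕ} (s : L.sections k m) (t : L.sections k n) :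
    of s * of t = of (mulSection s t) :=
  DirectSum.of_mul_of (A := fun n => L.sections k n) s t

theorem of_oneSection : of (oneSection : L.sections k 0) = 1 := rfl

theorem of_congr {m n : ℕ} (h : m = n) {s : L.sections k m} {t : L.sections k n}
    (hst : s.1 = t.1) : of s = of t := by
  subst h
  rw [Subtype.ext hst]

theorem of_pow {n : ℕ} (s : L.sections k n) (m : ℕ) : of s ^ m = of (powSection s m) := by
  induction m with
  | zero =>
    rw [pow_zero, ← of_oneSection]
    exact of_congr (mul_zero n).symm (pow_zero s.1).symm
  | succ m ih =>
    rw [pow_succ, ih, of_mul]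
    exact of_congr rfl (pow_succ s.1 m).symm

end SectionAlgebra

/-- The restriction of `V_•(L)` to the fibre of `L` at `x`, as a ring homomorphism to `κ(x)[T]`,
where `T` stands for the value at `x` of the frame `e i`. -/
def fiberPolynomial (i : L.ι) (x : X) (hx : x ∈ L.U i) :
    L.SectionAlgebra k →+* Polynomial (X.residueField x) :=
  DirectSum.toSemiring (A := fun n => L.sections k n)
    (fun n => (Polynomial.monomial n).toAddMonoidHom.comp
      ((X.evaluation (L.U i) x hx).hom.toAddMonoidHom.comp
        ((Pi.evalAddMonoidHom _ i).comp (L.sections k n).subtype.toAddMonoidHom)))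
    (by
      change Polynomial.monomial 0 (X.evaluation (L.U i) x hx (1 : Γ(X, L.U i))) = 1
      rw [map_one]
      rfl)
    (fun {m n} s t => by
      change Polynomial.monomial (m + n) (X.evaluation (L.U i) x hx (s.1 i * t.1 i)) =
        Polynomial.monomial m (X.evaluation (L.U i) x hx (s.1 i)) *
          Polynomial.monomial n (X.evaluation (L.U i) x hx (t.1 i))
      rw [map_mul, Polynomial.monomial_mul_monomial])

theorem fiberPolynomial_of (i : L.ι) (x : X) (hx : x ∈ L.U i) {n : ℕ} (s : L.sections k n) :
    fiberPolynomial i x hx (SectionAlgebra.of s) =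
      Polynomial.monomial n (X.evaluation (L.U i) x hx (s.1 i)) :=
  DirectSum.toSemiring_of (A := fun n => L.sections k n) _ _ _ n s

theorem coeff_fiberPolynomial (i : L.ι) (x : X) (hx : x ∈ L.U i) (s : L.SectionAlgebra k)
    (n : ℕ) :
    (fiberPolynomial i x hx s).coeff n = X.evaluation (L.U i) x hx ((s.component n).1 i) := by
  have eval_zero : X.evaluation (L.U i) x hx ((0 : L.sections k n).1 i) = 0 :=
    map_zero (X.evaluation (L.U i) x hx).hom
  induction s using SectionAlgebra.induction_on with
  | zero => rw [map_zero, Polynomial.coeff_zero, SectionAlgebra.component_zero, eval_zero]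
  | @homogeneous m s =>
    rw [fiberPolynomial_of, Polynomial.coeff_monomial]
    split_ifs with h
    · subst h
      rw [SectionAlgebra.component_of_self]
    · rw [SectionAlgebra.component_of_ne h, eval_zero]
  | add s t hs ht =>
    rw [map_add, Polynomial.coeff_add, hs, ht, SectionAlgebra.component_add]
    exact (map_add (X.evaluation (L.U i) x hx).hom _ _).symm

end Components

namespace Metric

variable {k : Type u} [NormedField k] {X : Scheme.{u}} [X.Over (Spec (CommRingCat.of k))]
  {L : LineBundle X} (φ : Metric k L)

theorem abs_smul {n : ℕ} (x : Analytification k X) (a : k) (s : L.sections k n) :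
    φ.abs (a • s) x = ‖a‖ * φ.abs s x := by
  have h (i : L.ι) (hi : x.pt ∈ L.U i) :
      x.absEval hi ((a • s).1 i) = ‖a‖ * x.absEval hi (s.1 i) := by
    refine (x.absEval_mul hi (structureHom k (L.U i) a) _).trans (congrArg (· * _) ?_)
    exact (congrArg x.abs (evaluation_structureHom k (L.U i) x.pt hi a)).trans
      (x.abs_residueHom a)
  rw [Metric.abs, h, mul_assoc]
  rfl

theorem supNorm_component_le (s : L.SectionAlgebra k) (n : ℕ) :
    φ.supNorm (s.component n) ≤ φ.algNorm s :=
  le_iSup (fun n => φ.supNorm (s.component n)) n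

variable [IsUltrametricDist k]

/-- The multiplicative seminorm `s ↦ maxₙ |sₙ|_{nφ}(x)` on `V_•(L)`. It is the pull-back of a Gauss
norm on `κ(x)[T]`, which makes its multiplicativity Gauss's lemma. -/
def pointSeminorm (x : Analytification k X) : MulRingSeminorm (L.SectionAlgebra k) :=
  letI i := (L.covers x.pt).choose
  letI hi := (L.covers x.pt).choose_spec
  haveI := Polynomial.gaussNorm_isAbsoluteValue x.isNonarchimedean_abs (φ.frameNorm_pos i x hi)
  comapSeminorm (MulRingNorm.mulRingNormEquivAbsoluteValue.symm
    (IsAbsoluteValue.toAbsoluteValue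
      (Polynomial.gaussNorm x.abs (φ.frameNorm i x hi)))).toMulRingSeminorm
    (fiberPolynomial i x.pt hi)

theorem pointSeminorm_apply (x : Analytification k X) (s : L.SectionAlgebra k) :
    φ.pointSeminorm x s =
      (fiberPolynomial (L.covers x.pt).choose x.pt (L.covers x.pt).choose_spec s).gaussNorm x.abs
        (φ.frameNorm (L.covers x.pt).choose x (L.covers x.pt).choose_spec) :=
  rfl

theorem isNonarchimedean_pointSeminorm (x : Analytification k X) :
    IsNonarchimedean (φ.pointSeminorm x) := fun s t => by
  simp only [pointSeminorm_apply, map_add]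
  exact Polynomial.isNonarchimedean_gaussNorm _ x.isNonarchimedean_abs
    (φ.frameNorm_pos _ _ _).le _ _

theorem isGreatest_pointSeminorm (x : Analytification k X) (s : L.SectionAlgebra k) :
    IsGreatest (Set.range fun n => φ.abs (s.component n) x) (φ.pointSeminorm x s) := by
  have h (n : ℕ) : φ.abs (s.component n) x =
      x.abs ((fiberPolynomial _ x.pt (L.covers x.pt).choose_spec s).coeff n) *
        φ.frameNorm _ x (L.covers x.pt).choose_spec ^ n := by
    rw [coeff_fiberPolynomial]
    rfl
  simp only [h]
  refine ⟨?_, Set.forall_mem_range.2 (Polynomial.le_gaussNorm _ _ (φ.frameNorm_pos _ _ _).le)⟩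
  obtain ⟨n, hn⟩ := Polynomial.exists_eq_gaussNorm x.abs
    (φ.frameNorm _ x (L.covers x.pt).choose_spec)
    (fiberPolynomial _ x.pt (L.covers x.pt).choose_spec s)
  exact ⟨n, hn.symm⟩

theorem pointSeminorm_of (x : Analytification k X) {n : ℕ} (s : L.sections k n) :
    φ.pointSeminorm x (SectionAlgebra.of s) = φ.abs s x := by
  rw [pointSeminorm_apply, fiberPolynomial_of, Polynomial.gaussNorm_monomial]
  rfl

theorem pointSeminorm_smul (x : Analytification k X) (a : k) (s : L.SectionAlgebra k) :
    φ.pointSeminorm x (a • s) = ‖a‖ * φ.pointSeminorm x s := by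
  refine (φ.isGreatest_pointSeminorm x (a • s)).unique ?_
  have h := (monotone_mul_left_of_nonneg (norm_nonneg a)).map_isGreatest
    (φ.isGreatest_pointSeminorm x s)
  rw [← Set.range_comp] at h
  simpa only [SectionAlgebra.component_smul, abs_smul, Function.comp_def] using h

theorem algNorm_eq_iSup_pointSeminorm (s : L.SectionAlgebra k) :
    φ.algNorm s = ⨆ x : Analytification k X, ENNReal.ofReal (φ.pointSeminorm x s) := by
  simp only [algNorm, supNorm]
  rw [iSup_comm]
  refine iSup_congr fun x => ?_
  obtain ⟨⟨n, hn⟩, hle⟩ := φ.isGreatest_pointSeminorm x s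
  refine le_antisymm (iSup_le fun m => ENNReal.ofReal_le_ofReal (hle ⟨m, rfl⟩)) ?_
  rw [← hn]
  exact le_iSup (fun n => ENNReal.ofReal (φ.abs (s.component n) x)) n

theorem ofReal_pointSeminorm_le (x : Analytification k X) (s : L.SectionAlgebra k) :
    ENNReal.ofReal (φ.pointSeminorm x s) ≤ φ.algNorm s := by
  rw [algNorm_eq_iSup_pointSeminorm]
  exact le_iSup (fun x => ENNReal.ofReal (φ.pointSeminorm x s)) x

theorem algNorm_smul (a : k) (s : L.SectionAlgebra k) :
    φ.algNorm (a • s) = ENNReal.ofReal ‖a‖ * φ.algNorm s := by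
  simp only [algNorm_eq_iSup_pointSeminorm, pointSeminorm_smul,
    ENNReal.ofReal_mul (norm_nonneg a), ENNReal.mul_iSup]

theorem algNorm_zero : φ.algNorm (0 : L.SectionAlgebra k) = 0 := by
  simp only [algNorm_eq_iSup_pointSeminorm, map_zero, ENNReal.ofReal_zero,
    ENNReal.iSup_zero]

theorem algNorm_one_le : φ.algNorm (1 : L.SectionAlgebra k) ≤ 1 := by
  simp only [algNorm_eq_iSup_pointSeminorm, map_one, ENNReal.ofReal_one]
  exact iSup_le fun _ => le_rfl

theorem algNorm_one [Nonempty (Analytification k X)] :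
    φ.algNorm (1 : L.SectionAlgebra k) = 1 := by
  simp only [algNorm_eq_iSup_pointSeminorm, map_one, ENNReal.ofReal_one, ciSup_const]

theorem algNorm_of {n : ℕ} (s : L.sections k n) :
    φ.algNorm (SectionAlgebra.of s) = φ.supNorm s := by
  simp only [algNorm_eq_iSup_pointSeminorm, pointSeminorm_of, supNorm]

theorem algNorm_add_le (s t : L.SectionAlgebra k) :
    φ.algNorm (s + t) ≤ max (φ.algNorm s) (φ.algNorm t) := by
  rw [algNorm_eq_iSup_pointSeminorm _ (s + t)]
  refine iSup_le fun x =>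
    (ENNReal.ofReal_le_ofReal (φ.isNonarchimedean_pointSeminorm x s t)).trans ?_
  rw [ENNReal.ofReal_max]
  exact max_le_max (φ.ofReal_pointSeminorm_le x s) (φ.ofReal_pointSeminorm_le x t)

theorem algNorm_mul_le (s t : L.SectionAlgebra k) :
    φ.algNorm (s * t) ≤ φ.algNorm s * φ.algNorm t := by
  rw [algNorm_eq_iSup_pointSeminorm _ (s * t)]
  refine iSup_le fun x => ?_
  rw [map_mul, ENNReal.ofReal_mul (apply_nonneg _ s)]
  exact mul_le_mul' (φ.ofReal_pointSeminorm_le x s) (φ.ofReal_pointSeminorm_le x t)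

theorem algNorm_pow (s : L.SectionAlgebra k) {n : ℕ} (hn : n ≠ 0) :
    φ.algNorm (s ^ n) = φ.algNorm s ^ n := by
  simp only [algNorm_eq_iSup_pointSeminorm, map_pow, ENNReal.ofReal_pow (apply_nonneg _ s)]
  exact (ENNReal.iSup_pow_of_ne_zero hn _).symm

end Metric

end LineBundle

/-! ### Pull-back and quotient norms -/

namespace LineBundle

section Pullback

variable {k : Type u} [CommRing k] {X Y : Scheme.{u}} [X.Over (Spec (CommRingCat.of k))]
  [Y.Over (Spec (CommRingCat.of k))] {L : LineBundle X} (f : Y ⟶ X)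
  [f.IsOver (Spec (CommRingCat.of k))]

theorem algebraPullback_of {n : ℕ} (s : L.sections k n) :
    L.algebraPullback k f (SectionAlgebra.of s) =
      SectionAlgebra.of (L.sectionsPullback k f n s) :=
  DirectSum.toAddMonoid_of (β := fun n => L.sections k n)
    (fun n => (DirectSum.lof k ℕ (fun n => (L.pullback f).sections k n) n ∘ₗ
      L.sectionsPullback k f n).toAddMonoidHom) n s

theorem component_algebraPullback (s : L.SectionAlgebra k) (n : ℕ) :
    (L.algebraPullback k f s).component n = L.sectionsPullback k f n (s.component n) := by
  induction s using SectionAlgebra.induction_on with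
  | zero => rw [map_zero, SectionAlgebra.component_zero, SectionAlgebra.component_zero, map_zero]
  | @homogeneous m s =>
    rw [algebraPullback_of]
    by_cases h : m = n
    · subst h
      rw [SectionAlgebra.component_of_self, SectionAlgebra.component_of_self]
    · rw [SectionAlgebra.component_of_ne h, SectionAlgebra.component_of_ne h, map_zero]
  | add s t hs ht =>
    rw [map_add, SectionAlgebra.component_add, hs, ht, SectionAlgebra.component_add, map_add]

end Pullback

namespace Metric

variable {k : Type u} [NormedField k] {X Y : Scheme.{u}} [X.Over (Spec (CommRingCat.of k))]
  [Y.Over (Spec (CommRingCat.of k))] {L : LineBundle X} (φ : Metric k L) (f : Y ⟶ X)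
  [f.IsOver (Spec (CommRingCat.of k))]

theorem pullback_abs {n : ℕ} (s : L.sections k n) (y : Analytification k Y) :
    (φ.pullback f).abs (L.sectionsPullback k f n s) y = φ.abs s (y.map f) := by
  obtain ⟨i, hi⟩ := L.covers (f y.pt)
  rw [φ.abs_eq s (y.map f) i hi,
    (φ.pullback f).abs_eq (L.sectionsPullback k f n s) y i hi]
  exact congrArg (· * _) (y.absEval_map f hi (s.1 i)).symm

theorem quotientAlgNorm_le {t : L.RestrictedAlgebra k f} {s : L.SectionAlgebra k}
    (h : L.algebraPullback k f s = t) : φ.quotientAlgNorm f t ≤ φ.algNorm s :=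
  iInf₂_le s h

theorem exists_algNorm_lt {t : L.RestrictedAlgebra k f} {c : ℝ≥0∞}
    (h : φ.quotientAlgNorm f t < c) :
    ∃ s : L.SectionAlgebra k, L.algebraPullback k f s = t ∧ φ.algNorm s < c := by
  simpa only [quotientAlgNorm, iInf_lt_iff, exists_prop] using h

variable [IsUltrametricDist k]

theorem pullback_pointSeminorm (s : L.SectionAlgebra k) (y : Analytification k Y) :
    (φ.pullback f).pointSeminorm y (L.algebraPullback k f s) =
      φ.pointSeminorm (y.map f) s := by
  have h := (φ.pullback f).isGreatest_pointSeminorm y (L.algebraPullback k f s)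
  simp only [component_algebraPullback, pullback_abs] at h
  exact h.unique (φ.isGreatest_pointSeminorm (y.map f) s)

theorem pullback_algNorm_le (s : L.SectionAlgebra k) :
    (φ.pullback f).algNorm (L.algebraPullback k f s) ≤ φ.algNorm s := by
  rw [algNorm_eq_iSup_pointSeminorm (φ.pullback f)]
  simp only [pullback_pointSeminorm]
  exact iSup_le fun y => φ.ofReal_pointSeminorm_le (y.map f) s

theorem pullback_algNorm_le_quotientAlgNorm (t : L.RestrictedAlgebra k f) :
    (φ.pullback f).algNorm t ≤ φ.quotientAlgNorm f t :=
  le_iInf₂ fun s hs => hs ▸ φ.pullback_algNorm_le f s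

theorem quotientAlgNorm_zero : φ.quotientAlgNorm f 0 = 0 :=
  le_antisymm ((φ.quotientAlgNorm_le f (s := 0) (map_zero _)).trans_eq φ.algNorm_zero) zero_le

theorem quotientAlgNorm_smul_le (a : k) (t : L.RestrictedAlgebra k f) :
    φ.quotientAlgNorm f (a • t) ≤ ENNReal.ofReal ‖a‖ * φ.quotientAlgNorm f t := by
  by_cases ha : a = 0
  · rw [ha, zero_smul, quotientAlgNorm_zero]
    exact zero_le
  have h0 : ENNReal.ofReal ‖a‖ ≠ 0 := by simpa using ha
  simp only [quotientAlgNorm, ENNReal.mul_iInf_of_ne h0 ENNReal.ofReal_ne_top]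
  refine le_iInf₂ fun s hs => ?_
  rw [← φ.algNorm_smul]
  exact iInf₂_le (a • s) (by rw [map_smul, hs]; rfl)

theorem quotientAlgNorm_smul (a : k) (t : L.RestrictedAlgebra k f) :
    φ.quotientAlgNorm f (a • t) = ENNReal.ofReal ‖a‖ * φ.quotientAlgNorm f t := by
  refine le_antisymm (φ.quotientAlgNorm_smul_le f a t) ?_
  by_cases ha : a = 0
  · rw [ha, norm_zero, ENNReal.ofReal_zero, zero_mul]
    exact zero_le
  have h := mul_le_mul_right (φ.quotientAlgNorm_smul_le f a⁻¹ (a • t)) (ENNReal.ofReal ‖a‖)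
  rwa [inv_smul_smul₀ ha, ← mul_assoc, ← ENNReal.ofReal_mul (norm_nonneg _), ← norm_mul,
    mul_inv_cancel₀ ha, norm_one, ENNReal.ofReal_one, one_mul] at h

theorem quotientAlgNorm_add_le (t t' : L.RestrictedAlgebra k f) :
    φ.quotientAlgNorm f (t + t') ≤ max (φ.quotientAlgNorm f t) (φ.quotientAlgNorm f t') := by
  refine le_of_forall_gt fun c hc => ?_
  obtain ⟨s, hs, hsc⟩ := φ.exists_algNorm_lt f ((le_max_left _ _).trans_lt hc)
  obtain ⟨s', hs', hsc'⟩ := φ.exists_algNorm_lt f ((le_max_right _ _).trans_lt hc)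
  refine (φ.quotientAlgNorm_le f (s := s + s') ?_).trans_lt
    ((φ.algNorm_add_le s s').trans_lt (max_lt hsc hsc'))
  rw [map_add, hs, hs']
  rfl

theorem quotientAlgNorm_mul_le (hfin : ∀ t, φ.quotientAlgNorm f t ≠ ⊤)
    (t t' : L.RestrictedAlgebra k f) :
    φ.quotientAlgNorm f (t * t') ≤ φ.quotientAlgNorm f t * φ.quotientAlgNorm f t' := by
  refine ENNReal.le_mul_of_forall_lt (.inr (hfin t')) (.inl (hfin t)) fun a ha b hb => ?_
  obtain ⟨s, hs, hsc⟩ := φ.exists_algNorm_lt f ha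
  obtain ⟨s', hs', hsc'⟩ := φ.exists_algNorm_lt f hb
  refine (φ.quotientAlgNorm_le f (s := s * s') ?_).trans
    ((φ.algNorm_mul_le s s').trans (mul_le_mul' hsc.le hsc'.le))
  rw [map_mul, hs, hs']
  rfl

end Metric

end LineBundle

theorem exists_algebraNorm {k : Type*} [NormedField k] {A : Type*} [CommRing A] [Algebra k A]
    (ν : A → ℝ≥0∞) (hfin : ∀ a, ν a ≠ ⊤) (hadd : ∀ a b, ν (a + b) ≤ max (ν a) (ν b))
    (hmul : ∀ a b, ν (a * b) ≤ ν a * ν b)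
    (hsmul : ∀ (c : k) a, ν (c • a) = ENNReal.ofReal ‖c‖ * ν a) (heq : ∀ a, ν a = 0 → a = 0) :
    ∃ P : AlgebraNorm k A, IsNonarchimedean P ∧ ∀ a, ENNReal.ofReal (P a) = ν a := by
  have hna (a b : A) : (ν (a + b)).toReal ≤ max (ν a).toReal (ν b).toReal := by
    rw [← ENNReal.toReal_max (hfin a) (hfin b)]
    exact ENNReal.toReal_mono (max_ne_top (hfin a) (hfin b)) (hadd a b)
  have hzero : ν 0 = 0 := by
    simpa only [zero_smul, norm_zero, ENNReal.ofReal_zero, zero_mul] using hsmul 0 0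
  have hneg (a : A) : ν (-a) = ν a := by
    simpa only [neg_one_smul, norm_neg, norm_one, ENNReal.ofReal_one, one_mul] using hsmul (-1) a
  exact ⟨{
    toFun a := (ν a).toReal
    map_zero' := by rw [hzero, ENNReal.toReal_zero]
    add_le' a b := (hna a b).trans
      (max_le_add_of_nonneg ENNReal.toReal_nonneg ENNReal.toReal_nonneg)
    neg' a := by rw [hneg]
    mul_le' a b := by
      rw [← ENNReal.toReal_mul]
      exact ENNReal.toReal_mono (ENNReal.mul_ne_top (hfin a) (hfin b)) (hmul a b)
    eq_zero_of_map_eq_zero' a ha :=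
      heq a (((ENNReal.toReal_eq_zero_iff _).1 ha).resolve_right (hfin a))
    smul' c a := by
      rw [hsmul, ENNReal.toReal_mul, ENNReal.toReal_ofReal (norm_nonneg c)] },
    hna, fun a => ENNReal.ofReal_toReal (hfin a)⟩

/-! ### Upper bounds for Fubini–Study metrics -/

namespace LineBundle

variable {k : Type u} [NormedField k] {X : Scheme.{u}} [X.Over (Spec (CommRingCat.of k))]
  {L : LineBundle X}

theorem norm_evalAt {n : ℕ} (i : L.ι) (x : Analytification k X) (hx : x.pt ∈ L.U i)
    (s : L.sections k n) : ‖L.evalAt n i x hx s‖ = x.absEval hx (s.1 i) :=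
  x.norm_toCompleted _

theorem absEval_mul_fubiniStudy_le {n : ℕ} {p : Seminorm k (L.sections k n)}
    (hp : ∀ s, p s = 0 → s = 0) (i : L.ι) (x : Analytification k X) (hx : x.pt ∈ L.U i)
    (s : L.sections k n) : x.absEval hx (s.1 i) * fubiniStudy p i x hx ≤ p s := by
  let := x.normedAlgebraCompleted
  rw [← norm_evalAt]
  by_cases h0 : L.evalAt n i x hx s = 0
  · rw [h0, norm_zero, zero_mul]
    exact apply_nonneg p s
  have hpos : 0 < ‖L.evalAt n i x hx s‖ := norm_pos_iff.2 h0
  rw [mul_comm, ← le_div_iff₀ hpos]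
  calc fubiniStudy p i x hx
      ≤ scalarExtension p x.CompletedResidueField ((L.evalAt n i x hx s)⁻¹ ⊗ₜ s) := by
        refine csInf_le ⟨0, ?_⟩ ⟨_, ?_, rfl⟩
        · rintro _ ⟨w, -, rfl⟩
          exact scalarExtension_nonneg w
        · rw [LinearMap.liftBaseChange_tmul, smul_eq_mul, inv_mul_cancel₀ h0]
    _ ≤ ‖(L.evalAt n i x hx s)⁻¹‖ * p s := scalarExtension_tmul_le hp _ s
    _ = p s / ‖L.evalAt n i x hx s‖ := by rw [norm_inv, inv_mul_eq_div]

theorem le_exp_mul_pow_of_abs_log_le {F c ε : ℝ} (hF : 0 < F) (hc : 0 < c) {n : ℕ} (hn : n ≠ 0)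
    (h : |Real.log (F ^ (1 / (n : ℝ)) / c)| ≤ ε) :
    F ≤ Real.exp (n * ε) * c ^ n ∧ c ^ n ≤ Real.exp (n * ε) * F := by
  have hn' : (0 : ℝ) < n := by positivity
  have hlog : Real.log (F ^ (1 / (n : ℝ)) / c) = (Real.log F - Real.log (c ^ n)) / n := by
    rw [Real.log_div (Real.rpow_pos_of_pos hF _).ne' hc.ne', Real.log_rpow hF, Real.log_pow]
    field_simp
  rw [hlog, abs_div, abs_of_pos hn', div_le_iff₀ hn', abs_le] at h
  constructor
  · rw [← Real.log_le_log_iff hF (by positivity), Real.log_mul (by positivity) (by positivity),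
      Real.log_exp]
    linarith
  · rw [← Real.log_le_log_iff (by positivity) (by positivity),
      Real.log_mul (by positivity) hF.ne', Real.log_exp]
    linarith

namespace Metric

variable {φ : Metric k L}

theorem abs_le_exp_mul {ε : ℝ} {n : ℕ} (hn : n ≠ 0) {p : Seminorm k (L.sections k n)}
    (hp : ∀ s, p s = 0 → s = 0)
    (h : ∀ i x (hx : x.pt ∈ L.U i), 0 < fubiniStudy p i x hx ∧
      |Real.log (fubiniStudy p i x hx ^ (1 / (n : ℝ)) / φ.frameNorm i x hx)| ≤ ε)
    (s : L.sections k n) (x : Analytification k X) :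
    φ.abs s x ≤ Real.exp (n * ε) * p s := by
  obtain ⟨i, hi⟩ := L.covers x.pt
  have hframe := (le_exp_mul_pow_of_abs_log_le (h i x hi).1 (φ.frameNorm_pos i x hi) hn
    (h i x hi).2).2
  calc φ.abs s x = x.absEval hi (s.1 i) * φ.frameNorm i x hi ^ n := φ.abs_eq s x i hi
    _ ≤ x.absEval hi (s.1 i) * (Real.exp (n * ε) * fubiniStudy p i x hi) :=
        mul_le_mul_of_nonneg_left hframe (x.abs.nonneg _)
    _ = Real.exp (n * ε) * (x.absEval hi (s.1 i) * fubiniStudy p i x hi) := mul_left_comm ..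
    _ ≤ Real.exp (n * ε) * p s :=
        mul_le_mul_of_nonneg_left (absEval_mul_fubiniStudy_le hp i x hi s) (Real.exp_pos _).le

theorem supNorm_ne_top_of_pos [IsUltrametricDist k] (hφ : φ.IsAsymptoticFubiniStudy) {n : ℕ}
    (hn : n ≠ 0) (s : L.sections k n) : φ.supNorm s ≠ ⊤ := by
  obtain ⟨p, hp, h⟩ := hφ
  obtain ⟨m, hm⟩ := Filter.eventually_atTop.1 (h 1 one_pos)
  have hnm : n * (m + 1) ≠ 0 := mul_ne_zero hn m.succ_ne_zero
  have hbound := abs_le_exp_mul hnm (hp _) (hm (n * (m + 1))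
    (m.le_succ.trans (Nat.le_mul_of_pos_left _ (Nat.pos_of_ne_zero hn)))) (powSection s (m + 1))
  have hpow : φ.algNorm (SectionAlgebra.of s) ^ (m + 1) ≠ ⊤ := by
    rw [← φ.algNorm_pow _ m.succ_ne_zero, SectionAlgebra.of_pow, algNorm_of]
    exact ne_top_of_le_ne_top ENNReal.ofReal_ne_top
      (iSup_le fun x => ENNReal.ofReal_le_ofReal (hbound x))
  rw [← algNorm_of]
  exact fun h => hpow (by rw [h, ENNReal.top_pow m.succ_ne_zero])

end Metric

end LineBundle

/-! ### Projective schemes are proper -/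

section Projective

attribute [local instance] MvPolynomial.gradedAlgebra

theorem IsProjectiveOver.isProper {k : Type u} [CommRing k] {X : Scheme.{u}}
    [X.Over (Spec (CommRingCat.of k))] (hX : IsProjectiveOver k X) :
    IsProper (X ↘ Spec (CommRingCat.of k)) := by
  obtain ⟨N, j, hj, h⟩ := hX
  rw [← h]
  let 𝒜 := MvPolynomial.homogeneousSubmodule (Fin (N + 1)) k
  have : IsScalarTower k (𝒜 0) (MvPolynomial (Fin (N + 1)) k) :=
    ⟨fun a b c => smul_mul_assoc a b.1 c⟩
  have : Algebra.FiniteType (𝒜 0) (MvPolynomial (Fin (N + 1)) k) :=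
    Algebra.FiniteType.of_restrictScalars_finiteType k (𝒜 0) (MvPolynomial (Fin (N + 1)) k)
  have hsurj : Function.Surjective (algebraMap k (𝒜 0)) := by
    rintro ⟨q, hq⟩
    have hq' : q.IsHomogeneous 0 := hq
    refine ⟨MvPolynomial.coeff 0 q, Subtype.ext ?_⟩
    exact (MvPolynomial.totalDegree_eq_zero_iff_eq_C.1
      (Nat.le_zero.1 hq'.totalDegree_le)).symm
  have : IsClosedImmersion (Spec.map (CommRingCat.ofHom (algebraMap k (𝒜 0)))) :=
    IsClosedImmersion.spec_of_surjective _ hsurj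
  infer_instance

end Projective

/-! ### Existence of points and finiteness of norms -/

theorem fromSpecStalk_over {k : Type u} [CommRing k] {Y : Scheme.{u}}
    [Y.Over (Spec (CommRingCat.of k))] (y : Y) :
    Y.fromSpecStalk y ≫ (Y ↘ Spec (CommRingCat.of k)) =
      Spec.map (CommRingCat.ofHom
        ((Y.presheaf.germ ⊤ y trivial).hom.comp (structureHom k (⊤ : Y.Opens)))) := by
  have h : (Y ↘ Spec (CommRingCat.of k)) = Y.toSpecΓ ≫
      Spec.map ((Scheme.ΓSpecIso (CommRingCat.of k)).inv ≫
        (Y ↘ Spec (CommRingCat.of k)).appTop) := by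
    rw [Spec.map_comp, ← Category.assoc, ← Scheme.toSpecΓ_naturality, Category.assoc,
      ← SpecMap_ΓSpecIso_hom, ← Spec.map_comp, Iso.inv_hom_id, Spec.map_id,
      Category.comp_id]
  rw [h, Scheme.fromSpecStalk_toSpecΓ_assoc, ← Spec.map_comp]
  congr 1
  ext a
  simp only [structureHom, Scheme.Hom.appTop, Scheme.Hom.app_eq_appLE]
  rfl

theorem fromSpecResidueField_over {k : Type u} [CommRing k] {Y : Scheme.{u}}
    [Y.Over (Spec (CommRingCat.of k))] (y : Y) :
    Y.fromSpecResidueField y ≫ (Y ↘ Spec (CommRingCat.of k)) =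
      Spec.map (CommRingCat.ofHom (residueHom k y)) := by
  rw [Scheme.fromSpecResidueField, Category.assoc, fromSpecStalk_over, ← Spec.map_comp]
  rfl

theorem isIntegral_residueHom_of_isClosed {k : Type u} [Field k] {Y : Scheme.{u}}
    [Y.Over (Spec (CommRingCat.of k))] [LocallyOfFiniteType (Y ↘ Spec (CommRingCat.of k))] {y : Y}
    (hy : IsClosed {y}) : (residueHom k y).IsIntegral := by
  have : IsFinite (Y.fromSpecResidueField y ≫ (Y ↘ Spec (CommRingCat.of k))) := by
    rw [isClosed_singleton_iff_isClosedImmersion] at hy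
    rw [isFinite_iff_locallyOfFiniteType_of_jacobsonSpace]
    infer_instance
  rw [fromSpecResidueField_over] at this
  exact (IsIntegralHom.SpecMap_iff (φ := CommRingCat.ofHom (residueHom k y))).1 inferInstance

theorem isIntegral_structureHom_top (k : Type u) [CommRing k] (X : Scheme.{u})
    [X.Over (Spec (CommRingCat.of k))] [UniversallyClosed (X ↘ Spec (CommRingCat.of k))] :
    (structureHom k (⊤ : X.Opens)).IsIntegral := by
  have h := RingHom.isIntegral_respectsIso.2 _
    (Scheme.ΓSpecIso (CommRingCat.of k)).symm.commRingCatIsoToRingEquiv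
    (isIntegral_appTop_of_universallyClosed (X ↘ Spec (CommRingCat.of k)))
  rw [Scheme.Hom.appTop, Scheme.Hom.app_eq_appLE] at h
  exact h

theorem LineBundle.exists_forall_restrict_eq {k : Type u} [CommRing k] {X : Scheme.{u}}
    [X.Over (Spec (CommRingCat.of k))] {L : LineBundle X} (s : L.sections k 0) :
    ∃ g : Γ(X, ⊤), ∀ i, g |_ L.U i = s.1 i := by
  obtain ⟨g, hg, -⟩ := X.sheaf.existsUnique_gluing' L.U ⊤ (fun i => homOfLE le_top)
    (fun x _ => Opens.mem_iSup.2 (L.covers x)) s.1 (fun i j => by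
      have h := s.2 i j
      rw [pow_zero, one_mul] at h
      exact h)
  exact ⟨g, hg⟩

section Points

variable {k : Type u} [NontriviallyNormedField k] [IsUltrametricDist k] [CompleteSpace k]
  {X : Scheme.{u}} [X.Over (Spec (CommRingCat.of k))]

theorem exists_analytification_mem [LocallyOfFiniteType (X ↘ Spec (CommRingCat.of k))]
    (V : X.Opens) (hV : (V : Set X).Nonempty) : ∃ x : Analytification k X, x.pt ∈ V := by
  have : JacobsonSpace X := LocallyOfFiniteType.jacobsonSpace (X ↘ Spec (CommRingCat.of k))
  obtain ⟨x, hxV, hx⟩ := nonempty_inter_closedPoints hV V.isOpen.isLocallyClosed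
  let : Algebra k (X.residueField x) := (residueHom k x).toAlgebra
  have : Algebra.IsAlgebraic k (X.residueField x) :=
    (⟨isIntegral_residueHom_of_isClosed hx⟩ :
      Algebra.IsIntegral k (X.residueField x)).isAlgebraic
  exact ⟨⟨x, MulRingNorm.mulRingNormEquivAbsoluteValue
    (spectralMulAlgNorm k (X.residueField x)).toMulRingNorm,
    spectralNorm_extends (K := k) (L := X.residueField x)⟩, hxV⟩

namespace LineBundle

variable {L : LineBundle X}

theorem Metric.eq_zero_of_algNorm_eq_zero [IsReduced X]
    [LocallyOfFiniteType (X ↘ Spec (CommRingCat.of k))] (φ : Metric k L)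
    {s : L.SectionAlgebra k} (hs : φ.algNorm s = 0) : s = 0 := by
  refine SectionAlgebra.ext_component fun n => Subtype.ext (funext fun i => ?_)
  rw [SectionAlgebra.component_zero]
  refine (basicOpen_eq_bot_iff _).1 (not_not.1 fun hne => ?_)
  obtain ⟨x, hx⟩ := exists_analytification_mem (k := k) (X.basicOpen ((s.component n).1 i))
    (Set.nonempty_iff_ne_empty.2 fun h => hne (Opens.ext h))
  have hxi : x.pt ∈ L.U i := X.basicOpen_le _ hx
  have hval : 0 < x.absEval hxi ((s.component n).1 i) :=
    x.abs.pos ((Scheme.evaluation_ne_zero_iff_mem_basicOpen X x.pt hxi _).2 hx)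
  have habs : φ.abs (s.component n) x ≤ 0 := by
    rw [← ENNReal.ofReal_eq_zero, ← le_zero_iff, ← hs]
    exact (le_iSup (fun x => ENNReal.ofReal (φ.abs (s.component n) x)) x).trans
      (φ.supNorm_component_le s n)
  rw [φ.abs_eq _ x i hxi] at habs
  exact habs.not_gt (mul_pos hval (pow_pos (φ.frameNorm_pos i x hxi) n))

variable [IsIntegral X] [UniversallyClosed (X ↘ Spec (CommRingCat.of k))]

-- Global functions are algebraic over `k`, so the absolute value of `k` extends uniquely to them.
theorem exists_forall_abs_eq (s : L.sections k 0) :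
    ∃ r : ℝ, ∀ (φ : Metric k L) (x : Analytification k X), φ.abs s x = r := by
  obtain ⟨g, hg⟩ := exists_forall_restrict_eq s
  let : Field Γ(X, ⊤) := (isField_of_universallyClosed k (X ↘ Spec (CommRingCat.of k))).toField
  let : Algebra k Γ(X, ⊤) := (structureHom k (⊤ : X.Opens)).toAlgebra
  have : Algebra.IsAlgebraic k Γ(X, ⊤) :=
    (⟨isIntegral_structureHom_top k X⟩ : Algebra.IsIntegral k Γ(X, ⊤)).isAlgebraic
  refine ⟨spectralNorm k Γ(X, ⊤) g, fun φ x => ?_⟩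
  obtain ⟨i, hi⟩ := L.covers x.pt
  rw [φ.abs_eq s x i hi, pow_zero, mul_one, ← hg i]
  refine (x.absEval_restrict le_top hi g).trans ?_
  let v : AbsoluteValue Γ(X, ⊤) ℝ :=
    x.abs.comp (f := (X.evaluation ⊤ x.pt trivial).hom) (RingHom.injective _)
  exact spectralNorm_unique_field_norm_ext (K := k) (L := Γ(X, ⊤)) (f := v)
    (fun a => x.abs_residueHom a) g

namespace Metric

variable {φ : Metric k L}

theorem supNorm_ne_top (hφ : φ.IsAsymptoticFubiniStudy) {n : ℕ} (s : L.sections k n) :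
    φ.supNorm s ≠ ⊤ := by
  rcases eq_or_ne n 0 with rfl | hn
  · obtain ⟨r, hr⟩ := exists_forall_abs_eq s
    exact ne_top_of_le_ne_top ENNReal.ofReal_ne_top
      (iSup_le fun x => ENNReal.ofReal_le_ofReal (hr φ x).le)
  · exact supNorm_ne_top_of_pos hφ hn s

theorem algNorm_ne_top (hφ : φ.IsAsymptoticFubiniStudy) (s : L.SectionAlgebra k) :
    φ.algNorm s ≠ ⊤ := by
  induction s using SectionAlgebra.induction_on with
  | zero => exact φ.algNorm_zero.trans_ne ENNReal.zero_ne_top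
  | homogeneous s =>
    rw [algNorm_of]
    exact supNorm_ne_top hφ s
  | add s t hs ht => exact ne_top_of_le_ne_top (max_ne_top hs ht) (φ.algNorm_add_le s t)

end Metric

end LineBundle

end Points

/-! ### Sections as rational functions -/

section RationalFunctions

variable {X : Scheme.{u}} [IsIntegral X]

theorem genericPoint_mem {W : X.Opens} {x : X} (hx : x ∈ W) : genericPoint X ∈ W :=
  ((genericPoint_spec X).mem_open_set_iff W.isOpen).2 ⟨x, trivial, hx⟩

/-- The rational function defined by a section of the structure sheaf: Mathlib's
`Scheme.germToFunctionField`, with the non-emptiness of `W` witnessed by the generic point. -/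
def rationalOf (W : X.Opens) (hW : genericPoint X ∈ W) : Γ(X, W) →+* X.functionField :=
  (X.presheaf.germ W (genericPoint X) hW).hom

theorem rationalOf_restrict {V W : X.Opens} (h : V ≤ W) (hV : genericPoint X ∈ V) (a : Γ(X, W)) :
    rationalOf V hV (X.presheaf.map (homOfLE h).op a) = rationalOf W (h hV) a :=
  X.presheaf.germ_res_apply (homOfLE h) _ hV a

theorem rationalOf_injective (W : X.Opens) (hW : genericPoint X ∈ W) :
    Function.Injective (rationalOf W hW) :=
  germ_injective_of_isIntegral X _ hW

theorem section_ext {W : X.Opens} {a b : Γ(X, W)}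
    (h : ∀ hW : genericPoint X ∈ W, rationalOf W hW a = rationalOf W hW b) : a = b := by
  by_cases hW : genericPoint X ∈ W
  · exact rationalOf_injective W hW (h hW)
  · obtain rfl : W = ⊥ :=
      Opens.ext (Set.eq_empty_of_forall_notMem fun x hx => hW (genericPoint_mem hx))
    exact Subsingleton.elim _ _

theorem exists_rationalOf_eq (V : X.Opens) (h : X.functionField)
    (hloc : ∀ x ∈ V, ∃ (W : X.Opens) (hW : x ∈ W) (a : Γ(X, W)),
      rationalOf W (genericPoint_mem hW) a = h) :
    ∃ a : Γ(X, V), ∀ hV : genericPoint X ∈ V, rationalOf V hV a = h := by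
  choose W hW a ha using fun x : V => hloc x.1 x.2
  obtain ⟨b, hb, -⟩ := X.sheaf.existsUnique_gluing' (fun x => W x ⊓ V) V
    (fun x => homOfLE inf_le_right) (fun x hx => Opens.mem_iSup.2 ⟨⟨x, hx⟩, hW ⟨x, hx⟩, hx⟩)
    (fun x => X.presheaf.map (homOfLE (inf_le_left : W x ⊓ V ≤ W x)).op (a x)) (fun x y => by
      refine section_ext fun hη => ?_
      refine (rationalOf_restrict _ hη _).trans
        (Eq.trans ?_ (rationalOf_restrict _ hη _).symm)
      rw [rationalOf_restrict, rationalOf_restrict, ha, ha])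
  refine ⟨b, fun hV => ?_⟩
  have hη : genericPoint X ∈ W ⟨_, hV⟩ ⊓ V := ⟨hW _, hV⟩
  calc rationalOf V hV b
      = rationalOf _ hη (X.presheaf.map (homOfLE inf_le_right).op b) :=
        (rationalOf_restrict inf_le_right hη b).symm
    _ = rationalOf _ hη (X.presheaf.map (homOfLE inf_le_left).op (a ⟨_, hV⟩)) :=
        congrArg (rationalOf _ hη) (hb ⟨_, hV⟩)
    _ = h := (rationalOf_restrict inf_le_left hη _).trans (ha _)

theorem genericPoint_mem_basicOpen_iff {W : X.Opens} (hW : genericPoint X ∈ W) (a : Γ(X, W)) :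
    genericPoint X ∈ X.basicOpen a ↔ rationalOf W hW a ≠ 0 := by
  rw [X.mem_basicOpen a _ hW]
  exact isUnit_iff_ne_zero

theorem exists_rationalOf_eq_pow_mul {V W : X.Opens} (hW : IsAffineOpen W) (τ : Γ(X, W))
    (hτV : X.basicOpen τ ≤ V) (hη : genericPoint X ∈ X.basicOpen τ) (a : Γ(X, V)) :
    ∃ (M : ℕ) (b : Γ(X, W)), rationalOf W (X.basicOpen_le τ hη) b =
      rationalOf W (X.basicOpen_le τ hη) τ ^ M * rationalOf V (hτV hη) a := by
  obtain ⟨M, b, hb⟩ := exists_eq_pow_mul_of_isAffineOpen X W hW τ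
    (X.presheaf.map (homOfLE hτV).op a)
  refine ⟨M, b, ?_⟩
  have h := congrArg (rationalOf _ hη) hb
  rw [map_mul, map_pow, rationalOf_restrict] at h
  exact (rationalOf_restrict (X.basicOpen_le τ) hη b).symm.trans
    (h.trans (congrArg (· ^ M * _) (rationalOf_restrict (X.basicOpen_le τ) hη τ)))

end RationalFunctions

namespace LineBundle

theorem mem_nonvanishing {X : Scheme.{u}} {L : LineBundle X} {k : Type u} [CommRing k]
    [X.Over (Spec (CommRingCat.of k))] {n : ℕ} {s : L.sections k n} {x : X} :
    x ∈ nonvanishing s ↔ ∃ i, x ∈ X.basicOpen (s.1 i) := Opens.mem_iSup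

variable {X : Scheme.{u}} [IsIntegral X] (L : LineBundle X)

/-- The rational function `e j / e i` by which two frames of `L` differ. -/
def ratio (i j : L.ι) (hi : genericPoint X ∈ L.U i) (hj : genericPoint X ∈ L.U j) :
    X.functionField :=
  rationalOf (L.U i ⊓ L.U j) ⟨hi, hj⟩ (L.g i j)

theorem ratio_self (i : L.ι) (hi : genericPoint X ∈ L.U i) : L.ratio i i hi hi = 1 := by
  rw [ratio, L.g_self, map_one]

theorem ratio_mul (i j l : L.ι) (hi : genericPoint X ∈ L.U i) (hj : genericPoint X ∈ L.U j)
    (hl : genericPoint X ∈ L.U l) : L.ratio i j hi hj * L.ratio j l hj hl = L.ratio i l hi hl := by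
  have hx : genericPoint X ∈ L.U i ⊓ L.U j ⊓ L.U l := ⟨⟨hi, hj⟩, hl⟩
  have h := congrArg (rationalOf _ hx) (L.g_trans i j l)
  rw [map_mul, rationalOf_restrict, rationalOf_restrict, rationalOf_restrict] at h
  exact h

theorem ratio_ne_zero (i j : L.ι) (hi : genericPoint X ∈ L.U i) (hj : genericPoint X ∈ L.U j) :
    L.ratio i j hi hj ≠ 0 := by
  have h : L.ratio i j hi hj * L.ratio j i hj hi = 1 := by rw [ratio_mul, ratio_self]
  exact left_ne_zero_of_mul_eq_one h

/-- The index of the reference frame `e`, a frame that is defined at the generic point. -/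
def genericIndex : L.ι := (L.covers (genericPoint X)).choose

theorem genericPoint_mem_genericIndex : genericPoint X ∈ L.U L.genericIndex :=
  (L.covers (genericPoint X)).choose_spec

/-- The rational function `e / e i`, where `e` is the reference frame. -/
def scale (i : L.ι) (hi : genericPoint X ∈ L.U i) : X.functionField :=
  L.ratio i L.genericIndex hi L.genericPoint_mem_genericIndex

theorem scale_eq_ratio_mul (i j : L.ι) (hi : genericPoint X ∈ L.U i)
    (hj : genericPoint X ∈ L.U j) : L.scale i hi = L.ratio i j hi hj * L.scale j hj :=
  (L.ratio_mul i j L.genericIndex hi hj L.genericPoint_mem_genericIndex).symm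

theorem scale_ne_zero (i : L.ι) (hi : genericPoint X ∈ L.U i) : L.scale i hi ≠ 0 :=
  L.ratio_ne_zero _ _ _ _

variable {L} {k : Type u} [CommRing k] [X.Over (Spec (CommRingCat.of k))]

/-- The rational function `s / e ^ n` of a section `s` of `L^{⊗ n}`, where `e` is the reference
frame. -/
def rationalValue {n : ℕ} (s : L.sections k n) : X.functionField :=
  rationalOf _ L.genericPoint_mem_genericIndex (s.1 L.genericIndex)

theorem rationalOf_section {n : ℕ} (s : L.sections k n) (i : L.ι) (hi : genericPoint X ∈ L.U i) :
    rationalOf (L.U i) hi (s.1 i) = L.scale i hi ^ n * rationalValue s := by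
  have hx : genericPoint X ∈ L.U i ⊓ L.U L.genericIndex := ⟨hi, L.genericPoint_mem_genericIndex⟩
  have h := congrArg (rationalOf _ hx) (s.2 i L.genericIndex)
  rwa [map_mul, map_pow, rationalOf_restrict, rationalOf_restrict] at h

theorem rationalValue_injective {n : ℕ} {s t : L.sections k n}
    (h : rationalValue s = rationalValue t) : s = t := by
  refine Subtype.ext (funext fun i => section_ext fun hi => ?_)
  rw [rationalOf_section, rationalOf_section, h]

theorem rationalValue_add {n : ℕ} (s t : L.sections k n) :
    rationalValue (s + t) = rationalValue s + rationalValue t :=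
  map_add (rationalOf _ L.genericPoint_mem_genericIndex) _ _

theorem rationalValue_zero {n : ℕ} : rationalValue (0 : L.sections k n) = 0 :=
  map_zero (rationalOf _ L.genericPoint_mem_genericIndex)

theorem rationalValue_mulSection {m n : ℕ} (s : L.sections k m) (t : L.sections k n) :
    rationalValue (mulSection s t) = rationalValue s * rationalValue t :=
  map_mul (rationalOf _ L.genericPoint_mem_genericIndex) _ _

theorem rationalValue_powSection {n : ℕ} (s : L.sections k n) (m : ℕ) :
    rationalValue (powSection s m) = rationalValue s ^ m :=
  map_pow (rationalOf _ L.genericPoint_mem_genericIndex) _ _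

theorem exists_rationalValue_eq (n : ℕ) (h : X.functionField)
    (hloc : ∀ x : X, ∃ (i : L.ι) (W : X.Opens) (hi : x ∈ L.U i) (hW : x ∈ W) (a : Γ(X, W)),
      rationalOf W (genericPoint_mem hW) a = L.scale i (genericPoint_mem hi) ^ n * h) :
    ∃ s : L.sections k n, rationalValue s = h := by
  have hregular (j : L.ι) : ∃ a : Γ(X, L.U j), ∀ hj : genericPoint X ∈ L.U j,
      rationalOf (L.U j) hj a = L.scale j hj ^ n * h := by
    by_cases hj : genericPoint X ∈ L.U j
    · obtain ⟨a, ha⟩ := exists_rationalOf_eq (L.U j) (L.scale j hj ^ n * h) fun x hx => by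
        obtain ⟨i, W, hi, hW, a, ha⟩ := hloc x
        have hV : x ∈ W ⊓ (L.U j ⊓ L.U i) := ⟨hW, hx, hi⟩
        refine ⟨W ⊓ (L.U j ⊓ L.U i), hV,
          X.presheaf.map (homOfLE inf_le_left).op a *
            X.presheaf.map (homOfLE inf_le_right).op (L.g j i) ^ n, ?_⟩
        rw [map_mul, map_pow, rationalOf_restrict, rationalOf_restrict, ha]
        rw [L.scale_eq_ratio_mul j i hj (genericPoint_mem hi), ratio]
        ring
      exact ⟨a, fun _ => ha hj⟩
    · exact ⟨0, fun hj' => (hj hj').elim⟩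
  choose s hs using hregular
  refine ⟨⟨s, fun i j => section_ext fun hij => ?_⟩, ?_⟩
  · rw [map_mul, map_pow, rationalOf_restrict, rationalOf_restrict, hs, hs,
      L.scale_eq_ratio_mul i j hij.1 hij.2, ratio, mul_pow, mul_assoc]
  · refine (hs L.genericIndex L.genericPoint_mem_genericIndex).trans ?_
    rw [scale, ratio_self, one_pow, one_mul]

theorem rationalValue_ne_zero {n : ℕ} {s : L.sections k n} {x : X} (hx : x ∈ nonvanishing s) :
    rationalValue s ≠ 0 := by
  obtain ⟨i, hi⟩ := mem_nonvanishing.1 hx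
  have h := (genericPoint_mem_basicOpen_iff (genericPoint_mem (X.basicOpen_le _ hi)) _).1
    (genericPoint_mem hi)
  rw [rationalOf_section] at h
  exact right_ne_zero_of_mul h

theorem exists_rationalOf_nonvanishing_eq {m n d e : ℕ} (h : m * d = n * e) (σ : L.sections k m)
    (s : L.sections k n) :
    ∃ a : Γ(X, nonvanishing s), ∀ hV : genericPoint X ∈ nonvanishing s,
      rationalOf _ hV a = rationalValue σ ^ d / rationalValue s ^ e := by
  refine exists_rationalOf_eq _ _ fun x hx => ?_
  obtain ⟨i, hi⟩ := mem_nonvanishing.1 hx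
  have hle : X.basicOpen (s.1 i) ≤ L.U i := X.basicOpen_le _
  have hη := genericPoint_mem hi
  have hu : IsUnit (X.presheaf.map (homOfLE hle).op (s.1 i)) :=
    X.toRingedSpace.isUnit_res_basicOpen (s.1 i)
  obtain ⟨v, hv⟩ := hu.exists_right_inv
  refine ⟨_, hi, X.presheaf.map (homOfLE hle).op (σ.1 i) ^ d * v ^ e, ?_⟩
  have hinv : L.scale i (hle hη) ^ n * rationalValue s * rationalOf _ hη v = 1 := by
    have h := congrArg (rationalOf _ hη) hv
    rwa [map_mul, map_one, rationalOf_restrict, rationalOf_section] at h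
  rw [map_mul, map_pow, map_pow, rationalOf_restrict, rationalOf_section,
    eq_div_iff (pow_ne_zero _ (rationalValue_ne_zero hx))]
  calc (L.scale i (hle hη) ^ m * rationalValue σ) ^ d * rationalOf _ hη v ^ e * rationalValue s ^ e
      = rationalValue σ ^ d * (L.scale i (hle hη) ^ (m * d) * rationalValue s ^ e *
        rationalOf _ hη v ^ e) := by ring
    _ = rationalValue σ ^ d *
        (L.scale i (hle hη) ^ n * rationalValue s * rationalOf _ hη v) ^ e := by rw [h]; ring
    _ = rationalValue σ ^ d := by rw [hinv, one_pow, mul_one]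

theorem exists_nhds_rationalOf_eq_mul_pow {n : ℕ} (s : L.sections k n)
    (hη : genericPoint X ∈ nonvanishing s) (a : Γ(X, nonvanishing s)) (x : X) :
    ∃ (W : X.Opens) (i : L.ι) (hW : x ∈ W) (hWi : W ≤ L.U i) (M : ℕ), ∀ N ≥ M, ∃ b : Γ(X, W),
      rationalOf W (genericPoint_mem hW) b = L.scale i (hWi (genericPoint_mem hW)) ^ (n * N) *
        (rationalOf _ hη a * rationalValue s ^ N) := by
  obtain ⟨i, hi⟩ := L.covers x
  obtain ⟨_, ⟨W, hWaff, rfl⟩, hxW, hWi : W ≤ L.U i⟩ :=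
    X.isBasis_affineOpens.exists_subset_of_mem_open hi (L.U i).isOpen
  have hηW : genericPoint X ∈ W := genericPoint_mem hxW
  let τ : Γ(X, W) := X.presheaf.map (homOfLE hWi).op (s.1 i)
  have hτ : rationalOf W hηW τ = L.scale i (hWi hηW) ^ n * rationalValue s := by
    rw [rationalOf_restrict, rationalOf_section]
  have hτV : X.basicOpen τ ≤ nonvanishing s := by
    rw [X.basicOpen_res]
    exact inf_le_right.trans (le_iSup (fun i => X.basicOpen (s.1 i)) i)
  have hητ : genericPoint X ∈ X.basicOpen τ := by
    rw [genericPoint_mem_basicOpen_iff hηW, hτ]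
    exact mul_ne_zero (pow_ne_zero _ (L.scale_ne_zero i _)) (rationalValue_ne_zero hη)
  obtain ⟨M, b, hb⟩ := exists_rationalOf_eq_pow_mul hWaff τ hτV hητ a
  refine ⟨W, i, hxW, hWi, M, fun N hN => ⟨b * τ ^ (N - M), ?_⟩⟩
  rw [map_mul, map_pow, hb, hτ, mul_right_comm, ← pow_add, Nat.add_sub_cancel' hN]
  ring

theorem exists_rationalValue_eq_mul_pow [CompactSpace X] {n : ℕ} (s : L.sections k n)
    (hη : genericPoint X ∈ nonvanishing s) (a : Γ(X, nonvanishing s)) :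
    ∃ (M : ℕ) (σ : L.sections k (n * M)),
      rationalValue σ = rationalOf _ hη a * rationalValue s ^ M := by
  choose W i hW hWi M hM using exists_nhds_rationalOf_eq_mul_pow s hη a
  obtain ⟨T, hT⟩ := isCompact_univ.elim_finite_subcover (fun x => (W x : Set X))
    (fun x => (W x).isOpen) (fun x _ => Set.mem_iUnion.2 ⟨x, hW x⟩)
  refine ⟨T.sup M, exists_rationalValue_eq _ _ fun x => ?_⟩
  obtain ⟨y, hy, hxy⟩ := Set.mem_iUnion₂.1 (hT (Set.mem_univ x))
  obtain ⟨b, hb⟩ := hM y (T.sup M) (Finset.le_sup hy)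
  exact ⟨i y, W y, hWi y hxy, hxy, b, hb⟩

end LineBundle

/-! ### Centres of valuations -/

theorem fromSpecStalk_appLE_comp_ΓSpecIso {X : Scheme.{u}} {x : X} {W : X.Opens} (hx : x ∈ W)
    (h : ⊤ ≤ X.fromSpecStalk x ⁻¹ᵁ W) :
    (X.fromSpecStalk x).appLE W ⊤ h ≫ (Scheme.ΓSpecIso _).hom = X.presheaf.germ W x hx := by
  have hid : (homOfLE le_top).op ≫ (homOfLE h).op =
      𝟙 (op (⊤ : (Spec (X.presheaf.stalk x)).Opens)) := rfl
  rw [Scheme.Hom.appLE, Scheme.fromSpecStalk_app hx, Category.assoc, Category.assoc,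
    Category.assoc, ← Functor.map_comp_assoc, hid, CategoryTheory.Functor.map_id,
    Category.id_comp, Iso.inv_hom_id, Category.comp_id]

theorem rationalOf_mem_of_comp_eq_fromSpecStalk {X : Scheme.{u}} [IsIntegral X]
    {O : ValuationSubring X.functionField} {l : Spec (CommRingCat.of O) ⟶ X}
    (hl : Spec.map (CommRingCat.ofHom (algebraMap O X.functionField)) ≫ l =
      X.fromSpecStalk (genericPoint X)) {W : X.Opens} (hW : l (IsLocalRing.closedPoint O) ∈ W)
    (a : Γ(X, W)) : rationalOf W (genericPoint_mem hW) a ∈ O := by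
  have hlW : (⊤ : (Spec (CommRingCat.of O)).Opens) ≤ l ⁻¹ᵁ W := fun p _ =>
    (IsLocalRing.specializes_closedPoint p).mem_open (l ⁻¹ᵁ W).isOpen hW
  have hηW : (⊤ : (Spec X.functionField).Opens) ≤ X.fromSpecStalk (genericPoint X) ⁻¹ᵁ W := by
    rw [← hl]
    exact fun p _ => hlW trivial
  have hfactor : (X.fromSpecStalk (genericPoint X)).appLE W ⊤ hηW = l.appLE W ⊤ hlW ≫
      (Spec.map (CommRingCat.ofHom (algebraMap O X.functionField))).appTop := by
    simp only [← hl]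
    rw [← Scheme.Hom.appLE_comp_appLE _ _ W ⊤ ⊤ hlW le_top]
    congr 1
  have hgerm := fromSpecStalk_appLE_comp_ΓSpecIso (genericPoint_mem hW) hηW
  rw [hfactor, Category.assoc, Scheme.ΓSpecIso_naturality] at hgerm
  let b : O := (Scheme.ΓSpecIso (CommRingCat.of O)).hom (l.appLE W ⊤ hlW a)
  have hb : rationalOf W (genericPoint_mem hW) a = algebraMap O X.functionField b :=
    (congrArg (fun g => g.hom a) hgerm).symm
  rw [hb]
  exact b.2

theorem exists_forall_rationalOf_mem {k : Type u} [CommRing k] {X : Scheme.{u}} [IsIntegral X]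
    [X.Over (Spec (CommRingCat.of k))] [UniversallyClosed (X ↘ Spec (CommRingCat.of k))]
    (O : ValuationSubring X.functionField)
    (hk : ∀ a : k, rationalOf (⊤ : X.Opens) trivial (structureHom k ⊤ a) ∈ O) :
    ∃ x : X, ∀ (W : X.Opens) (hW : x ∈ W) (a : Γ(X, W)),
      rationalOf W (genericPoint_mem hW) a ∈ O := by
  let ψ : k →+* O := ((rationalOf (⊤ : X.Opens) trivial).comp (structureHom k ⊤)).codRestrict
    O.toSubring hk
  have hcomm : X.fromSpecStalk (genericPoint X) ≫ (X ↘ Spec (CommRingCat.of k)) =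
      Spec.map (CommRingCat.ofHom (algebraMap O X.functionField)) ≫
        Spec.map (CommRingCat.ofHom ψ) := by
    rw [fromSpecStalk_over, ← Spec.map_comp]
    rfl
  have hlift : ValuativeCriterion.Existence (X ↘ Spec (CommRingCat.of k)) := by
    have : UniversallyClosed (X ↘ Spec (CommRingCat.of k)) := inferInstance
    rw [UniversallyClosed.eq_valuativeCriterion] at this
    exact this.1
  obtain ⟨l, hl, -⟩ :=
    (hlift { R := O, K := X.functionField, commSq := ⟨hcomm⟩, .. }).exists_lift
  exact ⟨l (IsLocalRing.closedPoint O),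
    fun _ hW a => rationalOf_mem_of_comp_eq_fromSpecStalk hl hW a⟩

/-! ### Sections that do not vanish at a multiplicative seminorm -/

namespace LineBundle

variable {k : Type u} [CommRing k] {X : Scheme.{u}} [X.Over (Spec (CommRingCat.of k))]
  {L : LineBundle X}

/-- A section regarded as a section of a propositionally equal power. -/
def castSection {m n : ℕ} (h : m = n) (s : L.sections k m) : L.sections k n := ⟨s.1, h ▸ s.2⟩

theorem SectionAlgebra.of_castSection {m n : ℕ} (h : m = n) (s : L.sections k m) :
    of (castSection h s) = of s :=
  of_congr h.symm rfl

/-- The numerator of `σ / s ^ M * τ / s ^ N` over the denominator `s ^ (M + N)`. -/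
def mulNumerator {d M N : ℕ} (σ : L.sections k (d * M)) (τ : L.sections k (d * N)) :
    L.sections k (d * (M + N)) :=
  castSection (mul_add d M N).symm (mulSection σ τ)

theorem SectionAlgebra.of_mulNumerator {d M N : ℕ} (σ : L.sections k (d * M))
    (τ : L.sections k (d * N)) : of (mulNumerator σ τ) = of σ * of τ := by
  rw [mulNumerator, of_castSection, of_mul]

/-- The numerator of `σ / s ^ M + τ / s ^ N` over the denominator `s ^ (M + N)`. -/
def addNumerator {d M N : ℕ} (s : L.sections k d) (σ : L.sections k (d * M))
    (τ : L.sections k (d * N)) : L.sections k (d * (M + N)) :=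
  mulNumerator σ (powSection s N) + mulNumerator (powSection s M) τ

theorem SectionAlgebra.of_addNumerator {d M N : ℕ} (s : L.sections k d)
    (σ : L.sections k (d * M)) (τ : L.sections k (d * N)) :
    of (addNumerator s σ τ) = of σ * of s ^ N + of s ^ M * of τ := by
  rw [addNumerator, map_add, of_mulNumerator, of_mulNumerator, of_pow, of_pow]

variable [IsIntegral X]

theorem rationalValue_oneSection : rationalValue (oneSection : L.sections k 0) = 1 :=
  map_one (rationalOf _ L.genericPoint_mem_genericIndex)

theorem rationalValue_smul {n : ℕ} (a : k) (s : L.sections k n) :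
    rationalValue (a • s) =
      rationalOf (⊤ : X.Opens) trivial (structureHom k ⊤ a) * rationalValue s := by
  refine (map_mul (rationalOf _ L.genericPoint_mem_genericIndex) (structureHom k _ a) _).trans ?_
  rw [← map_structureHom k (le_top : L.U L.genericIndex ≤ ⊤), rationalOf_restrict]
  rfl

theorem rationalValue_castSection {m n : ℕ} (h : m = n) (s : L.sections k m) :
    rationalValue (castSection h s) = rationalValue s := rfl

theorem rationalValue_mulNumerator {d M N : ℕ} (σ : L.sections k (d * M))
    (τ : L.sections k (d * N)) :
    rationalValue (mulNumerator σ τ) = rationalValue σ * rationalValue τ := by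
  rw [mulNumerator, rationalValue_castSection, rationalValue_mulSection]

theorem rationalValue_addNumerator {d M N : ℕ} (s : L.sections k d) (σ : L.sections k (d * M))
    (τ : L.sections k (d * N)) : rationalValue (addNumerator s σ τ) =
      rationalValue σ * rationalValue s ^ N + rationalValue s ^ M * rationalValue τ := by
  rw [addNumerator, rationalValue_add, rationalValue_mulNumerator, rationalValue_mulNumerator,
    rationalValue_powSection, rationalValue_powSection]

theorem of_eq_of_rationalValue_eq {m n : ℕ} (h : m = n) {s : L.sections k m} {t : L.sections k n}
    (hst : rationalValue s = rationalValue t) : SectionAlgebra.of s = SectionAlgebra.of t := by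
  subst h
  rw [rationalValue_injective hst]

theorem rationalValue_ne_zero_of_seminorm_ne_zero (z : MulRingSeminorm (L.SectionAlgebra k))
    {n : ℕ} {s : L.sections k n} (hs : z (SectionAlgebra.of s) ≠ 0) : rationalValue s ≠ 0 :=
  fun h => hs (by
    rw [rationalValue_injective (h.trans rationalValue_zero.symm), map_zero, map_zero])

/-- The ring of the rational functions of the form `σ / s ^ M`. -/
def fractions {d : ℕ} (s : L.sections k d) : Subring X.functionField where
  carrier := {ξ | ∃ (M : ℕ) (σ : L.sections k (d * M)), ξ * rationalValue s ^ M = rationalValue σ}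
  mul_mem' := by
    rintro ξ η ⟨M, σ, hσ⟩ ⟨N, τ, hτ⟩
    refine ⟨M + N, mulNumerator σ τ, ?_⟩
    rw [rationalValue_mulNumerator, ← hσ, ← hτ]
    ring
  one_mem' := ⟨0, castSection (mul_zero d).symm oneSection, by
    rw [rationalValue_castSection, rationalValue_oneSection, pow_zero, mul_one]⟩
  add_mem' := by
    rintro ξ η ⟨M, σ, hσ⟩ ⟨N, τ, hτ⟩
    refine ⟨M + N, addNumerator s σ τ, ?_⟩
    rw [rationalValue_addNumerator, ← hσ, ← hτ]
    ring
  zero_mem' := ⟨0, 0, by rw [zero_mul, rationalValue_zero]⟩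
  neg_mem' := by
    rintro ξ ⟨M, σ, hσ⟩
    refine ⟨M, -σ, ?_⟩
    rw [neg_mul, hσ]
    exact (map_neg (rationalOf _ L.genericPoint_mem_genericIndex) _).symm

/-- The ideal of the fractions `σ / s ^ M` with `z σ = 0`. -/
def fractionsKer (z : MulRingSeminorm (L.SectionAlgebra k)) {d : ℕ} (s : L.sections k d) :
    Ideal (fractions s) where
  carrier := {ξ | ∃ (M : ℕ) (σ : L.sections k (d * M)),
    (ξ : X.functionField) * rationalValue s ^ M = rationalValue σ ∧ z (SectionAlgebra.of σ) = 0}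
  add_mem' := by
    rintro ξ η ⟨M, σ, hσ, hσ'⟩ ⟨N, τ, hτ, hτ'⟩
    refine ⟨M + N, addNumerator s σ τ, ?_, le_antisymm ?_ (apply_nonneg z _)⟩
    · rw [rationalValue_addNumerator, ← hσ, ← hτ, Subring.coe_add]
      ring
    · rw [SectionAlgebra.of_addNumerator]
      refine (map_add_le_add z _ _).trans_eq ?_
      rw [map_mul, map_mul, hσ', hτ', zero_mul, mul_zero, add_zero]
  zero_mem' := ⟨0, 0, by rw [ZeroMemClass.coe_zero, zero_mul, rationalValue_zero],
    by rw [map_zero, map_zero]⟩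
  smul_mem' := by
    rintro ⟨ξ, M, σ, hσ⟩ η ⟨N, τ, hτ, hτ'⟩
    refine ⟨M + N, mulNumerator σ τ, ?_, ?_⟩
    · rw [rationalValue_mulNumerator, ← hσ, ← hτ, smul_eq_mul, Subring.coe_mul]
      ring
    · rw [SectionAlgebra.of_mulNumerator, map_mul, hτ', mul_zero]

theorem fractionsKer_ne_top (z : MulRingSeminorm (L.SectionAlgebra k)) {d : ℕ}
    {s : L.sections k d} (hs : z (SectionAlgebra.of s) ≠ 0) : fractionsKer z s ≠ ⊤ := by
  rw [Ideal.ne_top_iff_one]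
  rintro ⟨M, σ, hσ, hσ'⟩
  rw [OneMemClass.coe_one, one_mul, ← rationalValue_powSection] at hσ
  rw [← rationalValue_injective hσ, ← SectionAlgebra.of_pow, map_pow] at hσ'
  exact pow_ne_zero _ hs hσ'

-- If `x` is the centre of a valuation ring in which the fractions `σ / s ^ M` with `z σ = 0` are
-- non-units, then `z t ≠ 0` for every section `t` that does not vanish at `x`.
theorem exists_isAffineOpen_nonvanishing [UniversallyClosed (X ↘ Spec (CommRingCat.of k))]
    (hL : L.IsAmple k) (z : MulRingSeminorm (L.SectionAlgebra k)) {d : ℕ} (hd : 0 < d)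
    {s : L.sections k d} (hs : z (SectionAlgebra.of s) ≠ 0) :
    ∃ n : ℕ, 0 < n ∧ ∃ t : L.sections k n, IsAffineOpen (nonvanishing t) ∧
      genericPoint X ∈ nonvanishing t ∧ z (SectionAlgebra.of t) ≠ 0 := by
  have hs0 : rationalValue s ≠ 0 := rationalValue_ne_zero_of_seminorm_ne_zero z hs
  obtain ⟨O, hO, hI⟩ := Ideal.image_subset_nonunits_valuationSubring _ (fractionsKer_ne_top z hs)
  obtain ⟨x, hx⟩ := exists_forall_rationalOf_mem (k := k) O fun a => hO
    ⟨0, castSection (mul_zero d).symm (a • oneSection), by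
      rw [rationalValue_castSection, rationalValue_smul, rationalValue_oneSection, pow_zero]⟩
  obtain ⟨n, hn, t, hxt, ht⟩ := hL.2 x
  refine ⟨n, hn, t, ht, genericPoint_mem hxt, fun hzt => ?_⟩
  have ht0 : rationalValue t ≠ 0 := rationalValue_ne_zero hxt
  have hmem : rationalValue s ^ n / rationalValue t ^ d ∈ O := by
    obtain ⟨a, ha⟩ := exists_rationalOf_nonvanishing_eq (mul_comm d n) s t
    exact ha (genericPoint_mem hxt) ▸ hx _ hxt a
  have hfrac : rationalValue t ^ d / rationalValue s ^ n * rationalValue s ^ n =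
      rationalValue (castSection (mul_comm n d) (powSection t d)) := by
    rw [rationalValue_castSection, rationalValue_powSection,
      div_mul_cancel₀ _ (pow_ne_zero _ hs0)]
  have hnonunit : rationalValue t ^ d / rationalValue s ^ n ∈ O.nonunits :=
    hI ⟨⟨_, n, _, hfrac⟩, ⟨n, _, hfrac, by
      rw [SectionAlgebra.of_castSection, ← SectionAlgebra.of_pow, map_pow, hzt,
        zero_pow hd.ne']⟩, rfl⟩
  rw [ValuationSubring.mem_nonunits_iff_or, inv_div] at hnonunit
  exact hnonunit.elim (div_ne_zero (pow_ne_zero _ ht0) (pow_ne_zero _ hs0)) fun h => h hmem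

end LineBundle

/-! ### Points of the analytification from multiplicative seminorms -/

/-- A valuation of a field with values in `ℝ≥0`, regarded as an absolute value. -/
def absoluteValueOfValuation {F : Type*} [Field F] (v : Valuation F NNReal) :
    AbsoluteValue F ℝ where
  toFun a := v a
  map_mul' a b := by rw [map_mul, NNReal.coe_mul]
  nonneg' a := (v a).2
  eq_zero' a := NNReal.coe_eq_zero.trans v.zero_iff
  add_le' a b := by
    exact_mod_cast (v.map_add a b).trans (max_le_add_of_nonneg zero_le zero_le)

theorem exists_absoluteValue_evaluation {X : Scheme.{u}} {U : X.Opens} (hU : IsAffineOpen U)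
    (v : Valuation Γ(X, U) NNReal) :
    ∃ (x : X) (hx : x ∈ U) (α : AbsoluteValue (X.residueField x) ℝ),
      ∀ a, α (X.evaluation U x hx a) = v a := by
  let p : PrimeSpectrum Γ(X, U) := ⟨v.supp, inferInstance⟩
  have hx : hU.fromSpec p ∈ U := hU.range_fromSpec.subset ⟨p, rfl⟩
  let : Algebra Γ(X, U) (X.presheaf.stalk (hU.fromSpec p)) :=
    (X.presheaf.germ U _ hx).hom.toAlgebra
  have : IsLocalization.AtPrime (X.presheaf.stalk (hU.fromSpec p)) p.asIdeal :=
    hU.isLocalization_stalk' p hx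
  let w : Valuation (X.presheaf.stalk (hU.fromSpec p)) NNReal :=
    v.extendToLocalization (S := p.asIdeal.primeCompl) le_rfl _
  have hw (a : Γ(X, U)) : w (X.presheaf.germ U _ hx a) = v a :=
    v.extendToLocalization_apply_map_apply le_rfl _ a
  have hmax : IsLocalRing.maximalIdeal (X.presheaf.stalk (hU.fromSpec p)) ≤ w.supp := by
    rw [← IsLocalization.AtPrime.map_eq_maximalIdeal p.asIdeal, Ideal.map_le_iff_le_comap]
    exact fun a ha => (hw a).trans ha
  exact ⟨_, hx, absoluteValueOfValuation (F := X.residueField (hU.fromSpec p)) (w.onQuot hmax),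
    fun a => congrArg NNReal.toReal (hw a)⟩

theorem residueFieldMap_bijective {X Y : Scheme.{u}} (f : Y ⟶ X) [IsClosedImmersion f] (y : Y) :
    Function.Bijective (f.residueFieldMap y).hom := by
  refine ⟨RingHom.injective _, fun b => ?_⟩
  obtain ⟨b, rfl⟩ := Y.residue_surjective y b
  obtain ⟨a, rfl⟩ := f.stalkMap_surjective y b
  exact ⟨X.residue _ a, congrArg (fun g => g.hom a) (Scheme.residue_residueFieldMap f y)⟩

theorem exists_analytification_map_eq {k : Type u} [NormedField k] {X Y : Scheme.{u}}
    [X.Over (Spec (CommRingCat.of k))] [Y.Over (Spec (CommRingCat.of k))] (f : Y ⟶ X)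
    [f.IsOver (Spec (CommRingCat.of k))] [IsClosedImmersion f] (x : Analytification k X)
    (hx : x.pt ∈ Set.range f) : ∃ y : Analytification k Y, y.map f = x := by
  obtain ⟨x, α, hα⟩ := x
  obtain ⟨y, rfl⟩ := hx
  let e : X.residueField (f y) ≃+* Y.residueField y :=
    RingEquiv.ofBijective (f.residueFieldMap y).hom (residueFieldMap_bijective f y)
  refine ⟨⟨y, α.comp (f := e.symm.toRingHom) e.symm.injective, fun a => ?_⟩, ?_⟩
  · rw [← hα a]
    refine congrArg α (e.symm_apply_eq.2 ?_)
    have hy : f y ∈ (⊤ : X.Opens) := trivial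
    rw [← evaluation_structureHom k (f ⁻¹ᵁ ⊤) y hy, ← app_structureHom k f ⊤ a]
    exact (Scheme.evaluation_naturality_apply f y hy _).symm
  · rw [Analytification.map]
    congr 1
    ext a
    exact congrArg α (e.symm_apply_apply a)

namespace LineBundle

section FractionValuation

variable {k : Type u} [CommRing k] {X : Scheme.{u}} [X.Over (Spec (CommRingCat.of k))]
  [IsIntegral X] {L : LineBundle X} {z : MulRingSeminorm (L.SectionAlgebra k)}

theorem seminorm_div_eq_div {n M N : ℕ} {s : L.sections k n} (hs : z (SectionAlgebra.of s) ≠ 0)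
    {σ : L.sections k (n * M)} {τ : L.sections k (n * N)}
    (h : rationalValue σ * rationalValue s ^ N = rationalValue τ * rationalValue s ^ M) :
    z (SectionAlgebra.of σ) / z (SectionAlgebra.of s) ^ M =
      z (SectionAlgebra.of τ) / z (SectionAlgebra.of s) ^ N := by
  have hof : SectionAlgebra.of σ * SectionAlgebra.of s ^ N =
      SectionAlgebra.of τ * SectionAlgebra.of s ^ M := by
    rw [SectionAlgebra.of_pow, SectionAlgebra.of_pow, SectionAlgebra.of_mul, SectionAlgebra.of_mul]
    refine of_eq_of_rationalValue_eq (add_comm _ _) ?_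
    rw [rationalValue_mulSection, rationalValue_mulSection, rationalValue_powSection,
      rationalValue_powSection, h]
  rw [div_eq_div_iff (pow_ne_zero _ hs) (pow_ne_zero _ hs), ← map_pow z, ← map_pow z,
    ← map_mul z, ← map_mul z, hof]

variable [CompactSpace X]

/-- The value `z σ / z s ^ M` of a regular function `σ / s ^ M` on the non-vanishing locus of
`s`. -/
def fractionValue (z : MulRingSeminorm (L.SectionAlgebra k)) {n : ℕ} (s : L.sections k n)
    (hη : genericPoint X ∈ nonvanishing s) (a : Γ(X, nonvanishing s)) : NNReal :=
  ⟨z (SectionAlgebra.of (exists_rationalValue_eq_mul_pow s hη a).choose_spec.choose) /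
      z (SectionAlgebra.of s) ^ (exists_rationalValue_eq_mul_pow s hη a).choose,
    div_nonneg (apply_nonneg z _) (pow_nonneg (apply_nonneg z _) _)⟩

variable {n : ℕ} {s : L.sections k n}

theorem fractionValue_eq (hs : z (SectionAlgebra.of s) ≠ 0) (hη : genericPoint X ∈ nonvanishing s)
    {a : Γ(X, nonvanishing s)} {M : ℕ} {σ : L.sections k (n * M)}
    (hσ : rationalValue σ = rationalOf _ hη a * rationalValue s ^ M) :
    (fractionValue z s hη a : ℝ) = z (SectionAlgebra.of σ) / z (SectionAlgebra.of s) ^ M :=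
  seminorm_div_eq_div hs (by
    rw [(exists_rationalValue_eq_mul_pow s hη a).choose_spec.choose_spec, hσ, mul_right_comm])

theorem fractionValue_structureHom (hs : z (SectionAlgebra.of s) ≠ 0)
    (hη : genericPoint X ∈ nonvanishing s) (a : k) :
    (fractionValue z s hη (structureHom k _ a) : ℝ) = z (algebraMap k _ a) := by
  rw [fractionValue_eq (M := 0) (σ := castSection (mul_zero n).symm (a • oneSection)) hs hη]
  · rw [SectionAlgebra.of_castSection, map_smul, SectionAlgebra.of_oneSection, pow_zero, div_one,
      Algebra.algebraMap_eq_smul_one]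
  · rw [rationalValue_castSection, rationalValue_smul, rationalValue_oneSection, pow_zero,
      ← map_structureHom k (le_top : nonvanishing s ≤ ⊤), rationalOf_restrict]

theorem fractionValue_zero (hs : z (SectionAlgebra.of s) ≠ 0)
    (hη : genericPoint X ∈ nonvanishing s) : fractionValue z s hη 0 = 0 := by
  have h := fractionValue_structureHom hs hη 0
  rw [map_zero, map_zero, map_zero] at h
  exact_mod_cast h

theorem fractionValue_one (hs : z (SectionAlgebra.of s) ≠ 0)
    (hη : genericPoint X ∈ nonvanishing s) : fractionValue z s hη 1 = 1 := by
  have h := fractionValue_structureHom hs hη 1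
  rw [map_one, map_one, map_one] at h
  exact_mod_cast h

theorem fractionValue_mul (hs : z (SectionAlgebra.of s) ≠ 0)
    (hη : genericPoint X ∈ nonvanishing s) (a b : Γ(X, nonvanishing s)) :
    fractionValue z s hη (a * b) = fractionValue z s hη a * fractionValue z s hη b := by
  obtain ⟨M, σ, hσ⟩ := exists_rationalValue_eq_mul_pow s hη a
  obtain ⟨N, τ, hτ⟩ := exists_rationalValue_eq_mul_pow s hη b
  refine NNReal.coe_injective ?_
  rw [NNReal.coe_mul, fractionValue_eq hs hη hσ, fractionValue_eq hs hη hτ,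
    fractionValue_eq (σ := mulNumerator σ τ) hs hη, SectionAlgebra.of_mulNumerator, map_mul,
    pow_add, mul_div_mul_comm]
  rw [rationalValue_mulNumerator, hσ, hτ, map_mul]
  ring

theorem fractionValue_add_le (hna : IsNonarchimedean z) (hs : z (SectionAlgebra.of s) ≠ 0)
    (hη : genericPoint X ∈ nonvanishing s) (a b : Γ(X, nonvanishing s)) :
    fractionValue z s hη (a + b) ≤ max (fractionValue z s hη a) (fractionValue z s hη b) := by
  obtain ⟨M, σ, hσ⟩ := exists_rationalValue_eq_mul_pow s hη a
  obtain ⟨N, τ, hτ⟩ := exists_rationalValue_eq_mul_pow s hη b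
  have hadd : rationalValue (addNumerator s σ τ) =
      rationalOf _ hη (a + b) * rationalValue s ^ (M + N) := by
    rw [rationalValue_addNumerator, hσ, hτ, map_add]
    ring
  rw [← NNReal.coe_le_coe, NNReal.coe_max, fractionValue_eq hs hη hσ, fractionValue_eq hs hη hτ,
    fractionValue_eq hs hη hadd, SectionAlgebra.of_addNumerator]
  refine (div_le_div_of_nonneg_right (hna _ _) (pow_nonneg (apply_nonneg z _) _)).trans_eq ?_
  rw [← max_div_div_right (pow_nonneg (apply_nonneg z _) _), map_mul, map_mul, map_pow, map_pow,
    pow_add, mul_div_mul_right _ _ (pow_ne_zero N hs), mul_div_mul_left _ _ (pow_ne_zero M hs)]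

/-- `fractionValue` as a valuation of the ring of functions on the non-vanishing locus of `s`. -/
def fractionValuation (hna : IsNonarchimedean z) (hs : z (SectionAlgebra.of s) ≠ 0)
    (hη : genericPoint X ∈ nonvanishing s) : Valuation Γ(X, nonvanishing s) NNReal where
  toFun := fractionValue z s hη
  map_zero' := fractionValue_zero hs hη
  map_one' := fractionValue_one hs hη
  map_mul' := fractionValue_mul hs hη
  map_add_le_max' := fractionValue_add_le hna hs hη

end FractionValuation

theorem evaluation_mul_pow_eq {k : Type u} [CommRing k] {X : Scheme.{u}}
    [X.Over (Spec (CommRingCat.of k))] [IsIntegral X] {L : LineBundle X} {V : X.Opens}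
    (hη : genericPoint X ∈ V) {a : Γ(X, V)} {n M : ℕ} {s : L.sections k n}
    {σ : L.sections k (n * M)} (hσ : rationalValue σ = rationalOf V hη a * rationalValue s ^ M)
    {x : X} (hx : x ∈ V) {i : L.ι} (hi : x ∈ L.U i) :
    X.evaluation V x hx a * X.evaluation (L.U i) x hi (s.1 i) ^ M =
      X.evaluation (L.U i) x hi (σ.1 i) := by
  have hxi : x ∈ V ⊓ L.U i := ⟨hx, hi⟩
  have hsec : X.presheaf.map (homOfLE (inf_le_left : V ⊓ L.U i ≤ V)).op a *
      X.presheaf.map (homOfLE (inf_le_right : V ⊓ L.U i ≤ L.U i)).op (s.1 i) ^ M =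
      X.presheaf.map (homOfLE (inf_le_right : V ⊓ L.U i ≤ L.U i)).op (σ.1 i) := by
    refine section_ext fun hη => ?_
    rw [map_mul, map_pow, rationalOf_restrict, rationalOf_restrict, rationalOf_restrict,
      rationalOf_section, rationalOf_section, hσ]
    ring
  have hres {W : X.Opens} (hle : V ⊓ L.U i ≤ W) (b : Γ(X, W)) :
      X.evaluation (V ⊓ L.U i) x hxi (X.presheaf.map (homOfLE hle).op b) =
        X.evaluation W x (hle hxi) b :=
    congrArg (X.residue x) (X.presheaf.germ_res_apply (homOfLE hle) x hxi b)
  have heval := congrArg (X.evaluation (V ⊓ L.U i) x hxi) hsec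
  rwa [map_mul, map_pow, hres, hres, hres] at heval

section PointOfSeminorm

variable {k : Type u} [NormedField k] {X Y : Scheme.{u}}
  [X.Over (Spec (CommRingCat.of k))] [Y.Over (Spec (CommRingCat.of k))] [IsIntegral X]
  (f : Y ⟶ X) [f.IsOver (Spec (CommRingCat.of k))] {L : LineBundle X}

theorem sectionsPullback_mulSection_eq_zero [IsReduced Y] {n M : ℕ} {s : L.sections k n}
    {σ : L.sections k (n * M)} (hη : genericPoint X ∈ nonvanishing s) {a : Γ(X, nonvanishing s)}
    (hσ : rationalValue σ = rationalOf _ hη a * rationalValue s ^ M)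
    (ha : ∀ y, f y ∉ X.basicOpen a) :
    L.sectionsPullback k f _ (mulSection σ s) = 0 := by
  refine Subtype.ext (funext fun i => ?_)
  change f.app (L.U i) (σ.1 i * s.1 i) = 0
  rw [← basicOpen_eq_bot_iff, ← Scheme.preimage_basicOpen, Scheme.basicOpen_mul, eq_bot_iff]
  rintro y ⟨hyσ, hys⟩
  have hyi : f y ∈ L.U i := X.basicOpen_le _ hys
  have hyV : f y ∈ nonvanishing s := mem_nonvanishing.2 ⟨i, hys⟩
  rw [SetLike.mem_coe, ← Scheme.evaluation_ne_zero_iff_mem_basicOpen X _ hyi,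
    ← evaluation_mul_pow_eq hη hσ hyV hyi] at hyσ
  exact ha y ((Scheme.evaluation_ne_zero_iff_mem_basicOpen X _ hyV _).1 (left_ne_zero_of_mul hyσ))

variable [CompactSpace X] {z : MulRingSeminorm (L.SectionAlgebra k)} {n : ℕ} {s : L.sections k n}

theorem exists_absEval_eq_fractionValue (hna : IsNonarchimedean z)
    (hk : ∀ a : k, z (algebraMap k _ a) = ‖a‖) (hs : z (SectionAlgebra.of s) ≠ 0)
    (hη : genericPoint X ∈ nonvanishing s) (haff : IsAffineOpen (nonvanishing s)) :
    ∃ (x : Analytification k X) (hx : x.pt ∈ nonvanishing s),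
      ∀ a, x.absEval hx a = fractionValue z s hη a := by
  obtain ⟨x, hx, α, hα⟩ := exists_absoluteValue_evaluation haff (fractionValuation hna hs hη)
  refine ⟨⟨x, α, fun a => ?_⟩, hx, hα⟩
  rw [← evaluation_structureHom k (nonvanishing s) x hx, hα, ← hk]
  exact fractionValue_structureHom hs hη a

theorem mem_range_of_absEval_eq_fractionValue [IsReduced Y] [IsClosedImmersion f]
    (hker : ∀ t, L.algebraPullback k f t = 0 → z t = 0) (hs : z (SectionAlgebra.of s) ≠ 0)
    (hη : genericPoint X ∈ nonvanishing s) (haff : IsAffineOpen (nonvanishing s))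
    {x : Analytification k X} (hx : x.pt ∈ nonvanishing s)
    (hval : ∀ a, x.absEval hx a = fractionValue z s hη a) : x.pt ∈ Set.range f := by
  by_contra hxf
  obtain ⟨a, haY, hxa⟩ := haff.exists_basicOpen_le
    (V := ⟨(Set.range f)ᶜ, f.isClosedEmbedding.isClosed_range.isOpen_compl⟩) ⟨x.pt, hxf⟩ hx
  obtain ⟨M, σ, hσ⟩ := exists_rationalValue_eq_mul_pow s hη a
  have hmul : z (SectionAlgebra.of σ * SectionAlgebra.of s) = 0 := by
    refine hker _ ?_
    rw [SectionAlgebra.of_mul, algebraPullback_of,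
      sectionsPullback_mulSection_eq_zero f hη hσ fun y hy => haY hy ⟨y, rfl⟩, map_zero]
  rw [map_mul] at hmul
  have hzero : x.absEval hx a = 0 := by
    rw [hval, fractionValue_eq hs hη hσ, (mul_eq_zero.1 hmul).resolve_right hs, zero_div]
  rw [← Scheme.evaluation_ne_zero_iff_mem_basicOpen X _ hx] at hxa
  exact hxa (x.abs.eq_zero.1 hzero)

theorem pow_mul_pow_absEval_eq (hs : z (SectionAlgebra.of s) ≠ 0)
    (hη : genericPoint X ∈ nonvanishing s) {x : Analytification k X} (hx : x.pt ∈ nonvanishing s)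
    (hval : ∀ a, x.absEval hx a = fractionValue z s hη a) {i : L.ι} (hi : x.pt ∈ L.U i) {m : ℕ}
    (σ : L.sections k m) :
    z (SectionAlgebra.of σ) ^ n * x.absEval hi (s.1 i) ^ m =
      x.absEval hi (σ.1 i) ^ n * z (SectionAlgebra.of s) ^ m := by
  let τ : L.sections k (n * m) := castSection (mul_comm m n) (powSection σ n)
  obtain ⟨a, ha⟩ := exists_rationalOf_nonvanishing_eq (mul_comm m n) σ s
  have hτ : rationalValue τ = rationalOf _ hη a * rationalValue s ^ m := by
    rw [rationalValue_castSection, rationalValue_powSection, ha,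
      div_mul_cancel₀ _ (pow_ne_zero _ (rationalValue_ne_zero hη))]
  have hzτ : x.absEval hx a * z (SectionAlgebra.of s) ^ m = z (SectionAlgebra.of σ) ^ n := by
    rw [hval, fractionValue_eq hs hη hτ, div_mul_cancel₀ _ (pow_ne_zero _ hs),
      SectionAlgebra.of_castSection, ← SectionAlgebra.of_pow, map_pow]
  have hxτ : x.absEval hx a * x.absEval hi (s.1 i) ^ m = x.absEval hi (σ.1 i) ^ n := by
    have h := congrArg x.abs (evaluation_mul_pow_eq hη hτ hx hi)
    rw [map_mul, map_pow] at h
    refine h.trans ((congrArg x.abs ?_).trans (map_pow x.abs _ n))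
    exact map_pow (X.evaluation (L.U i) x.pt hi).hom (σ.1 i) n
  rw [← hzτ, ← hxτ]
  ring

theorem exists_analytification_eq [IsReduced Y] [IsClosedImmersion f] (hna : IsNonarchimedean z)
    (hk : ∀ a : k, z (algebraMap k _ a) = ‖a‖)
    (hker : ∀ t, L.algebraPullback k f t = 0 → z t = 0) (hn : 0 < n)
    (hs : z (SectionAlgebra.of s) ≠ 0) (hη : genericPoint X ∈ nonvanishing s)
    (haff : IsAffineOpen (nonvanishing s)) :
    ∃ (y : Analytification k Y) (i : L.ι) (hi : f y.pt ∈ L.U i) (c : ℝ), 0 < c ∧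
      ∀ m (σ : L.sections k m),
        z (SectionAlgebra.of σ) = (y.map f).absEval hi (σ.1 i) * c ^ m := by
  obtain ⟨x, hx, hval⟩ := exists_absEval_eq_fractionValue hna hk hs hη haff
  obtain ⟨y, rfl⟩ := exists_analytification_map_eq f x
    (mem_range_of_absEval_eq_fractionValue f hker hs hη haff hx hval)
  obtain ⟨i, hsi⟩ := mem_nonvanishing.1 hx
  have hi : f y.pt ∈ L.U i := X.basicOpen_le _ hsi
  have hzs : 0 < z (SectionAlgebra.of s) := (apply_nonneg z _).lt_of_ne' hs
  have hys : 0 < (y.map f).absEval hi (s.1 i) :=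
    (y.map f).abs.pos ((Scheme.evaluation_ne_zero_iff_mem_basicOpen X _ hi _).2 hsi)
  refine ⟨y, i, hi, (z (SectionAlgebra.of s) / (y.map f).absEval hi (s.1 i)) ^ (n⁻¹ : ℝ),
    Real.rpow_pos_of_pos (div_pos hzs hys) _, fun m σ => ?_⟩
  refine (pow_left_inj₀ (apply_nonneg z _) (mul_nonneg ((y.map f).abs.nonneg _)
    (pow_nonneg (Real.rpow_nonneg (div_pos hzs hys).le _) _)) hn.ne').1 ?_
  rw [mul_pow, pow_right_comm _ m n, Real.rpow_inv_natCast_pow (div_pos hzs hys).le hn.ne',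
    div_pow, mul_div_assoc', eq_div_iff (pow_ne_zero _ hys.ne')]
  exact pow_mul_pow_absEval_eq hs hη hx hval hi σ

end PointOfSeminorm

end LineBundle

/-! ### Lower bounds for Fubini–Study metrics -/

theorem exists_span_range_eq_top (k A : Type*) [CommRing k] [CommRing A] [Algebra k A]
    [Algebra.FiniteType k A] : ∃ e : ℕ → A, Submodule.span k (Set.range e) = ⊤ := by
  obtain ⟨n, q, hq⟩ := (Algebra.FiniteType.iff_quotient_mvPolynomial'' (R := k) (S := A)).1
    inferInstance
  obtain ⟨g, hg⟩ := exists_surjective_nat (Fin n →₀ ℕ)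
  refine ⟨fun m => q (MvPolynomial.monomial (g m) 1), ?_⟩
  have hrange : Set.range (fun m => q (MvPolynomial.monomial (g m) (1 : k))) =
      q.toLinearMap '' Set.range (MvPolynomial.basisMonomials (Fin n) k) := by
    rw [← Set.range_comp, ← hg.range_comp]
    simp only [Function.comp_def, MvPolynomial.coe_basisMonomials]
    rfl
  rw [hrange, Submodule.span_image, Module.Basis.span_eq, Submodule.map_top]
  exact LinearMap.range_eq_top.2 hq

namespace LineBundle

theorem exists_evalAt_mem_span {k : Type u} [NormedField k] {X : Scheme.{u}}
    [X.Over (Spec (CommRingCat.of k))] [LocallyOfFiniteType (X ↘ Spec (CommRingCat.of k))]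
    (L : LineBundle X) (i : L.ι) (x : Analytification k X) (hx : x.pt ∈ L.U i) :
    ∃ e : ℕ → x.CompletedResidueField, ∀ n (s : L.sections k n),
      L.evalAt n i x hx s ∈ Submodule.span k (Set.range e) := by
  obtain ⟨_, ⟨W, hW, rfl⟩, hxW, hWi⟩ :=
    X.isBasis_affineOpens.exists_subset_of_mem_open hx (L.U i).isOpen
  replace hWi : W ≤ L.U i := hWi
  have hfin : (structureHom k W).FiniteType :=
    ((X ↘ Spec (CommRingCat.of k)).finiteType_appLE (isAffineOpen_top _) hW le_top).comp
      (RingHom.FiniteType.of_surjective _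
        (Scheme.ΓSpecIso (CommRingCat.of k)).symm.commRingCatIsoToRingEquiv.surjective)
  have : Algebra.FiniteType k Γ(X, W) := hfin
  obtain ⟨e, he⟩ := exists_span_range_eq_top k Γ(X, W)
  let q : Γ(X, W) →ₗ[k] x.CompletedResidueField :=
    { toFun := fun a => x.toCompleted (X.evaluation W x.pt hxW a)
      map_add' := fun a b => by rw [map_add, map_add]
      map_smul' := fun c a => by
        rw [Algebra.smul_def, map_mul, map_mul, RingHom.id_apply, Algebra.smul_def]
        congr 1
        exact congrArg x.toCompleted (evaluation_structureHom k W x.pt hxW c) }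
  refine ⟨q ∘ e, fun n s => ?_⟩
  rw [Set.range_comp, Submodule.span_image, he, Submodule.map_top]
  exact ⟨X.presheaf.map (homOfLE hWi).op (s.1 i), congrArg (fun a => x.toCompleted (X.residue _ a))
    (X.presheaf.germ_res_apply (homOfLE hWi) x.pt hxW (s.1 i))⟩

section FrameNorm

variable {k : Type u} [NontriviallyNormedField k] [IsUltrametricDist k] [CompleteSpace k]
  {X : Scheme.{u}} [X.Over (Spec (CommRingCat.of k))]
  [LocallyOfFiniteType (X ↘ Spec (CommRingCat.of k))] {L : LineBundle X}

theorem inv_le_fubiniStudy {n : ℕ} {p : Seminorm k (L.sections k n)}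
    (hp : ∀ s, p s = 0 → s = 0) {i : L.ι} {x : Analytification k X} {hx : x.pt ∈ L.U i}
    (hpos : 0 < fubiniStudy p i x hx) {C : ℝ} (hC : 0 < C)
    (h : ∀ s, x.absEval hx (s.1 i) ≤ C * p s) : C⁻¹ ≤ fubiniStudy p i x hx := by
  let := x.normedAlgebraCompleted
  have := x.isUltrametricDist_completed
  obtain ⟨e, he⟩ := L.exists_evalAt_mem_span i x hx
  refine le_csInf (Set.nonempty_iff_ne_empty.2 fun hempty => ?_) ?_
  · rw [fubiniStudy, hempty, Real.sInf_empty] at hpos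
    exact lt_irrefl _ hpos
  · rintro r ⟨w, hw, rfl⟩
    have hle := norm_liftBaseChange_le hp (L.evalAt n i x hx) (he n) hC.le
      (fun s => (norm_evalAt i x hx s).trans_le (h s)) w
    rw [inv_le_iff_one_le_mul₀' hC]
    refine le_trans (le_of_eq ?_) hle
    exact (norm_one (α := x.CompletedResidueField)).symm.trans (congrArg norm hw.symm)

namespace Metric

variable {φ : Metric k L}

theorem le_exp_mul_frameNorm {ε : ℝ} {n : ℕ} (hn : n ≠ 0) {p : Seminorm k (L.sections k n)}
    (hp : ∀ s, p s = 0 → s = 0)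
    (hφ : ∀ i x (hx : x.pt ∈ L.U i), 0 < fubiniStudy p i x hx ∧
      |Real.log (fubiniStudy p i x hx ^ (1 / (n : ℝ)) / φ.frameNorm i x hx)| ≤ ε)
    {i : L.ι} {x : Analytification k X} {hx : x.pt ∈ L.U i} {c : ℝ} (hc : 0 < c)
    (h : ∀ s : L.sections k n, ENNReal.ofReal (x.absEval hx (s.1 i) * c ^ n) ≤ φ.supNorm s) :
    c ≤ Real.exp (2 * ε) * φ.frameNorm i x hx := by
  obtain ⟨hpos, hlog⟩ := hφ i x hx
  have hsup (s : L.sections k n) : φ.supNorm s ≤ ENNReal.ofReal (Real.exp (n * ε) * p s) :=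
    iSup_le fun y => ENNReal.ofReal_le_ofReal (φ.abs_le_exp_mul hn hp hφ s y)
  have heval (s : L.sections k n) :
      x.absEval hx (s.1 i) ≤ Real.exp (n * ε) / c ^ n * p s := by
    rw [div_mul_eq_mul_div, le_div_iff₀ (pow_pos hc n)]
    exact (ENNReal.ofReal_le_ofReal_iff
      (mul_nonneg (Real.exp_pos _).le (apply_nonneg p s))).1 ((h s).trans (hsup s))
  have hFS := inv_le_fubiniStudy hp hpos (div_pos (Real.exp_pos _) (pow_pos hc n)) heval
  refine (pow_le_pow_iff_left₀ hc.le
    (mul_nonneg (Real.exp_pos _).le (φ.frameNorm_pos i x hx).le) hn).1 ?_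
  calc c ^ n = Real.exp (n * ε) * (Real.exp (n * ε) / c ^ n)⁻¹ := by
        rw [inv_div, mul_div_cancel₀ _ (Real.exp_pos _).ne']
    _ ≤ Real.exp (n * ε) * (Real.exp (n * ε) * φ.frameNorm i x hx ^ n) :=
        mul_le_mul_of_nonneg_left
          (hFS.trans (le_exp_mul_pow_of_abs_log_le hpos (φ.frameNorm_pos i x hx) hn hlog).1)
          (Real.exp_pos _).le
    _ = (Real.exp (2 * ε) * φ.frameNorm i x hx) ^ n := by
        rw [mul_pow, ← Real.exp_nat_mul, ← mul_assoc, ← Real.exp_add]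
        ring_nf

theorem le_frameNorm (hφ : φ.IsAsymptoticFubiniStudy) {i : L.ι} {x : Analytification k X}
    {hx : x.pt ∈ L.U i} {c : ℝ} (hc : 0 < c)
    (h : ∀ n (s : L.sections k n),
      ENNReal.ofReal (x.absEval hx (s.1 i) * c ^ n) ≤ φ.supNorm s) :
    c ≤ φ.frameNorm i x hx := by
  obtain ⟨p, hp, hconv⟩ := hφ
  have hle (ε : ℝ) (hε : 0 < ε) : c ≤ Real.exp (2 * ε) * φ.frameNorm i x hx := by
    obtain ⟨n, hn, hn0⟩ := ((hconv ε hε).and (Filter.eventually_ne_atTop 0)).exists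
    exact le_exp_mul_frameNorm hn0 (hp n) hn hc (h n)
  have hlim : Filter.Tendsto (fun ε : ℝ => Real.exp (2 * ε) * φ.frameNorm i x hx) (𝓝[>] 0)
      (𝓝 (Real.exp (2 * 0) * φ.frameNorm i x hx)) :=
    (Continuous.tendsto (by fun_prop) 0).mono_left nhdsWithin_le_nhds
  rw [mul_zero, Real.exp_zero, one_mul] at hlim
  exact ge_of_tendsto hlim (Filter.eventually_of_mem self_mem_nhdsWithin hle)

end Metric

end FrameNorm

end LineBundle

/-! ### The spectral seminorm of the quotient norm -/

theorem norm_algebraMap_eq_of_le {k A : Type*} [NormedField k] [CommRing A] [Algebra k A]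
    (z : MulRingSeminorm A) (h : ∀ a : k, z (algebraMap k A a) ≤ ‖a‖) (a : k) :
    z (algebraMap k A a) = ‖a‖ := by
  rcases eq_or_ne a 0 with rfl | ha
  · rw [map_zero, map_zero, norm_zero]
  refine le_antisymm (h a) ?_
  have hmul : z (algebraMap k A a) * z (algebraMap k A a⁻¹) = 1 := by
    rw [← map_mul, ← map_mul, mul_inv_cancel₀ ha, map_one, map_one]
  have hle := mul_le_mul_of_nonneg_left (h a⁻¹) (apply_nonneg z (algebraMap k A a))
  rwa [hmul, norm_inv, ← div_eq_mul_inv, one_le_div (norm_pos_iff.2 ha)] at hle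

namespace LineBundle

section Unit

variable {k : Type u} [NormedField k] [IsUltrametricDist k] {X Y : Scheme.{u}}
  [X.Over (Spec (CommRingCat.of k))] [Y.Over (Spec (CommRingCat.of k))] (f : Y ⟶ X)
  [f.IsOver (Spec (CommRingCat.of k))] {L : LineBundle X} (φ : L.Metric k)

theorem Metric.quotientAlgNorm_one_le : φ.quotientAlgNorm f 1 ≤ 1 :=
  (φ.quotientAlgNorm_le f (map_one _)).trans φ.algNorm_one_le

theorem Metric.quotientAlgNorm_one [Nonempty (Analytification k Y)] :
    φ.quotientAlgNorm f 1 = 1 :=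
  le_antisymm (φ.quotientAlgNorm_one_le f)
    ((φ.pullback f).algNorm_one.symm.trans_le (φ.pullback_algNorm_le_quotientAlgNorm f 1))

theorem Metric.quotientAlgNorm_algebraMap_le (a : k) :
    φ.quotientAlgNorm f (algebraMap k _ a) ≤ ENNReal.ofReal ‖a‖ := by
  rw [Algebra.algebraMap_eq_smul_one]
  exact (φ.quotientAlgNorm_smul_le f a 1).trans
    (mul_le_of_le_one_right zero_le (φ.quotientAlgNorm_one_le f))

end Unit

/-- The restriction homomorphism `V_•(L) → V_•(L_{X|Y})`. -/
abbrev toRestrictedAlgebra {k : Type u} [CommRing k] {X Y : Scheme.{u}}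
    [X.Over (Spec (CommRingCat.of k))] [Y.Over (Spec (CommRingCat.of k))] (f : Y ⟶ X)
    [f.IsOver (Spec (CommRingCat.of k))] {L : LineBundle X} :
    L.SectionAlgebra k →ₐ[k] L.RestrictedAlgebra k f :=
  (L.algebraPullback k f).rangeRestrict

section Spectral

variable {k : Type u} [NontriviallyNormedField k] [IsUltrametricDist k] [CompleteSpace k]
  {X Y : Scheme.{u}} [X.Over (Spec (CommRingCat.of k))] [Y.Over (Spec (CommRingCat.of k))]
  (f : Y ⟶ X) [f.IsOver (Spec (CommRingCat.of k))] {L : LineBundle X} {φ : L.Metric k}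
  [IsIntegral X]

theorem quotientAlgNorm_of_degree_zero_le [UniversallyClosed (X ↘ Spec (CommRingCat.of k))]
    [Nonempty (Analytification k Y)] (s : L.sections k 0) :
    φ.quotientAlgNorm f (toRestrictedAlgebra f (SectionAlgebra.of s)) ≤
      (φ.pullback f).algNorm (L.algebraPullback k f (SectionAlgebra.of s)) := by
  obtain ⟨r, hr⟩ := exists_forall_abs_eq s
  obtain ⟨y⟩ := ‹Nonempty (Analytification k Y)›
  refine (φ.quotientAlgNorm_le f rfl).trans ?_
  rw [Metric.algNorm_of, algebraPullback_of, Metric.algNorm_of]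
  refine iSup_le fun x => le_trans (le_of_eq ?_) (le_iSup
    (fun y => ENNReal.ofReal ((φ.pullback f).abs (L.sectionsPullback k f 0 s) y)) y)
  simp only [Metric.pullback_abs, hr]

variable [IsProper (X ↘ Spec (CommRingCat.of k))] [IsClosedImmersion f] [IsReduced Y]

theorem ofReal_le_algNorm_pullback_of_pos (hL : L.IsAmple k) (hφ : φ.IsAsymptoticFubiniStudy)
    {z : MulRingSeminorm (L.RestrictedAlgebra k f)} (hna : IsNonarchimedean z)
    (hz : ∀ t, ENNReal.ofReal (z t) ≤ φ.quotientAlgNorm f t) {d : ℕ} (hd : 0 < d)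
    (s : L.sections k d) :
    ENNReal.ofReal (z (toRestrictedAlgebra f (SectionAlgebra.of s))) ≤
      (φ.pullback f).algNorm (L.algebraPullback k f (SectionAlgebra.of s)) := by
  have := hL.1
  let w : MulRingSeminorm (L.SectionAlgebra k) :=
    comapSeminorm z (toRestrictedAlgebra f).toRingHom
  by_cases hs : w (SectionAlgebra.of s) = 0
  · exact (ENNReal.ofReal_eq_zero.2 hs.le).trans_le zero_le
  obtain ⟨n, hn, t, haff, hη, ht⟩ := exists_isAffineOpen_nonvanishing hL w hd hs
  have hk (a : k) : z (algebraMap k _ a) = ‖a‖ := by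
    refine norm_algebraMap_eq_of_le z (fun a => ?_) a
    exact (ENNReal.ofReal_le_ofReal_iff (norm_nonneg a)).1
      ((hz _).trans (φ.quotientAlgNorm_algebraMap_le f a))
  have hker (a : L.SectionAlgebra k) (ha : L.algebraPullback k f a = 0) : w a = 0 :=
    (congrArg z (Subtype.ext ha)).trans (map_zero z)
  obtain ⟨y, i, hi, c, hc, hw⟩ := exists_analytification_eq f (z := w)
    (fun a b => (congrArg z (map_add (toRestrictedAlgebra f) a b)).trans_le (hna _ _))
    (fun a => (congrArg z ((toRestrictedAlgebra f).commutes a)).trans (hk a)) hker hn ht hη haff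
  have hle : c ≤ φ.frameNorm i (y.map f) hi := by
    refine Metric.le_frameNorm hφ hc fun m σ => ?_
    rw [← φ.algNorm_of, ← hw]
    exact (hz _).trans (φ.quotientAlgNorm_le f rfl)
  rw [algebraPullback_of, Metric.algNorm_of]
  refine le_trans (ENNReal.ofReal_le_ofReal ((hw d s).trans_le ?_))
    (le_iSup (fun y => ENNReal.ofReal ((φ.pullback f).abs (L.sectionsPullback k f d s) y)) y)
  rw [Metric.pullback_abs, φ.abs_eq s (y.map f) i hi]
  exact mul_le_mul_of_nonneg_left (pow_le_pow_left₀ hc.le hle d) ((y.map f).abs.nonneg _)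

variable [Nonempty (Analytification k Y)] {μ : RingSeminorm (L.RestrictedAlgebra k f)}

theorem ofReal_smoothingFun_of_le (hL : L.IsAmple k) (hφ : φ.IsAsymptoticFubiniStudy)
    (hna : IsNonarchimedean μ) (hμ : ∀ t, ENNReal.ofReal (μ t) ≤ φ.quotientAlgNorm f t) {d : ℕ}
    (s : L.sections k d) :
    ENNReal.ofReal (smoothingFun μ (toRestrictedAlgebra f (SectionAlgebra.of s))) ≤
      (φ.pullback f).algNorm (L.algebraPullback k f (SectionAlgebra.of s)) := by
  rcases Nat.eq_zero_or_pos d with rfl | hd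
  · exact (ENNReal.ofReal_le_ofReal (smoothingFun_le_self μ _)).trans
      ((hμ _).trans (quotientAlgNorm_of_degree_zero_le f s))
  by_cases hs : smoothingFun μ (toRestrictedAlgebra f (SectionAlgebra.of s)) = 0
  · exact (ENNReal.ofReal_eq_zero.2 hs.le).trans_le zero_le
  obtain ⟨z, hzna, hzμ, hzs⟩ := exists_mulRingSeminorm_eq_smoothingFun μ
    (ENNReal.ofReal_le_one.1 ((hμ 1).trans (φ.quotientAlgNorm_one_le f))) hna _ hs
  rw [← hzs]
  exact ofReal_le_algNorm_pullback_of_pos f hL hφ hzna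
    (fun t => (ENNReal.ofReal_le_ofReal (hzμ t)).trans (hμ t)) hd s

theorem ofReal_smoothingFun_le (hL : L.IsAmple k) (hφ : φ.IsAsymptoticFubiniStudy)
    (hna : IsNonarchimedean μ) (hμ : ∀ t, ENNReal.ofReal (μ t) ≤ φ.quotientAlgNorm f t)
    (t : L.RestrictedAlgebra k f) :
    ENNReal.ofReal (smoothingFun μ t) ≤ (φ.pullback f).algNorm t := by
  have hμ1 : μ 1 ≤ 1 :=
    ENNReal.ofReal_le_one.1 ((hμ 1).trans (φ.quotientAlgNorm_one_le f))
  obtain ⟨_, s, rfl⟩ := t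
  obtain ⟨S, hS⟩ := s.exists_eq_sum
  obtain ⟨n, -, hn⟩ := IsNonarchimedean.finset_image_add (map_zero (smoothingSeminorm μ hμ1 hna))
    (apply_nonneg _) (isNonarchimedean_smoothingFun μ hμ1 hna)
    (fun n => toRestrictedAlgebra f (SectionAlgebra.of (s.component n))) S
  rw [← map_sum, ← hS] at hn
  refine (ENNReal.ofReal_le_ofReal hn).trans
    ((ofReal_smoothingFun_of_le f hL hφ hna hμ (s.component n)).trans ?_)
  rw [algebraPullback_of, Metric.algNorm_of, ← component_algebraPullback]
  exact (φ.pullback f).supNorm_component_le _ n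

theorem tendsto_pow_one_div (hL : L.IsAmple k) (hφ : φ.IsAsymptoticFubiniStudy)
    {P Q : AlgebraNorm k (L.RestrictedAlgebra k f)} (hna : IsNonarchimedean P)
    (hP : ∀ t, ENNReal.ofReal (P t) = φ.quotientAlgNorm f t)
    (hQ : ∀ t, ENNReal.ofReal (Q t) = (φ.pullback f).algNorm t) (t : L.RestrictedAlgebra k f) :
    Filter.Tendsto (fun n : ℕ => P (t ^ n) ^ (1 / (n : ℝ))) Filter.atTop (𝓝 (Q t)) := by
  have hP1 : P 1 ≤ 1 :=
    ENNReal.ofReal_le_one.1 ((hP 1).trans_le (φ.quotientAlgNorm_one_le f))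
  have hlim : Filter.Tendsto (fun n : ℕ => P (t ^ n) ^ (1 / (n : ℝ))) Filter.atTop
      (𝓝 (smoothingFun P.toRingSeminorm' t)) :=
    tendsto_smoothingFun_of_map_one_le_one P.toRingSeminorm' hP1 t
  have hle : smoothingFun P.toRingSeminorm' t ≤ Q t := by
    rw [← ENNReal.ofReal_le_ofReal_iff (apply_nonneg Q t), hQ]
    exact ofReal_smoothingFun_le f hL hφ hna (fun t => (hP t).le) t
  have hpow (n : ℕ) (hn : n ≠ 0) : Q t ^ n ≤ P (t ^ n) := by
    rw [← ENNReal.ofReal_le_ofReal_iff (apply_nonneg P _),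
      ENNReal.ofReal_pow (apply_nonneg Q t), hP, hQ, ← Metric.algNorm_pow _ _ hn]
    exact φ.pullback_algNorm_le_quotientAlgNorm f (t ^ n)
  have hge : Q t ≤ smoothingFun P.toRingSeminorm' t := by
    refine ge_of_tendsto hlim ((Filter.eventually_ne_atTop 0).mono fun n hn => ?_)
    rw [one_div, Real.le_rpow_inv_iff_of_pos (apply_nonneg Q t) (apply_nonneg P _)
      (Nat.cast_pos.2 (Nat.pos_of_ne_zero hn)), Real.rpow_natCast]
    exact hpow n hn
  rwa [hle.antisymm hge] at hlim

end Spectral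

section Norms

variable {k : Type u} [NontriviallyNormedField k] [IsUltrametricDist k] [CompleteSpace k]
  {X Y : Scheme.{u}} [X.Over (Spec (CommRingCat.of k))] [Y.Over (Spec (CommRingCat.of k))]
  (f : Y ⟶ X) [f.IsOver (Spec (CommRingCat.of k))] {L : LineBundle X} {φ : L.Metric k}
  [IsIntegral X] [UniversallyClosed (X ↘ Spec (CommRingCat.of k))]

theorem Metric.quotientAlgNorm_ne_top (hφ : φ.IsAsymptoticFubiniStudy)
    (t : L.RestrictedAlgebra k f) : φ.quotientAlgNorm f t ≠ ⊤ := by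
  obtain ⟨_, s, rfl⟩ := t
  exact ne_top_of_le_ne_top (algNorm_ne_top hφ s) (φ.quotientAlgNorm_le f rfl)

variable [IsReduced Y] [LocallyOfFiniteType (Y ↘ Spec (CommRingCat.of k))]

theorem Metric.exists_algebraNorm_pullback (hφ : φ.IsAsymptoticFubiniStudy) :
    ∃ Q : AlgebraNorm k (L.RestrictedAlgebra k f),
      ∀ t, ENNReal.ofReal (Q t) = (φ.pullback f).algNorm t := by
  obtain ⟨Q, -, hQ⟩ := exists_algebraNorm (k := k) (A := L.RestrictedAlgebra k f)
    (fun t => (φ.pullback f).algNorm t)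
    (fun t => ne_top_of_le_ne_top (φ.quotientAlgNorm_ne_top f hφ t)
      (φ.pullback_algNorm_le_quotientAlgNorm f t))
    (fun _ _ => algNorm_add_le _ _ _) (fun _ _ => algNorm_mul_le _ _ _)
    (fun c _ => algNorm_smul _ c _)
    fun _ ht => Subtype.ext ((φ.pullback f).eq_zero_of_algNorm_eq_zero ht)
  exact ⟨Q, hQ⟩

theorem Metric.exists_algebraNorm_quotient (hφ : φ.IsAsymptoticFubiniStudy) :
    ∃ P : AlgebraNorm k (L.RestrictedAlgebra k f), IsNonarchimedean P ∧
      ∀ t, ENNReal.ofReal (P t) = φ.quotientAlgNorm f t :=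
  exists_algebraNorm (φ.quotientAlgNorm f) (φ.quotientAlgNorm_ne_top f hφ)
    (φ.quotientAlgNorm_add_le f) (φ.quotientAlgNorm_mul_le f (φ.quotientAlgNorm_ne_top f hφ))
    (φ.quotientAlgNorm_smul f) fun t ht => Subtype.ext <|
      (φ.pullback f).eq_zero_of_algNorm_eq_zero <|
        le_zero_iff.1 ((φ.pullback_algNorm_le_quotientAlgNorm f t).trans_eq ht)

end Norms

end LineBundle

end NormedSections

end

theorem mainTheorem3_general {k : Type u} [NontriviallyNormedField k] [IsUltrametricDist k]
    [CompleteSpace k] {X Y : Scheme.{u}}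
    [X.Over (Spec (CommRingCat.of k))] [Y.Over (Spec (CommRingCat.of k))]
    [IsProper (X ↘ Spec (CommRingCat.of k))] [IsIntegral X]
    (f : Y ⟶ X) [f.IsOver (Spec (CommRingCat.of k))] [IsClosedImmersion f]
    [IsReduced Y] [Nonempty Y] (L : NormedSections.LineBundle X)
    (hample : L.IsAmple k) (φ : L.Metric k) (hφ : φ.IsAsymptoticFubiniStudy) :
    ∃ P Q : AlgebraNorm k (L.RestrictedAlgebra k f),
      P 1 = 1 ∧ Q 1 = 1 ∧
      (∀ t, ENNReal.ofReal (P t) = φ.quotientAlgNorm f t) ∧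
      (∀ t, ENNReal.ofReal (Q t) = (φ.pullback f).algNorm t) ∧
      (∀ t, Filter.Tendsto (fun n : ℕ => P (t ^ n) ^ (1 / (n : ℝ))) Filter.atTop (𝓝 (Q t))) ∧
      ∃ h : NormedSections.BerkovichSpectrum k (NormedSections.AlgebraCompletion P) ≃ₜ
          NormedSections.BerkovichSpectrum k (NormedSections.AlgebraCompletion Q),
        ∀ z t, (h z).eval (NormedSections.toCompletion Q t) =
          z.eval (NormedSections.toCompletion P t) := by
  have : LocallyOfFiniteType (Y ↘ Spec (CommRingCat.of k)) := by
    rw [← comp_over f (Spec (CommRingCat.of k))]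
    infer_instance
  have : Nonempty (NormedSections.Analytification k Y) :=
    (NormedSections.exists_analytification_mem ⊤ Set.univ_nonempty).nonempty
  obtain ⟨P, hPna, hP⟩ := φ.exists_algebraNorm_quotient f hφ
  obtain ⟨Q, hQ⟩ := φ.exists_algebraNorm_pullback f hφ
  have hQP (t) : Q t ≤ P t := by
    rw [← ENNReal.ofReal_le_ofReal_iff (apply_nonneg P t), hP, hQ]
    exact φ.pullback_algNorm_le_quotientAlgNorm f t
  have hP1 : P 1 = 1 := ENNReal.ofReal_eq_one.1 ((hP 1).trans (φ.quotientAlgNorm_one f))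
  have hQ1 : Q 1 = 1 := ENNReal.ofReal_eq_one.1 ((hQ 1).trans (φ.pullback f).algNorm_one)
  have hlim := NormedSections.LineBundle.tendsto_pow_one_div f hample hφ hPna hP hQ
  exact ⟨P, Q, hP1, hQ1, hP, hQ, hlim,
    NormedSections.BerkovichSpectrum.exists_homeomorph hQP hlim⟩

theorem mainTheorem3 {k : Type u} [NontriviallyNormedField k] [IsUltrametricDist k]
    [CompleteSpace k] {X Y : Scheme.{u}}
    [X.Over (Spec (CommRingCat.of k))] [Y.Over (Spec (CommRingCat.of k))]
    (hX : NormedSections.IsProjectiveOver k X) [IsIntegral X]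
    (f : Y ⟶ X) [f.IsOver (Spec (CommRingCat.of k))] [IsClosedImmersion f]
    [IsReduced Y] [Nonempty Y]
    (M : X.Modules) (hM : NormedSections.IsInvertible M)
    (hample : (NormedSections.lineBundle M hM).IsAmple k)
    (φ : (NormedSections.lineBundle M hM).Metric k) (hφ : φ.IsAsymptoticFubiniStudy) :
    ∃ P Q : AlgebraNorm k ((NormedSections.lineBundle M hM).RestrictedAlgebra k f),
      P 1 = 1 ∧ Q 1 = 1 ∧
      (∀ t, ENNReal.ofReal (P t) = φ.quotientAlgNorm f t) ∧
      (∀ t, ENNReal.ofReal (Q t) = (φ.pullback f).algNorm t) ∧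
      (∀ t, Filter.Tendsto (fun n : ℕ => P (t ^ n) ^ (1 / (n : ℝ))) Filter.atTop (𝓝 (Q t))) ∧
      ∃ h : NormedSections.BerkovichSpectrum k (NormedSections.AlgebraCompletion P) ≃ₜ
          NormedSections.BerkovichSpectrum k (NormedSections.AlgebraCompletion Q),
        ∀ z t, (h z).eval (NormedSections.toCompletion Q t) =
          z.eval (NormedSections.toCompletion P t) := by
  have := hX.isProper
  exact mainTheorem3_general f _ hample φ hφ
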